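/- Let $p\neq\ell$ be odd primes and $k\ge 1$ an integer such that $p$ is a primitive root modulo $2\ell^k$. Put $e=\varphi(\ell^k)=(\ell-1)\ell^{k-1}$, $q=p^e$, $N=\frac{q-1}{2\ell^k}$, $\zeta_p=e^{2\pi i/p}$, let $\operatorname{Tr}$ be the trace from $\mathbb F_q$ to $\mathbb F_p$, $\eta$ the quadratic character of $\mathbb F_p$ (with $\eta(0)=0$), and $p^*=(-1)^{(p-1)/2}p$. As $e$ is even, $\sqrt q=p^{e/2}$ and $\sqrt{p^*}^{\,e}=(p^*)^{e/2}$ are integers. For $f:\mathbb F_q\to\mathbb F_p$ let $\mathcal W_f(\lambda)=\sum_{x\in\mathbb F_q}\zeta_p^{f(x)-\operatorname{Tr}(\lambda x)}$. The function $f$ is weakly regular bent if $|\mathcal W_f(\lambda)|^2=q$ for all $\lambda$ and there are $f^*:\mathbb F_q\to\mathbb F_p$ (a dual of $f$) and $u\in\mathbb C$, $|u|=1$, with $\mathcal W_f(\lambda)=u\sqrt q\,\zeta_p^{f^*(\lambda)}$ for all $\lambda$. Let $f$ be weakly regular bent with $f(0)=0$ and $f(cx)=c^{k_f}f(x)$ for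 all $c\in\mathbb F_p^*$, $x\in\mathbb F_q$, where $k_f$ is a positive even integer with $\gcd(k_f-1,p-1)=1$, and suppose that its dual satisfies $f^*(0)=0$ and $f^*(cx)=c^2f^*(x)$ for all $c\in\mathbb F_p^*$, $x\in\mathbb F_q$. Then there is a sign $\epsilon\in\{1,-1\}$, necessarily unique, with $\mathcal W_f(\lambda)=\epsilon\sqrt{p^*}^{\,e}\zeta_p^{f^*(\lambda)}$ for all $\lambda$, and the following holds. Let $$D'=\{(x,y)\in\mathbb F_q^2\setminus\{(0,0)\}: f(x)+\operatorname{Tr}(y^N)=0\},\qquad \mathcal C=\{(\operatorname{Tr}(\gamma x+\delta y))_{(x,y)\in D'}:\gamma,\delta\in\mathbb F_q\}.$$ Write $E=\epsilon\sqrt{p^*}^{\,e}$, $B=\frac{q^2}{p^2}(p-1)$, $Z=p^{e-1}+(p-1)\frac Ep$, $Y=p^{e-1}-\frac Ep$, $t_1=\varphi(\ell^k)\bmod p$, $t_2=\ell^{k-1}\bmod p$, $T=\eta(t_1)+(\ell-1)\eta(t_2)$. The code $\mathcal C$ is linear over $\mathbb F_p$ of dimension $2e$. Its length is $\frac{q^2}{p}+E\left(\frac{q(p-1)}p-\frac{(\ell-1)(q-1)}{\ell^k}\right)-1$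 if $\ell\equiv1\pmod p$, and $\frac{q^2}{p}+E\left(\frac{q(p-1)}p-\frac{q-1}{\ell^{k-1}}\right)-1$ if $\ell\not\equiv1\pmod p$. Its weight distribution is given by the tables below, listed as (weight : frequency), to which the row $0:1$ is always to be added; rows of equal weight are added up and rows of frequency $0$ are void. (1) If $\ell\equiv1\pmod p$ and $p\equiv1\pmod4$, then $\mathcal C$ has exactly eight nonzero weights, with - $B$ : $Z-1$ - $B+E\left(\frac{q(p-1)^2}{p^2}+\frac{\sqrt q(p-1)}p-\frac{(\ell-1)(q+\sqrt q)(p-1)}{p\ell^k}\right)$ : $\frac{(q-1)(\ell-1)}{\ell^k}Z$ - $B+E\left(\frac{q(p-1)^2}{p^2}-\frac{(\ell-1)(q+\sqrt q)(p-1)}{p\ell^k}\right)$ : $\frac{(q-1)(\ell^k-\ell+1)}{\ell^k}Z$ - $B+E\left(\frac{q(p-1)}{p}-\frac{(\ell-1)(q-1)(p+1)}{p\ell^k}\right)$ : $\frac{p-1}2Y$ - $B+E\left(\frac{q(p-1)}{p}-\frac{(\ell-1)(q-1)(p-1)}{p\ell^k}\right)$ : $\frac{p-1}2Y$ - $B+E\left(\frac{q(p-1)^2}{p^2}-\frac{2\sqrt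 q}p-\frac{(\ell-1)(\sqrt q+1)(\sqrt q(p-1)-(p+1))}{p\ell^k}\right)$ : $\frac{(q-1)(\ell-1)(p-1)}{2\ell^k}Y$ - $B+E\left(\frac{q(p-1)^2}{p^2}-\frac{(\ell-1)(\sqrt q+1)(\sqrt q(p-1)-(p+1))}{p\ell^k}\right)$ : $\frac{(q-1)(\ell^k-\ell+1)(p-1)}{2\ell^k}Y$ - $B+E\left(\frac{q(p-1)^2}{p^2}-\frac{(\ell-1)(q-1)(p-1)}{p\ell^k}\right)$ : $\frac{(p-1)(q-1)}{2}Y$ (2) If $\ell\equiv1\pmod p$ and $p\equiv3\pmod4$, then $\mathcal C$ has exactly six nonzero weights, with - $B$ : $Z-1$ - $B+E\left(\frac{q(p-1)^2}{p^2}+\frac{\sqrt q(p-1)}p-\frac{(\ell-1)(q+\sqrt q)(p-1)}{p\ell^k}\right)$ : $\frac{(q-1)(\ell-1)}{\ell^k}Z$ - $B+E\left(\frac{q(p-1)^2}{p^2}-\frac{(\ell-1)(q+\sqrt q)(p-1)}{p\ell^k}\right)$ : $\frac{(q-1)(\ell^k-\ell+1)}{\ell^k}Z$ - $B+E\left(\frac{q(p-1)}{p}-\frac{(\ell-1)(q-1)}{\ell^k}\right)$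 : $(p-1)Y$ - $B+E\left(\frac{q(p-1)^2}{p^2}-\frac{2\sqrt q}p-\frac{(\ell-1)(\sqrt q+1)(\sqrt q(p-1)-p)}{p\ell^k}\right)$ : $\frac{(q-1)(\ell-1)(p-1)}{2\ell^k}Y$ - $B+E\left(\frac{q(p-1)^2}{p^2}-\frac{(\ell-1)(\sqrt q+1)(\sqrt q(p-1)-p)}{p\ell^k}\right)$ : $\frac{(q-1)(2\ell^k-\ell+1)(p-1)}{2\ell^k}Y$ (3a) If $\ell\not\equiv1\pmod p$, $p\equiv1\pmod4$ and $\eta(t_1)=\eta(t_2)$, then the table is - $B$ : $Z-1$ - $B+E\left(\frac{q(p-1)^2}{p^2}+\frac{\sqrt q(p-1)}p-\frac{(q+\sqrt q)(p-1)}{p\ell^{k-1}}\right)$ : $\frac{q-1}{\ell^{k-1}}Z$ - $B+E\left(\frac{q(p-1)^2}{p^2}-\frac{(q+\sqrt q)(p-1)}{p\ell^{k-1}}\right)$ : $\frac{(q-1)(\ell^{k-1}-1)}{\ell^{k-1}}Z$ - $B+E\left(\frac{q(p-1)}{p}-\frac{(q-1)(p\ell+T)}{p\ell^k}\right)$ :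 $\frac{p-1}2Y$ - $B+E\left(\frac{q(p-1)}{p}-\frac{(q-1)(p\ell-T)}{p\ell^k}\right)$ : $\frac{p-1}2Y$ - $B+E\left(\frac{q(p-1)^2}{p^2}-\frac{2\sqrt q}p-\frac{q-1}{\ell^{k-1}}+\frac{(\sqrt q+1)(\ell\sqrt q+\eta(t_1)T)}{p\ell^k}\right)$ : $\frac{(q-1)(p-1)}{2\ell^{k-1}}Y$ - $B+E\left(\frac{q(p-1)^2}{p^2}-\frac{q-1}{\ell^{k-1}}+\frac{(\sqrt q+1)(\ell\sqrt q-\eta(t_1)T)}{p\ell^k}\right)$ : $\frac{(p-1)(q-1)}{2}Y$ - $B+E\left(\frac{q(p-1)^2}{p^2}-\frac{q-1}{\ell^{k-1}}+\frac{(\sqrt q+1)(\ell\sqrt q+\eta(t_1)T)}{p\ell^k}\right)$ : $\frac{(p-1)(q-1)(\ell^{k-1}-1)}{2\ell^{k-1}}Y$ and, if $k\ge2$, $\mathcal C$ has exactly eight nonzero weights. (3b) If $\ell\not\equiv1\pmod p$, $p\equiv1\pmod4$ and $\eta(t_1)=-\eta(t_2)$, then the table consists of the first five rows of (3a) and - $B+E\left(\frac{q(p-1)^2}{p^2}-\frac{2\sqrt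 q}p-\frac{q-1}{\ell^{k-1}}+\frac{(\sqrt q+1)(\ell\sqrt q+\eta(t_1)T)}{p\ell^k}\right)$ : $\frac{(q-1)(p-1)}{2\ell^{k}}Y$ - $B+E\left(\frac{q(p-1)^2}{p^2}-\frac{q-1}{\ell^{k-1}}+\frac{(\sqrt q+1)(\ell\sqrt q+\eta(t_1)T)}{p\ell^k}\right)$ : $\frac{(q-1)(p-1)(\ell^{k}-1)}{2\ell^{k}}Y$ - $B+E\left(\frac{q(p-1)^2}{p^2}-\frac{2\sqrt q}p-\frac{q-1}{\ell^{k-1}}+\frac{(\sqrt q+1)(\ell\sqrt q-\eta(t_1)T)}{p\ell^k}\right)$ : $\frac{(q-1)(p-1)(\ell-1)}{2\ell^{k}}Y$ - $B+E\left(\frac{q(p-1)^2}{p^2}-\frac{q-1}{\ell^{k-1}}+\frac{(\sqrt q+1)(\ell\sqrt q-\eta(t_1)T)}{p\ell^k}\right)$ : $\frac{(q-1)(p-1)(\ell^{k}-\ell+1)}{2\ell^{k}}Y$ and, if $k\ge2$, $\mathcal C$ has exactly nine nonzero weights. (4) If $\ell\not\equiv1\pmod p$ and $p\equiv3\pmod4$,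 then the table is - $B$ : $Z-1$ - $B+E\left(\frac{q(p-1)^2}{p^2}+\frac{\sqrt q(p-1)}p-\frac{(q+\sqrt q)(p-1)}{p\ell^{k-1}}\right)$ : $\frac{q-1}{\ell^{k-1}}Z$ - $B+E\left(\frac{q(p-1)^2}{p^2}-\frac{(q+\sqrt q)(p-1)}{p\ell^{k-1}}\right)$ : $\frac{(q-1)(\ell^{k-1}-1)}{\ell^{k-1}}Z$ - $B+E\left(\frac{q(p-1)}{p}-\frac{q-1}{\ell^{k-1}}\right)$ : $(p-1)Y$ - $B+E\left(\frac{q(p-1)^2}{p^2}-\frac{2\sqrt q}p-\frac{(\sqrt q+1)(\sqrt q(p-1)-p)}{p\ell^{k-1}}\right)$ : $\frac{(q-1)(p-1)}{2\ell^{k-1}}Y$ - $B+E\left(\frac{q(p-1)^2}{p^2}-\frac{(\sqrt q+1)(\sqrt q(p-1)-p)}{p\ell^{k-1}}\right)$ : $\frac{(q-1)(p-1)(2\ell^{k-1}-1)}{2\ell^{k-1}}Y$ and, if $k\ge2$, $\mathcal C$ has exactly six nonzero weights. -/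

import Mathlib

namespace BentCode

section Bent

variable {p : ℕ} [Fact p.Prime] {F : Type*} [Field F] [Fintype F] [Algebra (ZMod p) F]

/-- The Walsh transform `W_f(a) = ∑ x, ζ_p ^ (f x - Tr (a x))`, with `ζ_p = exp (2πi/p)`
(`ZMod.stdAddChar j = exp (2πi j/p)`) and `Tr` the absolute trace of `F`. -/
noncomputable def walsh (f : F → ZMod p) (a : F) : ℂ :=
  ∑ x : F, ZMod.stdAddChar (f x - Algebra.trace (ZMod p) F (a * x))

/-- `f` is bent: `|W_f(a)|² = |F|` for all `a`. -/
def IsBent (f : F → ZMod p) : Prop :=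
  ∀ a : F, ‖walsh f a‖ ^ 2 = (Fintype.card F : ℝ)

/-- `fs` is a dual of `f`: `W_f(a) = u |F|^{1/2} ζ_p ^ (fs a)` for all `a`, where `u` is a complex
number of modulus one that does not depend on `a`. -/
def IsDual (f fs : F → ZMod p) : Prop :=
  ∃ u : ℂ, ‖u‖ = 1 ∧
    ∀ a : F, walsh f a = u * (Real.sqrt (Fintype.card F) : ℂ) * ZMod.stdAddChar (fs a)

/-- `f` is weakly regular bent. -/
def IsWeaklyRegularBent (f : F → ZMod p) : Prop :=
  IsBent f ∧ ∃ fs : F → ZMod p, IsDual f fs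

/-- The class `RF`: weakly regular bent functions with `f 0 = 0` and `f (c x) = c ^ kf * f x` for
`c ∈ 𝔽_p^*`, for some positive even `kf` with `gcd (kf - 1, p - 1) = 1`. -/
def MemRF (f : F → ZMod p) : Prop :=
  IsWeaklyRegularBent f ∧ f 0 = 0 ∧
    ∃ kf : ℕ, 0 < kf ∧ Even kf ∧ Nat.gcd (kf - 1) (p - 1) = 1 ∧
      ∀ c : ZMod p, c ≠ 0 → ∀ x : F, f (c • x) = c ^ kf * f x

open Classical in
/-- The defining set `{(x, y) ≠ (0, 0) : f x + Tr (y ^ N) = 0}`. -/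
noncomputable def definingSet (f : F → ZMod p) (N : ℕ) : Finset (F × F) :=
  Finset.univ.filter fun z => z ≠ 0 ∧ f z.1 + Algebra.trace (ZMod p) F (z.2 ^ N) = 0

variable (p) in
/-- The map sending `(γ, δ)` to the word `(Tr (γ x + δ y))`, indexed by `(x, y) ∈ D`. -/
noncomputable def codeword (D : Finset (F × F)) : (F × F) →ₗ[ZMod p] (D → ZMod p) where
  toFun g := fun z => Algebra.trace (ZMod p) F (g.1 * z.1.1 + g.2 * z.1.2)
  map_add' g h := by
    funext z
    simp only [Prod.fst_add, Prod.snd_add, Pi.add_apply, ← map_add]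
    congr 1
    ring
  map_smul' c g := by
    funext z
    simp only [Prod.smul_fst, Prod.smul_snd, smul_mul_assoc, ← smul_add, map_smul,
      RingHom.id_apply, Pi.smul_apply]

variable (p) in
/-- The linear code over `𝔽_p` with defining set `D`; its length is `D.card`. -/
noncomputable def code (D : Finset (F × F)) : Submodule (ZMod p) (D → ZMod p) :=
  LinearMap.range (codeword p D)

end Bent

section Weights

variable {p : ℕ} {ι : Type*} [Fintype ι]

/-- The number of codewords of `C` of Hamming weight `w` (`w` rational, so that the value of any
formula can be inserted). -/
noncomputable def weightCount (C : Submodule (ZMod p) (ι → ZMod p)) (w : ℚ) : ℕ :=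
  {c : ι → ZMod p | c ∈ C ∧ (hammingNorm c : ℚ) = w}.ncard

/-- `C` has the weight distribution given by a table of pairs (weight, frequency): the number of
codewords of weight `w` is the sum of the frequencies of the rows with weight `w`. -/
def HasWeightDistribution (C : Submodule (ZMod p) (ι → ZMod p)) (table : List (ℚ × ℚ)) : Prop :=
  ∀ w : ℚ, (weightCount C w : ℚ) =
    ((table.filter fun r => decide (r.1 = w)).map Prod.snd).sum

/-- The number of distinct nonzero weights; `C` is a `t`-weight code if this number is `t`. -/
noncomputable def numWeights (C : Submodule (ZMod p) (ι → ZMod p)) : ℕ :=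
  {w : ℕ | w ≠ 0 ∧ ∃ c ∈ C, hammingNorm c = w}.ncard

end Weights

/-- `p^* = (-1)^{(p-1)/2} p`. -/
def pStar (p : ℕ) : ℤ := (-1) ^ ((p - 1) / 2) * p

/-- `(√p^*)^e` for even `e`, an integer. -/
def sqrtPStarPow (p e : ℕ) : ℤ := pStar p ^ (e / 2)

/-- For even `e`, `sqrtPStarPow p e` is the `e`-th power of either square root of `p^*`. -/
theorem pow_eq_sqrtPStarPow (p e : ℕ) (he : Even e) (s : ℂ) (hs : s ^ 2 = (pStar p : ℂ)) :
    s ^ e = (sqrtPStarPow p e : ℂ) := by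
  obtain ⟨m, rfl⟩ := he.two_dvd
  rw [pow_mul, hs, sqrtPStarPow, Nat.mul_div_cancel_left m two_pos, Int.cast_pow]

section Tables

/-! In what follows `e` is even, `q = p ^ e`, `s = √q = p ^ (e / 2)`, `E = ε (√p^*)^e`,
`Z = p^{e-1} + ε (p-1) (√p^*)^e / p` and `Y = p^{e-1} - ε (√p^*)^e / p`. -/

/-- The length when `ℓ ≡ 1 (mod p)`. -/
def lengthOne (p ℓ k e : ℕ) (ε : ℤ) : ℚ :=
  let q : ℚ := (p : ℚ) ^ e
  let E : ℚ := (ε : ℚ) * sqrtPStarPow p e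
  q ^ 2 / p + E * (q * (p - 1) / p - (ℓ - 1) * (q - 1) / (ℓ : ℚ) ^ k) - 1

/-- The length when `ℓ ≢ 1 (mod p)`. -/
def lengthNotOne (p ℓ k e : ℕ) (ε : ℤ) : ℚ :=
  let q : ℚ := (p : ℚ) ^ e
  let E : ℚ := (ε : ℚ) * sqrtPStarPow p e
  q ^ 2 / p + E * (q * (p - 1) / p - (q - 1) / (ℓ : ℚ) ^ (k - 1)) - 1

/-- The table for `ℓ ≡ 1 (mod p)`, `p ≡ 1 (mod 4)`. -/
def tableOneOne (p ℓ k e : ℕ) (ε : ℤ) : List (ℚ × ℚ) :=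
  let q : ℚ := (p : ℚ) ^ e
  let s : ℚ := (p : ℚ) ^ (e / 2)
  let E : ℚ := (ε : ℚ) * sqrtPStarPow p e
  let Z : ℚ := (p : ℚ) ^ (e - 1) + (p - 1) * E / p
  let Y : ℚ := (p : ℚ) ^ (e - 1) - E / p
  let L : ℚ := (ℓ : ℚ) ^ k
  [(0, 1),
   (q ^ 2 / p ^ 2 * (p - 1), Z - 1),
   (q ^ 2 / p ^ 2 * (p - 1) + E * (q / p ^ 2 * (p - 1) ^ 2 + s * (p - 1) / p
      - (ℓ - 1) * (q + s) * (p - 1) / (p * L)),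
    (q - 1) * (ℓ - 1) / L * Z),
   (q ^ 2 / p ^ 2 * (p - 1) + E * (q / p ^ 2 * (p - 1) ^ 2
      - (ℓ - 1) * (q + s) * (p - 1) / (p * L)),
    (q - 1) * (L - ℓ + 1) / L * Z),
   (q ^ 2 / p ^ 2 * (p - 1) + E * (q / p * (p - 1) - (ℓ - 1) * (q - 1) / (p * L) * (p + 1)),
    (p - 1) / 2 * Y),
   (q ^ 2 / p ^ 2 * (p - 1) + E * (q / p * (p - 1) - (ℓ - 1) * (q - 1) / (p * L) * (p - 1)),
    (p - 1) / 2 * Y),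
   (q ^ 2 / p ^ 2 * (p - 1) + E * (q / p ^ 2 * (p - 1) ^ 2 - 2 * s / p
      - (ℓ - 1) * (s + 1) / (p * L) * (s * (p - 1) - (p + 1))),
    (q - 1) * (ℓ - 1) * (p - 1) / (2 * L) * Y),
   (q ^ 2 / p ^ 2 * (p - 1) + E * (q / p ^ 2 * (p - 1) ^ 2
      - (ℓ - 1) * (s + 1) / (p * L) * (s * (p - 1) - (p + 1))),
    (q - 1) * (L - ℓ + 1) * (p - 1) / (2 * L) * Y),
   (q ^ 2 / p ^ 2 * (p - 1) + E * (q / p ^ 2 * (p - 1) ^ 2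
      - (ℓ - 1) * (q - 1) / (p * L) * (p - 1)),
    (p - 1) * (q - 1) / 2 * Y)]

/-- The table for `ℓ ≡ 1 (mod p)`, `p ≡ 3 (mod 4)`. -/
def tableOneThree (p ℓ k e : ℕ) (ε : ℤ) : List (ℚ × ℚ) :=
  let q : ℚ := (p : ℚ) ^ e
  let s : ℚ := (p : ℚ) ^ (e / 2)
  let E : ℚ := (ε : ℚ) * sqrtPStarPow p e
  let Z : ℚ := (p : ℚ) ^ (e - 1) + (p - 1) * E / p
  let Y : ℚ := (p : ℚ) ^ (e - 1) - E / p
  let L : ℚ := (ℓ : ℚ) ^ k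
  [(0, 1),
   (q ^ 2 / p ^ 2 * (p - 1), Z - 1),
   (q ^ 2 / p ^ 2 * (p - 1) + E * (q / p ^ 2 * (p - 1) ^ 2 + s * (p - 1) / p
      - (ℓ - 1) * (q + s) * (p - 1) / (p * L)),
    (q - 1) * (ℓ - 1) / L * Z),
   (q ^ 2 / p ^ 2 * (p - 1) + E * (q / p ^ 2 * (p - 1) ^ 2
      - (ℓ - 1) * (q + s) * (p - 1) / (p * L)),
    (q - 1) * (L - ℓ + 1) / L * Z),
   (q ^ 2 / p ^ 2 * (p - 1) + E * (q / p * (p - 1) - (ℓ - 1) * (q - 1) / L),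
    (p - 1) * Y),
   (q ^ 2 / p ^ 2 * (p - 1) + E * (q / p ^ 2 * (p - 1) ^ 2 - 2 * s / p
      - (ℓ - 1) * (s + 1) / (p * L) * (s * (p - 1) - p)),
    (q - 1) * (ℓ - 1) * (p - 1) / (2 * L) * Y),
   (q ^ 2 / p ^ 2 * (p - 1) + E * (q / p ^ 2 * (p - 1) ^ 2
      - (ℓ - 1) * (s + 1) / (p * L) * (s * (p - 1) - p)),
    (q - 1) * (2 * L - ℓ + 1) * (p - 1) / (2 * L) * Y)]

/-- The table for `ℓ ≢ 1 (mod p)`, `p ≡ 1 (mod 4)` and `η(t₁) = η(t₂)`; the arguments `h₁`, `h₂`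
stand for `η(t₁)` and `η(t₂)`. -/
def tableNotOneOneEq (p ℓ k e : ℕ) (ε h₁ h₂ : ℤ) : List (ℚ × ℚ) :=
  let q : ℚ := (p : ℚ) ^ e
  let s : ℚ := (p : ℚ) ^ (e / 2)
  let E : ℚ := (ε : ℚ) * sqrtPStarPow p e
  let Z : ℚ := (p : ℚ) ^ (e - 1) + (p - 1) * E / p
  let Y : ℚ := (p : ℚ) ^ (e - 1) - E / p
  let L : ℚ := (ℓ : ℚ) ^ k
  let M : ℚ := (ℓ : ℚ) ^ (k - 1)
  let T : ℚ := h₁ + (ℓ - 1) * h₂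
  [(0, 1),
   (q ^ 2 / p ^ 2 * (p - 1), Z - 1),
   (q ^ 2 / p ^ 2 * (p - 1) + E * (q / p ^ 2 * (p - 1) ^ 2 + s * (p - 1) / p
      - (q + s) * (p - 1) / (p * M)),
    (q - 1) / M * Z),
   (q ^ 2 / p ^ 2 * (p - 1) + E * (q / p ^ 2 * (p - 1) ^ 2 - (q + s) * (p - 1) / (p * M)),
    (q - 1) * (M - 1) / M * Z),
   (q ^ 2 / p ^ 2 * (p - 1) + E * (q / p * (p - 1) - (q - 1) * (p * ℓ + T) / (p * L)),
    (p - 1) / 2 * Y),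
   (q ^ 2 / p ^ 2 * (p - 1) + E * (q / p * (p - 1) - (q - 1) * (p * ℓ - T) / (p * L)),
    (p - 1) / 2 * Y),
   (q ^ 2 / p ^ 2 * (p - 1) + E * (q / p ^ 2 * (p - 1) ^ 2 - 2 * s / p - (q - 1) / M
      + (s + 1) * (ℓ * s + h₁ * T) / (p * L)),
    (q - 1) * (p - 1) / (2 * M) * Y),
   (q ^ 2 / p ^ 2 * (p - 1) + E * (q / p ^ 2 * (p - 1) ^ 2 - (q - 1) / M
      + (s + 1) * (ℓ * s - h₁ * T) / (p * L)),
    (p - 1) * (q - 1) / 2 * Y),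
   (q ^ 2 / p ^ 2 * (p - 1) + E * (q / p ^ 2 * (p - 1) ^ 2 - (q - 1) / M
      + (s + 1) * (ℓ * s + h₁ * T) / (p * L)),
    (p - 1) * (q - 1) * (M - 1) / (2 * M) * Y)]

/-- The table for `ℓ ≢ 1 (mod p)`, `p ≡ 1 (mod 4)` and `η(t₁) = -η(t₂)`; the arguments `h₁`, `h₂`
stand for `η(t₁)` and `η(t₂)`. -/
def tableNotOneOneNeg (p ℓ k e : ℕ) (ε h₁ h₂ : ℤ) : List (ℚ × ℚ) :=
  let q : ℚ := (p : ℚ) ^ e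
  let s : ℚ := (p : ℚ) ^ (e / 2)
  let E : ℚ := (ε : ℚ) * sqrtPStarPow p e
  let Z : ℚ := (p : ℚ) ^ (e - 1) + (p - 1) * E / p
  let Y : ℚ := (p : ℚ) ^ (e - 1) - E / p
  let L : ℚ := (ℓ : ℚ) ^ k
  let M : ℚ := (ℓ : ℚ) ^ (k - 1)
  let T : ℚ := h₁ + (ℓ - 1) * h₂
  [(0, 1),
   (q ^ 2 / p ^ 2 * (p - 1), Z - 1),
   (q ^ 2 / p ^ 2 * (p - 1) + E * (q / p ^ 2 * (p - 1) ^ 2 + s * (p - 1) / p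
      - (q + s) * (p - 1) / (p * M)),
    (q - 1) / M * Z),
   (q ^ 2 / p ^ 2 * (p - 1) + E * (q / p ^ 2 * (p - 1) ^ 2 - (q + s) * (p - 1) / (p * M)),
    (q - 1) * (M - 1) / M * Z),
   (q ^ 2 / p ^ 2 * (p - 1) + E * (q / p * (p - 1) - (q - 1) * (p * ℓ + T) / (p * L)),
    (p - 1) / 2 * Y),
   (q ^ 2 / p ^ 2 * (p - 1) + E * (q / p * (p - 1) - (q - 1) * (p * ℓ - T) / (p * L)),
    (p - 1) / 2 * Y),
   (q ^ 2 / p ^ 2 * (p - 1) + E * (q / p ^ 2 * (p - 1) ^ 2 - 2 * s / p - (q - 1) / M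
      + (s + 1) * (ℓ * s + h₁ * T) / (p * L)),
    (q - 1) * (p - 1) / (2 * L) * Y),
   (q ^ 2 / p ^ 2 * (p - 1) + E * (q / p ^ 2 * (p - 1) ^ 2 - (q - 1) / M
      + (s + 1) * (ℓ * s + h₁ * T) / (p * L)),
    (q - 1) * (p - 1) * (L - 1) / (2 * L) * Y),
   (q ^ 2 / p ^ 2 * (p - 1) + E * (q / p ^ 2 * (p - 1) ^ 2 - 2 * s / p - (q - 1) / M
      + (s + 1) * (ℓ * s - h₁ * T) / (p * L)),
    (q - 1) * (p - 1) * (ℓ - 1) / (2 * L) * Y),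
   (q ^ 2 / p ^ 2 * (p - 1) + E * (q / p ^ 2 * (p - 1) ^ 2 - (q - 1) / M
      + (s + 1) * (ℓ * s - h₁ * T) / (p * L)),
    (q - 1) * (p - 1) * (L - ℓ + 1) / (2 * L) * Y)]

/-- The table for `ℓ ≢ 1 (mod p)`, `p ≡ 3 (mod 4)`. -/
def tableNotOneThree (p ℓ k e : ℕ) (ε : ℤ) : List (ℚ × ℚ) :=
  let q : ℚ := (p : ℚ) ^ e
  let s : ℚ := (p : ℚ) ^ (e / 2)
  let E : ℚ := (ε : ℚ) * sqrtPStarPow p e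
  let Z : ℚ := (p : ℚ) ^ (e - 1) + (p - 1) * E / p
  let Y : ℚ := (p : ℚ) ^ (e - 1) - E / p
  let M : ℚ := (ℓ : ℚ) ^ (k - 1)
  [(0, 1),
   (q ^ 2 / p ^ 2 * (p - 1), Z - 1),
   (q ^ 2 / p ^ 2 * (p - 1) + E * (q / p ^ 2 * (p - 1) ^ 2 + s * (p - 1) / p
      - (q + s) * (p - 1) / (p * M)),
    (q - 1) / M * Z),
   (q ^ 2 / p ^ 2 * (p - 1) + E * (q / p ^ 2 * (p - 1) ^ 2 - (q + s) * (p - 1) / (p * M)),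
    (q - 1) * (M - 1) / M * Z),
   (q ^ 2 / p ^ 2 * (p - 1) + E * (q / p * (p - 1) - (q - 1) / M),
    (p - 1) * Y),
   (q ^ 2 / p ^ 2 * (p - 1) + E * (q / p ^ 2 * (p - 1) ^ 2 - 2 * s / p
      - (s + 1) / (p * M) * (s * (p - 1) - p)),
    (q - 1) * (p - 1) / (2 * M) * Y),
   (q ^ 2 / p ^ 2 * (p - 1) + E * (q / p ^ 2 * (p - 1) ^ 2
      - (s + 1) / (p * M) * (s * (p - 1) - p)),
    (q - 1) * (p - 1) * (2 * M - 1) / (2 * M) * Y)]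

end Tables

end BentCode

/-!
Orthogonality of additive characters expresses the number of `z ∈ D'` on a hyperplane
`Tr (γ x + δ y) = 0` through exponential sums in `f` and in `y ↦ Tr (y ^ N)`. Conjugating the Walsh
transform by `ζ ↦ ζ ^ t` evaluates the sums in `f`: the function `t f` has dual `t⁻¹ f^*` and the
same integral value `E = W_f(0) = ± p ^ m` at the origin, where `e = 2 m`.

The primitive root hypothesis makes `2 ℓ ^ k` a divisor of `p ^ m + 1`. Hence `p ^ m - 1` divides
`N`, and `y ↦ Tr (y ^ N)` is invariant under multiplication by the subfield of `p ^ m` elements.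
Averaging over that subfield evaluates the sums in `y`: they only involve the value of `Tr (y ^ N)`
at one point `b / δ` and the numbers `u`, `v` of `y ≠ 0` for which `-Tr (y ^ N)` is a nonzero
square, respectively a nonsquare. As `y ^ N` runs over the roots of unity of order dividing
`2 ℓ ^ k`, whose traces are explicit because `p` generates the units modulo `ℓ ^ k`, so are `u` and
`v`.

The weight of a word therefore depends only on `η(f^*(γ))` and `η(-Tr ((b / δ) ^ N))`, which yields
one table in `E`, `u`, `v`; the tables of the different cases are its specialisations.
-/

namespace BentCode

open Finset

variable {p : ℕ} [Fact p.Prime] {F : Type*} [Field F] [Fintype F] [Algebra (ZMod p) F]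

local notation "ψ" => (ZMod.stdAddChar : AddChar (ZMod _) ℂ)

local notation "Tr" => Algebra.trace (ZMod p) F

section AdditiveCharacters

theorem isPrimitiveRoot_stdAddChar {t : ZMod p} (ht : t ≠ 0) : IsPrimitiveRoot (ψ t) p := by
  rw [IsPrimitiveRoot.iff_orderOf, orderOf_eq_prime_iff, ← AddChar.map_nsmul_eq_pow,
    nsmul_eq_mul, CharP.cast_eq_zero, zero_mul, AddChar.map_zero_eq_one]
  exact ⟨rfl, fun h => ht (ZMod.injective_stdAddChar (h.trans (AddChar.map_zero_eq_one _).symm))⟩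

theorem stdAddChar_mul_eq_pow (t a : ZMod p) : ψ (t * a) = ψ t ^ a.val := by
  rw [← AddChar.map_nsmul_eq_pow, nsmul_eq_mul, ZMod.natCast_zmod_val, mul_comm]

/- Both sums are values, at `ψ 1` and at `ψ t`, of one polynomial with integer coefficients, and
these two numbers are conjugate over `ℚ`. -/
theorem sum_mul_stdAddChar_mul_eq_zero {ι : Type*} [Fintype ι] (c : ι → ℤ) (g : ι → ZMod p)
    {t : ZMod p} (ht : t ≠ 0) (h : ∑ i, (c i : ℂ) * ψ (g i) = 0) :
    ∑ i, (c i : ℂ) * ψ (t * g i) = 0 := by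
  have hp : p.Prime := Fact.out
  let P : Polynomial ℤ := ∑ i, Polynomial.C (c i) * Polynomial.X ^ (g i).val
  have aeval_P (u : ZMod p) : Polynomial.aeval (ψ u) P = ∑ i, (c i : ℂ) * ψ (u * g i) := by
    simp [P, stdAddChar_mul_eq_pow]
  have minpoly_eq {u : ZMod p} (hu : u ≠ 0) : minpoly ℤ (ψ u) = Polynomial.cyclotomic p ℤ :=
    (Polynomial.cyclotomic_eq_minpoly (isPrimitiveRoot_stdAddChar hu) hp.pos).symm
  have hdvd : minpoly ℤ (ψ 1) ∣ P :=
    minpoly.isIntegrallyClosed_dvd ((isPrimitiveRoot_stdAddChar one_ne_zero).isIntegral hp.pos)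
      (by rw [aeval_P]; simpa using h)
  obtain ⟨R, hR⟩ := hdvd
  rw [← aeval_P, hR, minpoly_eq one_ne_zero, ← minpoly_eq ht, map_mul, minpoly.aeval, zero_mul]

theorem sum_stdAddChar_mul_eq_intCast {ι : Type*} [Fintype ι] {g : ι → ZMod p} {E : ℤ}
    (h : ∑ i, ψ (g i) = E) {t : ZMod p} (ht : t ≠ 0) : ∑ i, ψ (t * g i) = E := by
  have hconj := sum_mul_stdAddChar_mul_eq_zero (ι := Option ι)
    (fun o => o.elim (-E) fun _ => 1) (fun o => o.elim 0 g) ht (by simp [Fintype.sum_option, h])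
  simp only [Fintype.sum_option, Option.elim_none, Option.elim_some, mul_zero,
    AddChar.map_zero_eq_one, Int.cast_neg, Int.cast_one, mul_one, one_mul] at hconj
  exact (neg_add_eq_zero.mp hconj).symm

theorem sum_stdAddChar_mul (a : ZMod p) :
    ∑ z : ZMod p, ψ (z * a) = if a = 0 then (p : ℂ) else 0 := by
  rw [AddChar.sum_mulShift a (ZMod.isPrimitive_stdAddChar p), ZMod.card]
  split_ifs <;> simp

theorem sum_stdAddChar_comp {ι : Type*} [Fintype ι] (g : ι → ZMod p) :
    ∑ i, ψ (g i) = ∑ a : ZMod p, (#{i | g i = a} : ℂ) * ψ a := by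
  rw [← sum_fiberwise univ g]
  refine sum_congr rfl fun a _ => ?_
  rw [sum_congr rfl (g := fun _ => ψ a) fun x hx => by rw [(mem_filter.mp hx).2], sum_const,
    nsmul_eq_mul]

theorem card_fiber_of_sum_eq {ι : Type*} [Fintype ι] {g : ι → ZMod p} {E : ℤ}
    (h : ∑ i, ψ (g i) = E) (a : ZMod p) :
    (p : ℤ) * #{i | g i = a} = Fintype.card ι - E + if a = 0 then p * E else 0 := by
  have hsum (t : ZMod p) : ∑ i, ψ (t * (g i - a)) =
      (if t = 0 then (Fintype.card ι : ℂ) - E else 0) + E * ψ (t * -a) := by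
    rcases eq_or_ne t 0 with rfl | ht
    · simp
    · simp_rw [if_neg ht, zero_add, ← sum_stdAddChar_mul_eq_intCast h ht, sum_mul,
        ← AddChar.map_add_eq_mul, sub_eq_add_neg, mul_add]
  have hcount : (p : ℂ) * #{i | g i = a} = ∑ t : ZMod p, ∑ i, ψ (t * (g i - a)) := by
    rw [sum_comm]
    simp only [sum_stdAddChar_mul, sub_eq_zero, ← sum_filter, sum_const, nsmul_eq_mul, mul_comm]
  simp only [hsum, sum_add_distrib, ← mul_sum, sum_stdAddChar_mul, neg_eq_zero, sum_ite_eq',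
    mem_univ, if_true, mul_ite, mul_zero] at hcount
  rw [mul_comm (E : ℂ)] at hcount
  exact_mod_cast hcount

theorem sum_stdAddChar_trace [DecidableEq F] (a : F) :
    ∑ x : F, ψ (Tr (a * x)) = if a = 0 then (Fintype.card F : ℂ) else 0 := by
  let φ : AddChar F ℂ := (ψ).compAddMonoidHom
    ((Tr).toAddMonoidHom.comp (AddMonoidHom.mulLeft a))
  have hφ : φ = 0 ↔ a = 0 := by
    refine ⟨fun h => (traceForm_nondegenerate (ZMod p) F).1 a fun b => ?_, ?_⟩
    · exact ZMod.injective_stdAddChar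
        ((DFunLike.congr_fun h b).trans (AddChar.map_zero_eq_one _).symm)
    · rintro rfl
      ext x
      simp [φ]
  simp_rw [← hφ]
  exact AddChar.sum_eq_ite φ

end AdditiveCharacters

section Walsh

theorem walsh_zero (f : F → ZMod p) : walsh f 0 = ∑ x : F, ψ (f x) := by
  simp [walsh]

theorem sum_walsh_mul (f : F → ZMod p) (y : F) :
    ∑ a : F, walsh f a * ψ (Tr (a * y)) = (Fintype.card F : ℂ) * ψ (f y) := by
  classical
  have inner_sum (x : F) : ∑ a : F, ψ (f x - Tr (a * x)) * ψ (Tr (a * y)) =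
      if y = x then (Fintype.card F : ℂ) * ψ (f x) else 0 :=
    calc _ = ψ (f x) * ∑ a : F, ψ (Tr ((y - x) * a)) := by
          rw [mul_sum]
          refine sum_congr rfl fun a _ => ?_
          rw [← AddChar.map_add_eq_mul, ← AddChar.map_add_eq_mul, sub_mul, map_sub, mul_comm y,
            mul_comm x]
          ring_nf
      _ = _ := by rw [sum_stdAddChar_trace, mul_ite, mul_zero, mul_comm, sub_eq_zero]
  simp only [walsh, sum_mul]
  rw [sum_comm]
  simp only [inner_sum, sum_ite_eq, mem_univ, if_true]

theorem IsBent.sum_ne_zero {f : F → ZMod p} (hf : IsBent f) : ∑ x : F, ψ (f x) ≠ 0 := by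
  intro h
  have hnorm := hf 0
  rw [walsh_zero, h] at hnorm
  simp [eq_comm] at hnorm

theorem sum_comp_smul {M : Type*} [AddCommMonoid M] {c : ZMod p} (hc : c ≠ 0) (g : F → M) :
    ∑ x : F, g (c • x) = ∑ x : F, g x :=
  Fintype.sum_bijective (fun x : F => c • x) (MulAction.bijective₀ hc) _ _ fun _ => rfl

namespace IsDual

variable {f fs : F → ZMod p}

theorem walsh_eq (hd : IsDual f fs) (h0 : fs 0 = 0) (a : F) :
    walsh f a = (∑ x : F, ψ (f x)) * ψ (fs a) := by
  obtain ⟨u, -, hu⟩ := hd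
  have hu0 := hu 0
  rw [h0, AddChar.map_zero_eq_one, mul_one, walsh_zero] at hu0
  rw [hu a, hu0]

theorem sum_stdAddChar_mul (hd : IsDual f fs) (h0 : fs 0 = 0) {t : ZMod p} (ht : t ≠ 0) (a : F) :
    ∑ x : F, ψ (t * (f x - Tr (a * x))) = (∑ x : F, ψ (t * f x)) * ψ (t * fs a) := by
  have hwalsh := hd.walsh_eq h0 a
  simp only [walsh, sum_mul, ← AddChar.map_add_eq_mul] at hwalsh
  have hconj := sum_mul_stdAddChar_mul_eq_zero (ι := F ⊕ F) (Sum.elim (fun _ => 1) fun _ => -1)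
    (Sum.elim (fun x => f x - Tr (a * x)) fun x => f x + fs a) ht
    (by simp [Fintype.sum_sum_type, hwalsh])
  simp only [Fintype.sum_sum_type, Sum.elim_inl, Sum.elim_inr, Int.cast_one, Int.cast_neg, one_mul,
    neg_mul, sum_neg_distrib] at hconj
  simp only [sum_mul, ← AddChar.map_add_eq_mul, ← mul_add]
  exact add_neg_eq_zero.mp hconj

theorem exists_ne_zero (hd : IsDual f fs) : ∃ a, fs a ≠ 0 := by
  classical
  by_contra! hz
  have hinv := sum_walsh_mul f (1 : F)
  have hcard : (Fintype.card F : ℂ) ≠ 0 := Nat.cast_ne_zero.mpr Fintype.card_ne_zero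
  have hψ : ψ (f 1) ≠ 0 := (AddChar.val_isUnit ψ (f 1)).ne_zero
  simp only [hd.walsh_eq (hz 0), hz, AddChar.map_zero_eq_one, mul_one, ← mul_sum] at hinv
  have hsum : ∑ a : F, ψ (Tr a) = 0 := by simpa using sum_stdAddChar_trace (p := p) (1 : F)
  rw [hsum, mul_zero] at hinv
  exact mul_ne_zero hcard hψ hinv.symm

theorem sum_dual (hd : IsDual f fs) (hf0 : f 0 = 0) (hfs0 : fs 0 = 0) {E : ℤ}
    (hE : ∑ x : F, ψ (f x) = E) (hEsq : E ^ 2 = Fintype.card F) : ∑ x : F, ψ (fs x) = E := by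
  have hinv := sum_walsh_mul f 0
  simp only [hd.walsh_eq hfs0, hE, mul_zero, map_zero, hf0, AddChar.map_zero_eq_one, mul_one,
    ← mul_sum] at hinv
  have hsq : (E : ℂ) * E = Fintype.card F := by rw [← pow_two]; exact_mod_cast hEsq
  have hE0 : (E : ℂ) ≠ 0 := by
    rintro h0
    simp [h0, eq_comm] at hsq
  exact mul_left_cancel₀ hE0 (hinv.trans hsq.symm)

end IsDual

/- For `d = c ^ j` the substitution `x ↦ d x` turns `W_f(c a)` into the conjugate of `W_f(a)` under
`ζ ↦ ζ ^ (c d)`, once `j` is chosen so that `d ^ kf = c d`. As `fs (c a) = c ^ 2 fs a`, comparing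
phases gives `d = c`. -/
theorem MemRF.map_smul_of_dual {f fs : F → ZMod p} (hf : MemRF f) (hd : IsDual f fs)
    (hquad : ∀ (c : ZMod p) (x : F), fs (c • x) = c ^ 2 * fs x) (c : ZMod p) (x : F) :
    f (c • x) = c ^ 2 * f x := by
  obtain ⟨⟨hb, -⟩, hf0, kf, hkf, -, hgcd, hhom⟩ := hf
  have hfs0 : fs 0 = 0 := by simpa using hquad 0 0
  rcases eq_or_ne c 0 with rfl | hc
  · simp [hf0]
  obtain ⟨j, hj⟩ : ∃ j : ℕ, (c ^ j) ^ kf = c * c ^ j := by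
    have hdvd : orderOf c ∣ p - 1 := orderOf_dvd_of_pow_eq_one (ZMod.pow_card_sub_one_eq_one hc)
    obtain ⟨j, hj⟩ := exists_pow_eq_self_of_coprime (Nat.Coprime.coprime_dvd_right hdvd hgcd)
    refine ⟨j, ?_⟩
    rw [← Nat.sub_add_cancel hkf, pow_succ, pow_right_comm, hj]
  have hd0 : c ^ j ≠ 0 := pow_ne_zero _ hc
  have walsh_smul (b : F) :
      walsh f (c • b) = (∑ x : F, ψ (c * c ^ j * f x)) * ψ (c * c ^ j * fs b) := by
    rw [← hd.sum_stdAddChar_mul hfs0 (mul_ne_zero hc hd0), walsh, ← sum_comp_smul hd0]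
    refine sum_congr rfl fun x _ => ?_
    rw [hhom _ hd0, hj, smul_mul_smul_comm, map_smul, smul_eq_mul, mul_sub]
  have hsum : ∑ x : F, ψ (c * c ^ j * f x) = ∑ x : F, ψ (f x) := by
    simpa [walsh_zero, hfs0] using (walsh_smul 0).symm
  obtain ⟨a, ha⟩ := hd.exists_ne_zero
  have hphase := walsh_smul a
  rw [hsum, hd.walsh_eq hfs0, hquad] at hphase
  have hcj : c ^ 2 = c * c ^ j := mul_right_cancel₀ ha
    (ZMod.injective_stdAddChar (mul_left_cancel₀ hb.sum_ne_zero hphase))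
  have hdc : c ^ j = c := mul_left_cancel₀ hc (hcj.symm.trans (pow_two c))
  rw [hhom c hc, ← congrArg (· ^ kf) hdc, hj, ← hcj]

end Walsh

section Integrality

theorem eq_zero_of_sq_add_mul_sq {r : ℕ} (hr : r.Prime) (m : ℕ) (a b : ℤ)
    (h : a ^ 2 + r * b ^ 2 = (r : ℤ) ^ (2 * m)) : b = 0 := by
  induction m generalizing a b with
  | zero =>
    by_contra hb
    have hb2 : 0 < b ^ 2 := by positivity
    have hr2 : (2 : ℤ) ≤ r := by exact_mod_cast hr.two_le
    rw [mul_zero, pow_zero] at h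
    nlinarith [sq_nonneg a]
  | succ m ih =>
    have hrz : Prime (r : ℤ) := Nat.prime_iff_prime_int.mp hr
    rw [mul_add, mul_one, pow_add] at h
    obtain ⟨a', rfl⟩ : (r : ℤ) ∣ a :=
      hrz.dvd_of_dvd_pow (n := 2) ⟨(r : ℤ) ^ (2 * m) * r - b ^ 2, by linear_combination h⟩
    obtain ⟨b', rfl⟩ : (r : ℤ) ∣ b :=
      hrz.dvd_of_dvd_pow (n := 2) ⟨(r : ℤ) ^ (2 * m) - a' ^ 2,
        mul_left_cancel₀ hrz.ne_zero (by linear_combination h)⟩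
    have hb' : b' = 0 :=
      ih a' b' (mul_left_cancel₀ (pow_ne_zero 2 hrz.ne_zero) (by linear_combination h))
    rw [hb', mul_zero]

theorem even_card_of_neg_mem {G : Type*} [InvolutiveNeg G] {s : Finset G}
    (hmem : ∀ x ∈ s, -x ∈ s) (hne : ∀ x ∈ s, -x ≠ x) : Even #s := by
  have hsum : ∑ _x ∈ s, (1 : ZMod 2) = 0 :=
    sum_involution (fun x _ => -x) (fun _ _ => by decide) (fun x hx _ => hne x hx) hmem
      fun _ _ => neg_neg _
  rwa [sum_const, nsmul_one, ZMod.natCast_eq_zero_iff_even] at hsum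

theorem eq_or_eq_of_mul_sq_invariant {K α : Type*} [Field K] [Fintype K] [DecidableEq K]
    {n : K → α} (hn : ∀ c ≠ 0, ∀ a, n (c ^ 2 * a) = n a) {d : K} (hd : quadraticChar K d = -1)
    {a : K} (ha : a ≠ 0) :
    quadraticChar K a = 1 ∧ n a = n 1 ∨ quadraticChar K a = -1 ∧ n a = n d := by
  have hd0 : d ≠ 0 := by
    rintro rfl
    simp at hd
  rcases quadraticChar_dichotomy ha with h | h
  · obtain ⟨c, rfl⟩ := (quadraticChar_one_iff_isSquare ha).mp h
    have hc := hn c (left_ne_zero_of_mul ha) 1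
    rw [mul_one, pow_two] at hc
    exact .inl ⟨h, hc⟩
  · have had : quadraticChar K (a * d⁻¹) = 1 := by
      rw [map_mul, h, ← MulChar.inv_apply', (quadraticChar_isQuadratic K).inv, hd]
      rfl
    obtain ⟨c, hc⟩ :=
      (quadraticChar_one_iff_isSquare (mul_ne_zero ha (inv_ne_zero hd0))).mp had
    obtain rfl : a = c ^ 2 * d := by rw [pow_two, ← hc, inv_mul_cancel_right₀ hd0]
    exact .inr ⟨h, hn c (pow_ne_zero_iff two_ne_zero |>.mp (left_ne_zero_of_mul ha)) d⟩

variable (p) in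
/-- The quadratic Gauss sum `∑ a, η(a) ζ_p ^ a` of the prime field. -/
noncomputable def quadraticGaussSum : ℂ :=
  gaussSum ((quadraticChar (ZMod p)).ringHomComp (Int.castRingHom ℂ)) ψ

theorem quadraticGaussSum_sq (hp : p ≠ 2) :
    quadraticGaussSum p ^ 2 = quadraticChar (ZMod p) (-1) * (p : ℂ) := by
  have hχ : (quadraticChar (ZMod p)).ringHomComp (Int.castRingHom ℂ) ≠ 1 :=
    (MulChar.ringHomComp_ne_one_iff (Int.cast_injective)).mpr
      (quadraticChar_ne_one (by rwa [ZMod.ringChar_zmod_n]))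
  rw [quadraticGaussSum, gaussSum_sq hχ ((quadraticChar_isQuadratic (ZMod p)).comp _)
    (ZMod.isPrimitive_stdAddChar p), ZMod.card]
  rfl

theorem conj_quadraticGaussSum :
    (starRingEnd ℂ) (quadraticGaussSum p) =
      quadraticChar (ZMod p) (-1) * quadraticGaussSum p := by
  set χ := (quadraticChar (ZMod p)).ringHomComp (Int.castRingHom ℂ)
  have hquad : χ.IsQuadratic := (quadraticChar_isQuadratic (ZMod p)).comp _
  have hsq : χ (-1) * χ (-1) = 1 := by rw [← map_mul, neg_one_mul, neg_neg, map_one]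
  rw [quadraticGaussSum, starRingEnd_apply, star_gaussSum_eq, hquad.inv]
  change gaussSum χ (ψ)⁻¹ = χ (-1) * gaussSum χ ψ
  rw [← mul_gaussSum_inv_eq_gaussSum χ ψ, ← mul_assoc, hsq, one_mul]

/- A function that is constant on squares and on nonsquares is, away from `0`, a combination of `1`
and `η`. Its two values being even makes the coefficients integral. -/
theorem exists_sum_mul_stdAddChar_eq (hp : p ≠ 2) {n : ZMod p → ℕ}
    (hn : ∀ c ≠ 0, ∀ a, n (c ^ 2 * a) = n a) (heven : ∀ a ≠ 0, Even (n a)) :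
    ∃ A B : ℤ, ∑ a : ZMod p, (n a : ℂ) * ψ a = A + B * quadraticGaussSum p := by
  obtain ⟨d, hd⟩ := quadraticChar_exists_neg_one (F := ZMod p) (by rwa [ZMod.ringChar_zmod_n])
  obtain ⟨u, hu⟩ := heven 1 one_ne_zero
  obtain ⟨v, hv⟩ := heven d (by rintro rfl; simp at hd)
  have hval (a : ZMod p) : (n a : ℂ) = (if a = 0 then (n 0 : ℂ) - (u + v) else 0) + (u + v) +
      (u - v) * (quadraticChar (ZMod p) a : ℤ) := by
    rcases eq_or_ne a 0 with rfl | ha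
    · simp
    · rcases eq_or_eq_of_mul_sq_invariant hn hd ha with ⟨h, hna⟩ | ⟨h, hna⟩
      · rw [if_neg ha, h, hna, hu]
        push_cast
        ring
      · rw [if_neg ha, h, hna, hv]
        push_cast
        ring
  have hψ : ∑ a : ZMod p, ψ a = 0 := by simpa using sum_stdAddChar_mul (1 : ZMod p)
  refine ⟨n 0 - (u + v), u - v, ?_⟩
  calc ∑ a : ZMod p, (n a : ℂ) * ψ a
      = ((n 0 : ℂ) - (u + v)) + (u + v) * ∑ a : ZMod p, ψ a +
          (u - v) * ∑ a : ZMod p, (quadraticChar (ZMod p) a : ℤ) * ψ a := by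
        rw [sum_congr rfl fun a _ => congrArg (· * ψ a) (hval a)]
        simp only [add_mul, sum_add_distrib, ite_mul, zero_mul, sum_ite_eq', mem_univ, if_true,
          AddChar.map_zero_eq_one, mul_one, mul_assoc, mul_sum]
    _ = _ := by
        rw [hψ, mul_zero, add_zero]
        push_cast
        rfl

variable {f : F → ZMod p}

theorem card_fiber_mul_sq (hsq : ∀ (c : ZMod p) (x : F), f (c • x) = c ^ 2 * f x)
    {c : ZMod p} (hc : c ≠ 0) (a : ZMod p) :
    #{x : F | f x = c ^ 2 * a} = #{x : F | f x = a} := by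
  have hfiber (x : F) : f (c • x) = c ^ 2 * a ↔ f x = a := by
    rw [hsq, mul_right_inj' (pow_ne_zero 2 hc)]
  simp only [card_filter, ← hfiber]
  exact (sum_comp_smul hc fun x => if f x = c ^ 2 * a then 1 else 0).symm

theorem even_card_fiber (hp : p ≠ 2) (hsq : ∀ (c : ZMod p) (x : F), f (c • x) = c ^ 2 * f x)
    {a : ZMod p} (ha : a ≠ 0) : Even #{x : F | f x = a} := by
  have hf0 : f 0 = 0 := by simpa using hsq 0 0
  have hneg (x : F) : f (-x) = f x := by simpa using hsq (-1) x
  have hchar : ringChar F ≠ 2 := by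
    rwa [ringChar.eq_iff.mpr (charP_of_injective_algebraMap (algebraMap (ZMod p) F).injective p)]
  refine even_card_of_neg_mem (fun x hx => ?_) fun x hx hxx => ?_
  · simpa only [mem_filter_univ, hneg] using hx
  · rw [mem_filter_univ, (Ring.eq_self_iff_eq_zero_of_char_ne_two hchar).mp hxx, hf0] at hx
    exact ha hx.symm

theorem conj_sum_stdAddChar {ι : Type*} [Fintype ι] (g : ι → ZMod p) :
    (starRingEnd ℂ) (∑ i, ψ (g i)) = ∑ i, ψ (-g i) := by
  simp only [map_sum, AddChar.map_neg_eq_conj]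

theorem IsBent.sum_mul_conj_sum {n : ℕ} (hF : Fintype.card F = n) (hb : IsBent f) :
    (∑ x, ψ (f x)) * (starRingEnd ℂ) (∑ x, ψ (f x)) = n := by
  have hbent := hb 0
  rw [walsh_zero] at hbent
  rw [Complex.mul_conj, Complex.normSq_eq_norm_sq, hbent, hF]
  rfl

theorem IsBent.exists_int_eq_sum_of_isSquare {m : ℕ} (hF : Fintype.card F = p ^ (2 * m))
    (hb : IsBent f) (hsq : ∀ (c : ZMod p) (x : F), f (c • x) = c ^ 2 * f x)
    (h1 : IsSquare (-1 : ZMod p)) :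
    ∃ E : ℤ, E ^ 2 = (p : ℤ) ^ (2 * m) ∧ ∑ x : F, ψ (f x) = E := by
  have hnorm := hb.sum_mul_conj_sum hF
  obtain ⟨c, hc⟩ := h1
  have hc0 : c ≠ 0 := by
    rintro rfl
    simp at hc
  have hreal : (starRingEnd ℂ) (∑ x, ψ (f x)) = ∑ x, ψ (f x) := by
    rw [conj_sum_stdAddChar, ← sum_comp_smul hc0]
    simp only [hsq, pow_two, ← hc, neg_one_mul, neg_neg]
  have sum_sq : (∑ x, ψ (f x)) ^ 2 = ((p : ℂ) ^ m) ^ 2 := by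
    rw [hreal] at hnorm
    rw [pow_two, hnorm]
    push_cast
    ring
  rcases sq_eq_sq_iff_eq_or_eq_neg.mp sum_sq with h | h
  · exact ⟨(p : ℤ) ^ m, by ring, by rw [h]; push_cast; rfl⟩
  · exact ⟨-(p : ℤ) ^ m, by ring, by rw [h]; push_cast; rfl⟩

/- The sum is `A + B √(-p)` with integers `A`, `B`, and the norm equation forces `B = 0`. -/
theorem IsBent.exists_int_eq_sum_of_not_isSquare (hp : p ≠ 2) {m : ℕ}
    (hF : Fintype.card F = p ^ (2 * m)) (hb : IsBent f)
    (hsq : ∀ (c : ZMod p) (x : F), f (c • x) = c ^ 2 * f x) (h1 : ¬ IsSquare (-1 : ZMod p)) :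
    ∃ E : ℤ, E ^ 2 = (p : ℤ) ^ (2 * m) ∧ ∑ x : F, ψ (f x) = E := by
  have hnorm := hb.sum_mul_conj_sum hF
  have hη : quadraticChar (ZMod p) (-1) = -1 := quadraticChar_neg_one_iff_not_isSquare.mpr h1
  obtain ⟨A, B, hAB⟩ := exists_sum_mul_stdAddChar_eq hp (n := fun a => #{x : F | f x = a})
    (fun _ hc => card_fiber_mul_sq hsq hc) fun _ => even_card_fiber hp hsq
  rw [← sum_stdAddChar_comp] at hAB
  have hG := quadraticGaussSum_sq hp
  have hform : A ^ 2 + p * B ^ 2 = (p : ℤ) ^ (2 * m) := by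
    have : ((A ^ 2 + p * B ^ 2 : ℤ) : ℂ) = ((p ^ (2 * m) : ℤ) : ℂ) := by
      simp only [hAB, map_add, map_mul, map_intCast, conj_quadraticGaussSum, hη] at hnorm hG
      push_cast at hnorm hG ⊢
      linear_combination hnorm + (B : ℂ) ^ 2 * hG
    exact_mod_cast this
  have hB := eq_zero_of_sq_add_mul_sq Fact.out m A B hform
  exact ⟨A, by simpa [hB] using hform, by simpa [hB] using hAB⟩

theorem IsBent.exists_int_eq_sum (hp : p ≠ 2) {m : ℕ} (hF : Fintype.card F = p ^ (2 * m))
    (hb : IsBent f) (hsq : ∀ (c : ZMod p) (x : F), f (c • x) = c ^ 2 * f x) :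
    ∃ E : ℤ, E ^ 2 = (p : ℤ) ^ (2 * m) ∧ ∑ x : F, ψ (f x) = E := by
  by_cases h1 : IsSquare (-1 : ZMod p)
  · exact hb.exists_int_eq_sum_of_isSquare hF hsq h1
  · exact hb.exists_int_eq_sum_of_not_isSquare hp hF hsq h1

end Integrality

section DualSums

variable {f fs : F → ZMod p} {E : ℤ}

/-- The Walsh spectrum of a weakly regular bent function `f` with dual `fs`, together with its
Galois conjugates, in the case where `W_f(0) = E` is an integer and `fs` is homogeneous of degree
two: then `t f` has dual `t⁻¹ fs` and the same value `E` at `0`, for every `t ≠ 0`. -/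
def HasIntegralDual (f fs : F → ZMod p) (E : ℤ) : Prop :=
  ∀ t : ZMod p, t ≠ 0 → ∀ a : F, walsh (fun x => t * f x) a = E * ψ (t⁻¹ * fs a)

theorem IsDual.hasIntegralDual (hd : IsDual f fs)
    (hquad : ∀ (c : ZMod p) (x : F), fs (c • x) = c ^ 2 * fs x)
    (hE : ∑ x : F, ψ (f x) = E) : HasIntegralDual f fs E := by
  intro t ht a
  have hsum := hd.sum_stdAddChar_mul (by simpa using hquad 0 0) ht (t⁻¹ • a)
  rw [sum_stdAddChar_mul_eq_intCast hE ht, hquad] at hsum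
  convert hsum using 2 with x
  · simp only [walsh, smul_mul_assoc, map_smul, smul_eq_mul, mul_sub, mul_inv_cancel_left₀ ht]
  · congr 1
    field_simp

end DualSums

section PowerRoots

variable {F : Type*} [Field F]

theorem pow_eq_mul_self_iff {n : ℕ} (hn : 1 ≤ n) (y c : F) :
    y ^ n = c * y ↔ y = 0 ∨ y ^ (n - 1) = c := by
  obtain ⟨n, rfl⟩ := Nat.exists_eq_add_of_le' hn
  rw [Nat.add_sub_cancel, pow_succ, mul_eq_mul_right_iff, or_comm]

variable [Fintype F] [DecidableEq F]

theorem sum_pow_eq_mul_self {M : Type*} [AddCommMonoid M] {n : ℕ} (hn : 2 ≤ n) {c : F} (hc : c ≠ 0)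
    (g : F → M) :
    ∑ y : F with y ^ n = c * y, g y = g 0 + ∑ y : F with y ^ (n - 1) = c, g y := by
  have hinsert : ({y : F | y ^ n = c * y} : Finset F) =
      insert 0 ({y : F | y ^ (n - 1) = c} : Finset F) := by
    ext y
    simp [pow_eq_mul_self_iff (one_le_two.trans hn)]
  rw [hinsert, sum_insert]
  simp [zero_pow (Nat.sub_ne_zero_of_lt hn), hc.symm]

theorem card_pow_eq_one {n : ℕ} (hn : n ∣ Fintype.card F - 1) : #{y : F | y ^ n = 1} = n := by
  obtain ⟨g, hg⟩ := IsCyclic.exists_ofOrder_eq_natCard (α := Fˣ)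
  rw [Nat.card_eq_fintype_card, Fintype.card_units] at hg
  have hpos : 0 < Fintype.card F - 1 := Nat.sub_pos_of_lt Fintype.one_lt_card
  have hn0 : 0 < n := Nat.pos_of_dvd_of_pos hn hpos
  obtain ⟨c, hc⟩ := hn
  have hprim : IsPrimitiveRoot ((g ^ c : Fˣ) : F) n := IsPrimitiveRoot.coe_units_iff.mpr <|
    IsPrimitiveRoot.pow hpos (hg ▸ IsPrimitiveRoot.orderOf g) (by rw [hc, mul_comm])
  have hroots : ({y : F | y ^ n = 1} : Finset F) = Polynomial.nthRootsFinset n 1 := by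
    ext y
    simp [Polynomial.mem_nthRootsFinset hn0]
  rw [hroots, hprim.card_nthRootsFinset]

theorem card_pow_eq_neg_one (hF : (1 : F) ≠ -1) {n : ℕ} (hn : 2 * n ∣ Fintype.card F - 1) :
    #{y : F | y ^ n = -1} = n := by
  have hunion : ({y : F | y ^ (2 * n) = 1} : Finset F) =
      ({y : F | y ^ n = 1} : Finset F) ∪ ({y : F | y ^ n = -1} : Finset F) := by
    ext y
    simp only [mem_filter, mem_univ, true_and, mem_union]
    rw [mul_comm, pow_mul, sq_eq_one_iff]
  have hdisj : Disjoint ({y : F | y ^ n = 1} : Finset F) ({y : F | y ^ n = -1} : Finset F) :=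
    disjoint_filter.mpr fun y _ h h' => hF (h.symm.trans h')
  have hcard := card_pow_eq_one hn
  rw [hunion, card_union_of_disjoint hdisj,
    card_pow_eq_one ((Dvd.intro_left 2 rfl).trans hn)] at hcard
  omega

theorem card_pow_eq_mul_self {n : ℕ} (hn : 2 ≤ n) {c : F} (hc : c ≠ 0) :
    #{y : F | y ^ n = c * y} = #{y : F | y ^ (n - 1) = c} + 1 := by
  simp only [card_eq_sum_ones, sum_pow_eq_mul_self hn hc, add_comm]

variable {s : ℕ}

theorem card_pow_sub_one_eq_one (hF : Fintype.card F = s ^ 2) :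
    #{u : F | u ^ (s - 1) = 1} = s - 1 :=
  card_pow_eq_one (by rw [hF, ← one_pow 2, Nat.sq_sub_sq]; exact Dvd.intro_left _ rfl)

theorem card_pow_sub_one_eq_neg_one (hF : Fintype.card F = s ^ 2) (hone : (1 : F) ≠ -1)
    (hs : Odd s) : #{u : F | u ^ (s - 1) = -1} = s - 1 :=
  card_pow_eq_neg_one hone <| by
    rw [hF, ← one_pow 2, Nat.sq_sub_sq]
    exact Nat.mul_dvd_mul (even_iff_two_dvd.mp hs.add_one) dvd_rfl

end PowerRoots

section Semiprimitive

theorem trace_pow_prime_pow {K : Type*} [Field K] [Finite K] [Algebra (ZMod p) K] (m : ℕ) (x : K) :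
    Algebra.trace (ZMod p) K (x ^ p ^ m) = Algebra.trace (ZMod p) K x := by
  induction m with
  | zero => simp
  | succ m ih =>
    have hfrob := Algebra.trace_eq_of_algEquiv
      (FiniteField.frobeniusAlgEquivOfAlgebraic (ZMod p) K) (x ^ p ^ m)
    rw [FiniteField.coe_frobeniusAlgEquivOfAlgebraic, ZMod.card] at hfrob
    rw [pow_succ, pow_mul, ← ih, hfrob]

theorem one_ne_neg_one_of_algebra {K : Type*} [Field K] [Algebra (ZMod p) K] (hp : p ≠ 2) :
    (1 : K) ≠ -1 := by
  have hchar : ringChar K ≠ 2 := by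
    rwa [ringChar.eq_iff.mpr (charP_of_injective_algebraMap (algebraMap (ZMod p) K).injective p)]
  exact (Ring.neg_one_ne_one_of_char_ne_two hchar).symm

theorem three_le_prime_pow (hp : p ≠ 2) {m : ℕ} (hm : 1 ≤ m) : 3 ≤ p ^ m := by
  have hp2 := (Fact.out : p.Prime).two_le
  exact (by omega : 3 ≤ p).trans (Nat.le_self_pow (by omega) p)

theorem odd_prime_pow (hp : p ≠ 2) (m : ℕ) : Odd (p ^ m) :=
  ((Fact.out : p.Prime).odd_of_ne_two hp).pow

omit [Fintype F] in
theorem sum_addSubgroup_stdAddChar (K : AddSubgroup F) [Fintype K] (c : F) :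
    ∑ u : K, ψ (Tr (c * u)) =
      if ∀ u : K, Tr (c * u) = 0 then (Fintype.card K : ℂ) else 0 := by
  let φ : AddChar K ℂ := (ψ).compAddMonoidHom
    ((Tr).toAddMonoidHom.comp ((AddMonoidHom.mulLeft c).comp K.subtype))
  have hφ : φ = 0 ↔ ∀ u : K, Tr (c * u) = 0 := by
    refine ⟨fun h u => ZMod.injective_stdAddChar ?_, fun h => ?_⟩
    · exact (DFunLike.congr_fun h u).trans (AddChar.map_zero_eq_one _).symm
    · ext u
      simp [φ, h u]
  classical
  simp_rw [← hφ]
  exact AddChar.sum_eq_ite φ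

theorem card_mul_card_trace_annihilator (K : AddSubgroup F) [Fintype K] :
    Fintype.card K * #{c : F | ∀ u : K, Tr (c * u) = 0} = Fintype.card F := by
  classical
  have hsum : ∑ c : F, ∑ u : K, ψ (Tr (c * u)) = Fintype.card F := by
    rw [sum_comm]
    simp only [mul_comm _ ((_ : K) : F), sum_stdAddChar_trace, ZeroMemClass.coe_eq_zero]
    rw [sum_ite_eq' univ 0, if_pos (mem_univ _)]
  simp only [sum_addSubgroup_stdAddChar, ← sum_filter, sum_const, nsmul_eq_mul] at hsum
  rw [mul_comm]
  exact_mod_cast hsum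

/-- The subfield of `p ^ m` elements as an additive group, when `F` has `p ^ (2 * m)` elements. -/
def fixedPow (p : ℕ) [Fact p.Prime] (F : Type*) [Field F] [Algebra (ZMod p) F] (m : ℕ) :
    AddSubgroup F :=
  have : CharP F p := charP_of_injective_algebraMap (algebraMap (ZMod p) F).injective p
  (iterateFrobenius F p m).toAddMonoidHom.eqLocus (AddMonoidHom.id F)

omit [Fintype F] in
theorem mem_fixedPow {m : ℕ} {u : F} : u ∈ fixedPow p F m ↔ u ^ p ^ m = u :=
  Iff.rfl

variable [DecidableEq F] {m : ℕ}

instance : DecidablePred (· ∈ fixedPow p F m) :=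
  fun u => inferInstanceAs (Decidable (u ^ p ^ m = u))

theorem sum_fixedPow {M : Type*} [AddCommMonoid M] (hp : p ≠ 2) (hm : 1 ≤ m) (g : F → M) :
    ∑ u : fixedPow p F m, g u = g 0 + ∑ u : F with u ^ (p ^ m - 1) = 1, g u := by
  have hs := three_le_prime_pow hp hm
  rw [← sum_pow_eq_mul_self (by omega) one_ne_zero]
  refine (sum_subtype _ (fun u => ?_) g).symm
  rw [mem_filter_univ, one_mul, mem_fixedPow]

theorem card_fixedPow (hp : p ≠ 2) (hm : 1 ≤ m) (hF : Fintype.card F = (p ^ m) ^ 2) :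
    Fintype.card (fixedPow p F m) = p ^ m := by
  have hsum := sum_fixedPow (F := F) hp hm fun _ => 1
  simp only [sum_const, card_univ, smul_eq_mul, mul_one, card_pow_sub_one_eq_one hF] at hsum
  have := three_le_prime_pow hp hm
  omega

/- Raising to the power `p ^ m` preserves the trace of `c u` but changes its sign if
`c ^ p ^ m = -c`. There are `p ^ m` such `c`, as many as the annihilator of the subfield has
elements. -/
omit [DecidableEq F] in
theorem forall_trace_mul_fixedPow_eq_zero_iff (hp : p ≠ 2) (hm : 1 ≤ m)
    (hF : Fintype.card F = (p ^ m) ^ 2) (c : F) :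
    (∀ u : fixedPow p F m, Tr (c * u) = 0) ↔ c ^ p ^ m = -1 * c := by
  have := Classical.decEq F
  have hs := three_le_prime_pow hp hm
  have hsub : ({c : F | c ^ p ^ m = -1 * c} : Finset F) ⊆
      ({c : F | ∀ u : fixedPow p F m, Tr (c * u) = 0} : Finset F) := by
    intro c hc
    rw [mem_filter_univ] at hc ⊢
    rintro ⟨u, hu⟩
    have htrace := trace_pow_prime_pow (p := p) m (c * u)
    rw [mul_pow, hc, mem_fixedPow.mp hu, neg_one_mul, neg_mul, map_neg] at htrace
    exact (Ring.eq_self_iff_eq_zero_of_char_ne_two (by rwa [ZMod.ringChar_zmod_n])).mp htrace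
  have hcard := card_mul_card_trace_annihilator (p := p) (fixedPow p F m)
  rw [card_fixedPow hp hm hF, hF, pow_two] at hcard
  have heq := eq_of_subset_of_card_le hsub <| by
    rw [Nat.eq_of_mul_eq_mul_left (by omega) hcard,
      card_pow_eq_mul_self (by omega) (neg_ne_zero.mpr one_ne_zero),
      card_pow_sub_one_eq_neg_one hF (one_ne_neg_one_of_algebra hp) (odd_prime_pow hp m)]
    omega
  simpa using (Finset.ext_iff.mp heq c).symm

theorem sum_pow_sub_one_eq_one_stdAddChar (hp : p ≠ 2) (hm : 1 ≤ m)
    (hF : Fintype.card F = (p ^ m) ^ 2) (c : F) :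
    ∑ u : F with u ^ (p ^ m - 1) = 1, ψ (Tr (c * u)) =
      (if c ^ p ^ m = -1 * c then (p : ℂ) ^ m else 0) - 1 := by
  have hsum := sum_fixedPow (F := F) hp hm fun u => ψ (Tr (c * u))
  rw [sum_addSubgroup_stdAddChar, card_fixedPow hp hm hF, mul_zero, map_zero,
    AddChar.map_zero_eq_one, Nat.cast_pow] at hsum
  simp only [forall_trace_mul_fixedPow_eq_zero_iff hp hm hF] at hsum
  exact eq_sub_of_add_eq' hsum.symm

/- Averaging over `u` in the multiplicative group of the subfield turns the character into the
indicator of `(d y) ^ p ^ m = -(d y)`, whose nonzero solutions form the coset `(b / d) u`. -/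
omit [DecidableEq F] in
theorem sum_invariant_mul_stdAddChar (hp : p ≠ 2) (hm : 1 ≤ m)
    (hF : Fintype.card F = (p ^ m) ^ 2) (g : F → ℂ)
    (hg : ∀ u y : F, u ^ (p ^ m - 1) = 1 → g (u * y) = g y) {b : F} (hb : b ^ (p ^ m - 1) = -1)
    {d : F} (hd : d ≠ 0) :
    ((p : ℂ) ^ m - 1) * ∑ y : F, g y * ψ (Tr (d * y)) =
      (p : ℂ) ^ m * g 0 + (p : ℂ) ^ m * ((p : ℂ) ^ m - 1) * g (b / d) - ∑ y : F, g y := by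
  have := Classical.decEq F
  have hs := three_le_prime_pow hp hm
  have hcast : ((p ^ m - 1 : ℕ) : ℂ) = (p : ℂ) ^ m - 1 := by push_cast [(by omega : 1 ≤ p ^ m)]; rfl
  have ne_zero_of_pow {c u : F} (hc : c ≠ 0) (hu : u ^ (p ^ m - 1) = c) : u ≠ 0 := by
    rintro rfl
    exact hc (by rw [← hu, zero_pow (by omega)])
  have sum_mul_left (u : F) (hu : u ^ (p ^ m - 1) = 1) :
      ∑ y : F, g y * ψ (Tr (d * y)) = ∑ y : F, g y * ψ (Tr (d * y * u)) := by
    refine (Fintype.sum_bijective _ (mulLeft_bijective₀ u (ne_zero_of_pow one_ne_zero hu)) _ _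
      fun y => ?_).symm
    rw [hg u y hu, mul_left_comm, mul_comm u]
  have g_div {y : F} (hy : y ^ (p ^ m - 1) = -1) : g (y / d) = g (b / d) := by
    have hb0 := ne_zero_of_pow (neg_ne_zero.mpr one_ne_zero) hb
    rw [← hg (y / b) (b / d) (by rw [div_pow, hy, hb, neg_div_neg_eq, div_one]),
      div_mul_div_cancel₀ hb0]
  have averaged : ((p : ℂ) ^ m - 1) * ∑ y : F, g y * ψ (Tr (d * y)) =
      ∑ y : F, g y * ((if (d * y) ^ p ^ m = -1 * (d * y) then (p : ℂ) ^ m else 0) - 1) := by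
    simp only [← sum_pow_sub_one_eq_one_stdAddChar hp hm hF, mul_sum (s := filter _ _)]
    rw [sum_comm, sum_congr rfl fun u hu => (sum_mul_left u (mem_filter.mp hu).2).symm, sum_const,
      card_pow_sub_one_eq_one hF, nsmul_eq_mul, hcast]
  have main : ∑ y : F, g y * (if (d * y) ^ p ^ m = -1 * (d * y) then (p : ℂ) ^ m else 0) =
      (p : ℂ) ^ m * g 0 + (p : ℂ) ^ m * ((p : ℂ) ^ m - 1) * g (b / d) :=
    calc _ = ∑ y : F with y ^ p ^ m = -1 * y, (p : ℂ) ^ m * g (y / d) := by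
          rw [sum_filter]
          refine Fintype.sum_bijective _ (mulLeft_bijective₀ d hd) _ _ fun y => ?_
          rw [mul_div_cancel_left₀ y hd, mul_ite, mul_zero, mul_comm (g y)]
      _ = _ := by
          rw [sum_pow_eq_mul_self (by omega) (neg_ne_zero.mpr one_ne_zero), zero_div,
            sum_congr rfl fun y hy => by rw [g_div (mem_filter.mp hy).2], sum_const,
            card_pow_sub_one_eq_neg_one hF (one_ne_neg_one_of_algebra hp) (odd_prime_pow hp m),
            nsmul_eq_mul, hcast]
          ring
  rw [averaged]
  simp only [mul_sub, mul_one, sum_sub_distrib, main]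

end Semiprimitive

section PrimitiveRoot

variable {p ℓ k : ℕ}

theorem orderOf_natCast_prime_pow (hp : Odd p) (hℓ : Odd ℓ)
    (hprim : orderOf (p : ZMod (2 * ℓ ^ k)) = Nat.totient (ℓ ^ k)) :
    orderOf (p : ZMod (ℓ ^ k)) = Nat.totient (ℓ ^ k) := by
  rw [← hprim]
  refine orderOf_eq_orderOf_iff.mpr fun n => ?_
  have pow_eq_one_iff (r : ℕ) : (p : ZMod r) ^ n = 1 ↔ p ^ n ≡ 1 [MOD r] := by
    rw [← ZMod.natCast_eq_natCast_iff, Nat.cast_pow, Nat.cast_one]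
  have hcop : Nat.Coprime 2 (ℓ ^ k) := (Nat.coprime_two_left.mpr hℓ).pow_right k
  have hodd : p ^ n ≡ 1 [MOD 2] := Nat.odd_iff.mp hp.pow
  rw [pow_eq_one_iff, pow_eq_one_iff, ← Nat.modEq_and_modEq_iff_modEq_mul hcop]
  exact (and_iff_right hodd).symm

theorem even_totient_prime_pow (hℓ : ℓ.Prime) (hℓ2 : ℓ ≠ 2) (hk : 1 ≤ k) :
    Even (Nat.totient (ℓ ^ k)) := by
  refine Nat.totient_even ?_
  have htwo := hℓ.two_le
  have hle : ℓ ≤ ℓ ^ k := Nat.le_self_pow (by omega) ℓ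
  omega

theorem prime_pow_dvd_add_one (hℓ : ℓ.Prime) (hℓ2 : ℓ ≠ 2) {a : ℤ} (h : (ℓ : ℤ) ^ k ∣ a ^ 2 - 1)
    (hnot : ¬ (ℓ : ℤ) ^ k ∣ a - 1) : (ℓ : ℤ) ^ k ∣ a + 1 := by
  have hprime : Prime (ℓ : ℤ) := Nat.prime_iff_prime_int.mp hℓ
  rw [← one_pow 2, sq_sub_sq, mul_comm] at h
  by_cases hdvd : (ℓ : ℤ) ∣ a - 1
  · have hndvd : ¬ (ℓ : ℤ) ∣ a + 1 := by
      intro hdvd'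
      have htwo : (ℓ : ℤ) ∣ (2 : ℕ) := by
        have hsub := dvd_sub hdvd' hdvd
        ring_nf at hsub
        exact hsub
      exact hℓ2 ((Nat.prime_dvd_prime_iff_eq hℓ Nat.prime_two).mp (Int.natCast_dvd_natCast.mp htwo))
    exact absurd (hprime.pow_dvd_of_dvd_mul_right k hndvd h) hnot
  · exact hprime.pow_dvd_of_dvd_mul_left k hdvd h

theorem two_mul_prime_pow_dvd (hp : Odd p) (hℓ : ℓ.Prime) (hℓ2 : ℓ ≠ 2) (hk : 1 ≤ k)
    (hord : orderOf (p : ZMod (ℓ ^ k)) = Nat.totient (ℓ ^ k)) :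
    2 * ℓ ^ k ∣ p ^ (Nat.totient (ℓ ^ k) / 2) + 1 := by
  obtain ⟨m, hm⟩ := (even_totient_prime_pow hℓ hℓ2 hk).two_dvd
  have hpos : 0 < Nat.totient (ℓ ^ k) := Nat.totient_pos.mpr (pow_pos hℓ.pos _)
  have dvd_sub_one_iff (n : ℕ) :
      (ℓ : ℤ) ^ k ∣ (p : ℤ) ^ n - 1 ↔ Nat.totient (ℓ ^ k) ∣ n := by
    rw [← hord, orderOf_dvd_iff_pow_eq_one, ← sub_eq_zero, ← Int.natCast_pow,
      ← ZMod.intCast_zmod_eq_zero_iff_dvd]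
    push_cast
    rfl
  have hdvd : (ℓ : ℤ) ^ k ∣ (p : ℤ) ^ m + 1 := by
    refine prime_pow_dvd_add_one hℓ hℓ2 ?_ ?_
    · rw [← pow_mul, mul_comm, ← hm, dvd_sub_one_iff]
    · rw [dvd_sub_one_iff]
      exact Nat.not_dvd_of_pos_of_lt (by omega) (by omega)
  rw [hm, Nat.mul_div_cancel_left m two_pos]
  refine Nat.Coprime.mul_dvd_of_dvd_of_dvd ?_ (even_iff_two_dvd.mp hp.pow.add_one) ?_
  · exact ((Nat.coprime_primes Nat.prime_two hℓ).mpr hℓ2.symm).pow_right k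
  · exact_mod_cast hdvd

theorem sum_pow_mod {M : Type*} [AddCommMonoid M] {n : ℕ} (hn : 0 < n) (hcop : Nat.Coprime p n)
    (hord : orderOf (p : ZMod n) = Nat.totient n) (g : ℕ → M) :
    ∑ i ∈ range (Nat.totient n), g (p ^ i % n) = ∑ j ∈ range n with n.Coprime j, g j := by
  have hinj : Set.InjOn (fun i => p ^ i % n) (range (Nat.totient n)) := by
    intro i hi j hj hij
    rw [mem_coe, mem_range, ← hord] at hi hj
    have hpow := (ZMod.natCast_eq_natCast_iff _ _ _).mpr hij
    rw [Nat.cast_pow, Nat.cast_pow] at hpow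
    exact pow_injOn_Iio_orderOf hi hj hpow
  rw [← sum_image hinj]
  refine sum_congr (eq_of_subset_of_card_le (fun j hj => ?_) ?_) fun _ _ => rfl
  · obtain ⟨i, -, rfl⟩ := mem_image.mp hj
    rw [mem_filter, mem_range]
    refine ⟨Nat.mod_lt _ hn, ?_⟩
    rw [Nat.coprime_comm, Nat.Coprime, ← Nat.gcd_rec, Nat.gcd_comm]
    exact hcop.pow_left i
  · rw [card_image_of_injOn hinj, card_range]
    rfl

theorem sum_coprime_prime_pow (hℓ : ℓ.Prime) (hk : 1 ≤ k) {M : Type*} [AddCommGroup M]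
    (g : ℕ → M) :
    ∑ j ∈ range (ℓ ^ k) with (ℓ ^ k).Coprime j, g j =
      ∑ j ∈ range (ℓ ^ k), g j - ∑ j ∈ range (ℓ ^ (k - 1)), g (ℓ * j) := by
  rw [eq_sub_iff_add_eq,
    ← sum_filter_add_sum_filter_not (range (ℓ ^ k)) (fun j => (ℓ ^ k).Coprime j) g]
  congr 1
  have hpow : ℓ ^ k = ℓ * ℓ ^ (k - 1) := by rw [← pow_succ', Nat.sub_add_cancel hk]
  have not_coprime_iff (j : ℕ) : ¬ (ℓ ^ k).Coprime j ↔ ℓ ∣ j := by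
    rw [Nat.coprime_pow_left_iff hk, hℓ.coprime_iff_not_dvd, not_not]
  simp only [not_coprime_iff]
  refine sum_bij (fun j _ => ℓ * j) (fun j hj => ?_) (fun i _ j _ h => ?_) (fun j hj => ?_)
    fun _ _ => rfl
  · rw [mem_filter, mem_range, hpow]
    exact ⟨Nat.mul_lt_mul_of_pos_left (mem_range.mp hj) hℓ.pos, dvd_mul_right ℓ j⟩
  · exact Nat.eq_of_mul_eq_mul_left hℓ.pos h
  · rw [mem_filter, mem_range, hpow] at hj
    obtain ⟨hlt, i, rfl⟩ := hj
    exact ⟨i, mem_range.mpr (Nat.lt_of_mul_lt_mul_left hlt), rfl⟩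

end PrimitiveRoot

section PowerSums

variable {K : Type*} [Field K] [Fintype K]

theorem exists_pow_eq_of_pow_eq_one {M N : ℕ} (h : Fintype.card K - 1 = N * M) {w : K}
    (hw : w ^ M = 1) : ∃ y : K, y ^ N = w := by
  have hpos : 0 < N * M := h ▸ Nat.sub_pos_of_lt Fintype.one_lt_card
  have hM : 0 < M := Nat.pos_of_mul_pos_left hpos
  obtain ⟨g, hg⟩ := IsCyclic.exists_generator (α := Kˣ)
  have hord : orderOf g = N * M := by
    rw [orderOf_eq_card_of_forall_mem_zpowers hg, Nat.card_units, Nat.card_eq_fintype_card, h]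
  obtain ⟨j, hj⟩ := mem_powers_iff_mem_zpowers.mpr (hg (Units.ofPowEqOne w M hw hM.ne'))
  have hjM : N * M ∣ j * M := by
    rw [← hord, orderOf_dvd_iff_pow_eq_one, pow_mul]
    simp only at hj
    rw [hj, Units.pow_ofPowEqOne]
  obtain ⟨i, rfl⟩ := Nat.dvd_of_mul_dvd_mul_right hM hjM
  refine ⟨(g ^ i : Kˣ), ?_⟩
  rw [← Units.val_pow_eq_pow_val, ← pow_mul, mul_comm]
  exact congrArg Units.val hj

variable [DecidableEq K]

theorem card_pow_eq {M N : ℕ} (h : Fintype.card K - 1 = N * M) {w : K} (hw : w ^ M = 1) :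
    #{y : K | y ^ N = w} = N := by
  obtain ⟨z, rfl⟩ := exists_pow_eq_of_pow_eq_one h hw
  have hpos : 0 < N * M := h ▸ Nat.sub_pos_of_lt Fintype.one_lt_card
  have hz : z ≠ 0 := by
    rintro rfl
    rw [← pow_mul, zero_pow hpos.ne'] at hw
    exact zero_ne_one hw
  refine (card_equiv (Equiv.divRight₀ z hz) fun y => ?_).trans
    (card_pow_eq_one (F := K) (n := N) (h ▸ Dvd.intro _ rfl))
  simp [div_pow, div_eq_one_iff_eq (pow_ne_zero N hz)]

theorem sum_comp_pow {A : Type*} [AddCommMonoid A] {M N : ℕ} (h : Fintype.card K - 1 = N * M)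
    (g : K → A) : ∑ y : K with y ≠ 0, g (y ^ N) = N • ∑ w : K with w ^ M = 1, g w := by
  have hpos : 0 < N * M := h ▸ Nat.sub_pos_of_lt Fintype.one_lt_card
  have hmaps (y : K) (hy : y ∈ ({y | y ≠ 0} : Finset K)) :
      y ^ N ∈ ({w | w ^ M = 1} : Finset K) := by
    rw [mem_filter_univ] at hy ⊢
    rw [← pow_mul, ← h, FiniteField.pow_card_sub_one_eq_one y hy]
  rw [← sum_fiberwise_of_maps_to hmaps, smul_sum]
  refine sum_congr rfl fun w hw => ?_
  have hfiber : ({y ∈ ({y | y ≠ 0} : Finset K) | y ^ N = w} : Finset K) =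
      ({y | y ^ N = w} : Finset K) := by
    rw [filter_filter]
    refine filter_congr fun y _ => and_iff_right_of_imp ?_
    rintro hy rfl
    rw [mem_filter_univ, ← hy, ← pow_mul, zero_pow hpos.ne'] at hw
    exact zero_ne_one hw
  rw [hfiber, sum_congr rfl fun y hy => by rw [(mem_filter.mp hy).2], sum_const,
    card_pow_eq h (mem_filter.mp hw).2]

theorem sum_pow_two_mul_eq_one {A : Type*} [AddCommMonoid A] (hK : (1 : K) ≠ -1) {n : ℕ}
    (hn : Odd n) (g : K → A) :
    ∑ w : K with w ^ (2 * n) = 1, g w = ∑ w : K with w ^ n = 1, (g w + g (-w)) := by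
  have hneg : ∑ w : K with w ^ n = 1, g (-w) = ∑ w : K with w ^ n = -1, g w :=
    sum_equiv (Equiv.neg K) (fun w => by simp [hn.neg_pow]) fun w _ => rfl
  rw [sum_add_distrib, hneg, ← sum_union]
  · refine sum_congr ?_ fun _ _ => rfl
    ext w
    simp only [mem_filter, mem_univ, true_and, mem_union]
    rw [mul_comm, pow_mul, sq_eq_one_iff]
  · exact disjoint_filter.mpr fun w _ h h' => hK (h.symm.trans h')

end PowerSums

section Trace

variable {ℓ k : ℕ}

theorem finrank_eq_of_card {e : ℕ} (hF : Fintype.card F = p ^ e) :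
    Module.finrank (ZMod p) F = e := by
  have hcard := Module.card_eq_pow_finrank (K := ZMod p) (V := F)
  rw [ZMod.card, hF] at hcard
  exact (Nat.pow_right_injective (Fact.out : p.Prime).two_le hcard).symm

theorem trace_one_of_card {e : ℕ} (hF : Fintype.card F = p ^ e) : Tr 1 = e := by
  have htrace := Algebra.trace_algebraMap (R := ZMod p) (S := F) 1
  rw [map_one, finrank_eq_of_card hF, nsmul_eq_mul, mul_one] at htrace
  exact htrace

variable [DecidableEq F] (hℓ : ℓ.Prime) (hk : 1 ≤ k) (hpℓ : p ≠ ℓ)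
  (hord : orderOf (p : ZMod (ℓ ^ k)) = Nat.totient (ℓ ^ k))
  (hF : Fintype.card F = p ^ Nat.totient (ℓ ^ k))
include hℓ hk hpℓ hord hF

/- The conjugates of `w` are the `w ^ j` with `j` prime to `ℓ`, each occurring once. -/
theorem trace_root_of_unity {w : F} (hw : w ^ ℓ ^ k = 1) (hw1 : w ≠ 1) :
    Tr w = if w ^ ℓ = 1 then -(ℓ : ZMod p) ^ (k - 1) else 0 := by
  have hcop : Nat.Coprime p (ℓ ^ k) := ((Nat.coprime_primes Fact.out hℓ).mpr hpℓ).pow_right k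
  have geom_sum_eq_zero {v : F} {n : ℕ} (hv : v ^ n = 1) (hv1 : v ≠ 1) :
      ∑ j ∈ range n, v ^ j = 0 := by
    rw [geom_sum_eq hv1, hv, sub_self, zero_div]
  have pow_mod (i : ℕ) : w ^ p ^ i = w ^ (p ^ i % ℓ ^ k) := by
    conv_lhs => rw [← Nat.mod_add_div (p ^ i) (ℓ ^ k), pow_add, pow_mul, hw, one_pow, mul_one]
  apply (algebraMap (ZMod p) F).injective
  rw [FiniteField.algebraMap_trace_eq_sum_pow, finrank_eq_of_card hF, Nat.card_zmod]
  simp only [pow_mod]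
  rw [sum_pow_mod (pow_pos hℓ.pos k) hcop hord fun j => w ^ j, sum_coprime_prime_pow hℓ hk,
    geom_sum_eq_zero hw hw1, zero_sub]
  simp only [pow_mul]
  split_ifs with h
  · simp [h]
  · rw [geom_sum_eq_zero _ h, neg_zero, map_zero]
    rw [← pow_mul, ← pow_succ', Nat.sub_add_cancel hk, hw]

theorem sum_trace_roots_of_unity (hdvd : ℓ ^ k ∣ Fintype.card F - 1) (g : ZMod p → ℤ) :
    ∑ w : F with w ^ ℓ ^ k = 1, g (Tr w) =
      g (Nat.totient (ℓ ^ k)) + (ℓ - 1) * g (-(ℓ : ZMod p) ^ (k - 1)) + (ℓ ^ k - ℓ) * g 0 := by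
  have hpow : ℓ ^ k = ℓ * ℓ ^ (k - 1) := by rw [← pow_succ', Nat.sub_add_cancel hk]
  have value (w : F) (hw : w ∈ ({w | w ^ ℓ ^ k = 1} : Finset F)) : g (Tr w) =
      g 0 + (if w ^ ℓ = 1 then g (-(ℓ : ZMod p) ^ (k - 1)) - g 0 else 0) +
        if w = 1 then g (Nat.totient (ℓ ^ k)) - g (-(ℓ : ZMod p) ^ (k - 1)) else 0 := by
    rcases eq_or_ne w 1 with rfl | hw1
    · rw [trace_one_of_card hF, one_pow, if_pos rfl, if_pos rfl]
      ring
    · rw [trace_root_of_unity hℓ hk hpℓ hord hF (mem_filter.mp hw).2 hw1, if_neg hw1]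
      split_ifs <;> ring
  have hfilter : ({w ∈ ({w | w ^ ℓ ^ k = 1} : Finset F) | w ^ ℓ = 1} : Finset F) =
      ({w | w ^ ℓ = 1} : Finset F) := by
    rw [filter_filter]
    refine filter_congr fun w _ => and_iff_right_of_imp fun hw => ?_
    rw [hpow, pow_mul, hw, one_pow]
  rw [sum_congr rfl value, sum_add_distrib, sum_add_distrib, ← sum_filter, hfilter, sum_const,
    sum_const, sum_ite_eq', if_pos (by simp), card_pow_eq_one hdvd,
    card_pow_eq_one ((Dvd.intro _ hpow.symm).trans hdvd)]
  simp only [nsmul_eq_mul, Nat.cast_pow]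
  ring

theorem sum_trace_pow (hp : p ≠ 2) (hℓ2 : ℓ ≠ 2) {N : ℕ}
    (hN : Fintype.card F - 1 = N * (2 * ℓ ^ k)) (g : ZMod p → ℤ) :
    ∑ y : F with y ≠ 0, g (Tr (y ^ N)) =
      N * (g (Nat.totient (ℓ ^ k)) + g (-Nat.totient (ℓ ^ k)) +
        (ℓ - 1) * (g ((ℓ : ZMod p) ^ (k - 1)) + g (-(ℓ : ZMod p) ^ (k - 1))) +
        (2 * ℓ ^ k - 2 * ℓ) * g 0) := by
  have hdvd : ℓ ^ k ∣ Fintype.card F - 1 := by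
    rw [hN, ← mul_assoc]
    exact Dvd.intro_left _ rfl
  rw [sum_comp_pow hN fun w => g (Tr w), sum_pow_two_mul_eq_one (one_ne_neg_one_of_algebra hp)
    (hℓ.odd_of_ne_two hℓ2).pow, sum_add_distrib]
  simp only [map_neg]
  rw [sum_trace_roots_of_unity hℓ hk hpℓ hord hF hdvd,
    sum_trace_roots_of_unity hℓ hk hpℓ hord hF hdvd fun t => g (-t)]
  simp only [nsmul_eq_mul, neg_neg, neg_zero]
  ring

end Trace

section ExponentialSums

/-- The value of `∑ z ≠ 0, ζ_p ^ (z t)`. -/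
def ramanujanSum {p : ℕ} (t : ZMod p) : ℤ := if t = 0 then (p : ℤ) - 1 else -1

/-- The value of `∑ z ≠ 0, ∑ w, ζ_p ^ (w ^ 2 a / z + z t)`. -/
noncomputable def quadraticSum (a t : ZMod p) : ℤ :=
  if a = 0 then p * ramanujanSum t else p * quadraticChar (ZMod p) (-(a * t))

theorem ramanujanSum_eq_ite_quadraticChar (t : ZMod p) :
    ramanujanSum t = if quadraticChar (ZMod p) (-t) = 0 then (p : ℤ) - 1 else -1 := by
  simp only [ramanujanSum, quadraticChar_eq_zero_iff, neg_eq_zero]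

theorem quadraticSum_zero_left (t : ZMod p) : quadraticSum 0 t = p * ramanujanSum t :=
  if_pos rfl

theorem quadraticSum_of_ne_zero {a : ZMod p} (ha : a ≠ 0) (t : ZMod p) :
    quadraticSum a t = p * quadraticChar (ZMod p) a * quadraticChar (ZMod p) (-t) := by
  rw [quadraticSum, if_neg ha, ← mul_neg, map_mul, mul_assoc]

theorem sum_ne_zero_stdAddChar (t : ZMod p) :
    ∑ z : ZMod p with z ≠ 0, ψ (z * t) = ramanujanSum t := by
  rw [filter_ne', ← add_left_inj (ψ ((0 : ZMod p) * t)),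
    sum_erase_add _ _ (mem_univ _), sum_stdAddChar_mul, ramanujanSum]
  split_ifs <;> simp

theorem card_sq_mul_add_eq_zero (hp : p ≠ 2) {a : ZMod p} (ha : a ≠ 0) (t : ZMod p) :
    (#{w : ZMod p | w ^ 2 * a + t = 0} : ℤ) = quadraticChar (ZMod p) (-(a * t)) + 1 := by
  have hsqrt : ({w : ZMod p | w ^ 2 * a + t = 0} : Finset (ZMod p)) =
      {x : ZMod p | x ^ 2 = -(a * t) * a⁻¹ ^ 2}.toFinset := by
    ext w
    simp only [mem_filter, mem_univ, true_and, Set.mem_toFinset, Set.mem_ofPred_eq]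
    rw [show -(a * t) * a⁻¹ ^ 2 = -t / a by field_simp, eq_div_iff ha, eq_neg_iff_add_eq_zero]
  rw [hsqrt, quadraticChar_card_sqrts (by rwa [ZMod.ringChar_zmod_n]), map_mul,
    quadraticChar_sq_one' (inv_ne_zero ha), mul_one]

theorem sum_ramanujanSum_quadratic (hp : p ≠ 2) (a t : ZMod p) :
    ∑ w : ZMod p, ramanujanSum (w ^ 2 * a + t) = quadraticSum a t := by
  have ramanujanSum_eq (u : ZMod p) : ramanujanSum u = (if u = 0 then (p : ℤ) else 0) - 1 := by
    rw [ramanujanSum]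
    split_ifs <;> simp
  rcases eq_or_ne a 0 with rfl | ha
  · simp [quadraticSum, ZMod.card]
  simp only [quadraticSum, if_neg ha, ramanujanSum_eq, sum_sub_distrib, ← sum_filter, sum_const,
    card_univ, ZMod.card, nsmul_eq_mul, card_sq_mul_add_eq_zero hp ha]
  ring

theorem sum_quadraticSum (hp : p ≠ 2) (a t : ZMod p) :
    ∑ z : ZMod p with z ≠ 0, ∑ w : ZMod p, ψ (z⁻¹ * (w ^ 2 * a) + z * t) =
      quadraticSum a t := by
  rw [← sum_ramanujanSum_quadratic hp]
  push_cast
  simp only [← sum_ne_zero_stdAddChar]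
  rw [sum_comm (s := univ)]
  refine sum_congr rfl fun z hz => ?_
  have hz0 : z ≠ 0 := (mem_filter.mp hz).2
  symm
  refine Fintype.sum_bijective (fun w => z * w) (mulLeft_bijective₀ z hz0) _ _ fun w => ?_
  congr 1
  field_simp

end ExponentialSums

section Counting

variable {f fs T : F → ZMod p} {E : ℤ}

theorem HasIntegralDual.card_zeros (hW : HasIntegralDual f fs E) (h0 : fs 0 = 0) :
    (p : ℤ) * #{z : F × F | f z.1 + T z.2 = 0} =
      Fintype.card F ^ 2 + E * ∑ y, ramanujanSum (T y) := by
  have sum_pair {t : ZMod p} (ht : t ≠ 0) :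
      ∑ z : F × F, ψ (t * (f z.1 + T z.2)) = E * ∑ y, ψ (t * T y) := by
    have hWt := hW t ht 0
    rw [walsh_zero, h0, mul_zero, AddChar.map_zero_eq_one, mul_one] at hWt
    rw [← hWt, sum_mul_sum, Fintype.sum_prod_type]
    simp only [mul_add, AddChar.map_add_eq_mul]
  have count : ∑ t : ZMod p, ∑ z : F × F, ψ (t * (f z.1 + T z.2)) =
      (p : ℂ) * #{z : F × F | f z.1 + T z.2 = 0} := by
    rw [sum_comm]
    simp only [sum_stdAddChar_mul, ← sum_filter, sum_const, nsmul_eq_mul, mul_comm]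
  rw [← sum_erase_add _ _ (mem_univ (0 : ZMod p)), ← filter_ne',
    sum_congr rfl fun t ht => sum_pair (mem_filter.mp ht).2, ← mul_sum, sum_comm] at count
  simp only [sum_ne_zero_stdAddChar, zero_mul, AddChar.map_zero_eq_one, sum_const, card_univ,
    Fintype.card_prod, nsmul_eq_mul, mul_one] at count
  rw [← Int.cast_inj (α := ℂ)]
  push_cast at count ⊢
  rw [← count]
  ring

theorem sum_trace_pair {g : F × F} (hg : g ≠ 0) :
    ∑ z : F × F, ψ (-Tr (g.1 * z.1 + g.2 * z.2)) = 0 := by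
  have := Classical.decEq F
  have separate (z : F × F) : ψ (-Tr (g.1 * z.1 + g.2 * z.2)) =
      ψ (Tr (-g.1 * z.1)) * ψ (Tr (-g.2 * z.2)) := by
    rw [← AddChar.map_add_eq_mul, ← map_add, ← map_neg]
    congr 2
    ring
  simp only [separate, Fintype.sum_prod_type, ← mul_sum, ← sum_mul, sum_stdAddChar_trace,
    neg_eq_zero]
  split_ifs with hfst hsnd
  · exact absurd (Prod.ext hfst hsnd) hg
  all_goals simp

theorem sum_indicator_hyperplane (g : F × F) :
    (p : ℂ) ^ 2 * #{z : F × F | f z.1 + T z.2 = 0 ∧ Tr (g.1 * z.1 + g.2 * z.2) = 0} =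
      ∑ t : ZMod p, ∑ w : ZMod p, ∑ z : F × F,
        ψ (t * (f z.1 + T z.2)) * ψ (w * -Tr (g.1 * z.1 + g.2 * z.2)) := by
  have indicator (z : F × F) : ∑ t : ZMod p, ∑ w : ZMod p,
      ψ (t * (f z.1 + T z.2)) * ψ (w * -Tr (g.1 * z.1 + g.2 * z.2)) =
      if f z.1 + T z.2 = 0 ∧ Tr (g.1 * z.1 + g.2 * z.2) = 0 then (p : ℂ) ^ 2 else 0 := by
    rw [← sum_mul_sum, sum_stdAddChar_mul, sum_stdAddChar_mul]
    simp only [neg_eq_zero]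
    split_ifs <;> simp_all [pow_two]
  simp only [sum_comm (t := (univ : Finset (F × F)))]
  simp only [indicator, ← sum_filter, sum_const, nsmul_eq_mul, mul_comm]

namespace HasIntegralDual

theorem card_zeros_hyperplane_complex (hW : HasIntegralDual f fs E)
    (hquad : ∀ (c : ZMod p) (x : F), fs (c • x) = c ^ 2 * fs x) {g : F × F} (hg : g ≠ 0) :
    (p : ℂ) ^ 2 * #{z : F × F | f z.1 + T z.2 = 0 ∧ Tr (g.1 * z.1 + g.2 * z.2) = 0} =
      Fintype.card F ^ 2 + E * ∑ t : ZMod p with t ≠ 0, ∑ w : ZMod p,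
        ψ (t⁻¹ * (w ^ 2 * fs g.1)) * ∑ y, ψ (t * T y - Tr (w • g.2 * y)) := by
  rw [sum_indicator_hyperplane, ← sum_erase_add _ _ (mem_univ (0 : ZMod p)), ← filter_ne', add_comm]
  congr 1
  · rw [sum_eq_single (0 : ZMod p)]
    · simp [pow_two]
    · intro w _ hw
      rw [← sum_trace_pair (p := p) (smul_ne_zero hw hg)]
      refine sum_congr rfl fun z _ => ?_
      simp only [zero_mul, AddChar.map_zero_eq_one, one_mul, Prod.smul_fst, Prod.smul_snd,
        smul_mul_assoc, ← smul_add, map_smul, smul_eq_mul, mul_neg]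
    · simp
  · simp only [mul_sum (s := filter _ _), mul_sum (ι := ZMod p)]
    refine sum_congr rfl fun t ht => sum_congr rfl fun w _ => ?_
    rw [← mul_assoc, ← hquad, ← hW t (mem_filter.mp ht).2, walsh, sum_mul_sum,
      Fintype.sum_prod_type]
    refine sum_congr rfl fun x _ => sum_congr rfl fun y _ => ?_
    rw [← AddChar.map_add_eq_mul, ← AddChar.map_add_eq_mul]
    simp only [smul_mul_assoc, map_smul, smul_eq_mul, map_add]
    congr 1
    ring

theorem card_zeros_hyperplane_of_snd_eq_zero (hW : HasIntegralDual f fs E) (hp : p ≠ 2)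
    (hquad : ∀ (c : ZMod p) (x : F), fs (c • x) = c ^ 2 * fs x) {c : F} (hc : c ≠ 0) :
    (p : ℤ) ^ 2 * #{z : F × F | f z.1 + T z.2 = 0 ∧ Tr (c * z.1 + 0 * z.2) = 0} =
      Fintype.card F ^ 2 + E * ∑ y, quadraticSum (fs c) (T y) := by
  rw [← Int.cast_inj (α := ℂ)]
  push_cast
  rw [hW.card_zeros_hyperplane_complex hquad (g := (c, 0)) fun h => hc (Prod.ext_iff.mp h).1]
  simp only [smul_zero, zero_mul, map_zero, sub_zero, mul_sum, ← AddChar.map_add_eq_mul,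
    ← sum_quadraticSum hp, sum_comm (t := (univ : Finset F))]

end HasIntegralDual

section Invariant

variable {m : ℕ}

omit [Fintype F] in
theorem apply_div_smul_of_invariant (hT : ∀ u y : F, u ^ (p ^ m - 1) = 1 → T (u * y) = T y)
    {w : ZMod p} (hw : w ≠ 0) (b d : F) : T (b / (w • d)) = T (b / d) := by
  obtain ⟨r, hr⟩ : p - 1 ∣ p ^ m - 1 := by simpa using Nat.sub_dvd_pow_sub_pow p 1 m
  have hroot : algebraMap (ZMod p) F w⁻¹ ^ (p ^ m - 1) = 1 := by
    rw [← map_pow, hr, pow_mul, ZMod.pow_card_sub_one_eq_one (inv_ne_zero hw), one_pow, map_one]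
  rw [← hT _ (b / d) hroot, Algebra.smul_def, map_inv₀, inv_mul_eq_div, div_div, mul_comm d]

theorem sum_stdAddChar_invariant (hp : p ≠ 2) (hm : 1 ≤ m)
    (hF : Fintype.card F = (p ^ m) ^ 2)
    (hT : ∀ u y : F, u ^ (p ^ m - 1) = 1 → T (u * y) = T y) (hT0 : T 0 = 0)
    {b : F} (hb : b ^ (p ^ m - 1) = -1) {d : F} (hd : d ≠ 0) (t w : ZMod p) :
    ((p : ℂ) ^ m - 1) * ∑ y, ψ (t * T y - Tr (w • d * y)) =
      (p ^ m * ψ (t * 0) + p ^ m * (p ^ m - 1) * ψ (t * T (b / d)) - ∑ y, ψ (t * T y)) +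
        if w = 0 then
          p ^ m * ∑ y, ψ (t * T y) - p ^ m * ψ (t * 0) - p ^ m * (p ^ m - 1) * ψ (t * T (b / d))
        else 0 := by
  split_ifs with hw
  · simp only [hw, zero_smul, zero_mul, map_zero, sub_zero]
    ring
  · have hsum := sum_invariant_mul_stdAddChar hp hm hF (fun y => ψ (t * T y))
      (fun u y hu => by rw [hT u y hu]) hb (smul_ne_zero (neg_ne_zero.mpr hw) hd)
    rw [apply_div_smul_of_invariant hT (neg_ne_zero.mpr hw), hT0] at hsum
    rw [add_zero, ← hsum]
    simp only [← AddChar.map_add_eq_mul, neg_smul, neg_mul, map_neg, sub_eq_add_neg]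

theorem sum_quadratic_mul_stdAddChar_invariant (hp : p ≠ 2) (hm : 1 ≤ m)
    (hF : Fintype.card F = (p ^ m) ^ 2)
    (hT : ∀ u y : F, u ^ (p ^ m - 1) = 1 → T (u * y) = T y) (hT0 : T 0 = 0)
    {b : F} (hb : b ^ (p ^ m - 1) = -1) {d : F} (hd : d ≠ 0) (a : ZMod p) :
    ((p : ℂ) ^ m - 1) * ∑ t : ZMod p with t ≠ 0, ∑ w : ZMod p,
        ψ (t⁻¹ * (w ^ 2 * a)) * ∑ y, ψ (t * T y - Tr (w • d * y)) =
      p ^ m * quadraticSum a 0 + p ^ m * (p ^ m - 1) * quadraticSum a (T (b / d)) -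
        ∑ y, (quadraticSum a (T y) : ℂ) + p ^ m * ∑ y, (ramanujanSum (T y) : ℂ) -
        p ^ m * ramanujanSum (0 : ZMod p) - p ^ m * (p ^ m - 1) * ramanujanSum (T (b / d)) := by
  have quadraticSum_eq (v : ZMod p) : (quadraticSum a v : ℂ) =
      ∑ t : ZMod p with t ≠ 0, (∑ w : ZMod p, ψ (t⁻¹ * (w ^ 2 * a))) * ψ (t * v) := by
    simp only [← sum_quadraticSum hp, sum_mul, AddChar.map_add_eq_mul]
  have sum_quadraticSum_eq : ∑ y, (quadraticSum a (T y) : ℂ) =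
      ∑ t : ZMod p with t ≠ 0, (∑ w : ZMod p, ψ (t⁻¹ * (w ^ 2 * a))) * ∑ y, ψ (t * T y) := by
    simp only [quadraticSum_eq, mul_sum (ι := F)]
    rw [sum_comm]
  have sum_ramanujanSum_eq : ∑ y, (ramanujanSum (T y) : ℂ) =
      ∑ t : ZMod p with t ≠ 0, ∑ y, ψ (t * T y) := by
    simp only [← sum_ne_zero_stdAddChar]
    rw [sum_comm]
  rw [sum_quadraticSum_eq, sum_ramanujanSum_eq, quadraticSum_eq, quadraticSum_eq,
    ← sum_ne_zero_stdAddChar, ← sum_ne_zero_stdAddChar]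
  simp only [mul_sum (s := filter _ _), ← sum_add_distrib, ← sum_sub_distrib]
  refine sum_congr rfl fun t _ => ?_
  rw [mul_sum]
  simp only [mul_left_comm ((p : ℂ) ^ m - 1), sum_stdAddChar_invariant hp hm hF hT hT0 hb hd,
    mul_add, sum_add_distrib, ← sum_mul, mul_ite, mul_zero, sum_ite_eq', mem_univ, if_true, ne_eq,
    OfNat.ofNat_ne_zero, not_false_eq_true, zero_pow, zero_mul, AddChar.map_zero_eq_one]
  ring

theorem HasIntegralDual.card_zeros_hyperplane_of_snd_ne_zero (hW : HasIntegralDual f fs E)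
    (hp : p ≠ 2) (hm : 1 ≤ m) (hF : Fintype.card F = (p ^ m) ^ 2)
    (hquad : ∀ (c : ZMod p) (x : F), fs (c • x) = c ^ 2 * fs x)
    (hT : ∀ u y : F, u ^ (p ^ m - 1) = 1 → T (u * y) = T y) (hT0 : T 0 = 0)
    {b : F} (hb : b ^ (p ^ m - 1) = -1) {c d : F} (hd : d ≠ 0) :
    ((p : ℤ) ^ m - 1) * ((p : ℤ) ^ 2 * #{z : F × F | f z.1 + T z.2 = 0 ∧
        Tr (c * z.1 + d * z.2) = 0}) =
      ((p : ℤ) ^ m - 1) * Fintype.card F ^ 2 + E * (p ^ m * quadraticSum (fs c) 0 +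
        p ^ m * (p ^ m - 1) * quadraticSum (fs c) (T (b / d)) - ∑ y, quadraticSum (fs c) (T y) +
        p ^ m * ∑ y, ramanujanSum (T y) - p ^ m * ramanujanSum (0 : ZMod p) -
        p ^ m * (p ^ m - 1) * ramanujanSum (T (b / d))) := by
  rw [← Int.cast_inj (α := ℂ)]
  push_cast
  rw [hW.card_zeros_hyperplane_complex hquad (g := (c, d)) fun h => hd (Prod.ext_iff.mp h).2,
    ← sum_quadratic_mul_stdAddChar_invariant hp hm hF hT hT0 hb hd]
  ring

end Invariant

end Counting

section Deviation

/-- The deviation of `p ^ 2` times the weight of `(γ, 0)` from `(p - 1) q ^ 2`, as a multiple of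
`E`, when `η(f^*(γ)) = σ ≠ 0`; here `s = √q`, `r = u + v` and `t = u - v`, where `(s - 1) u` and
`(s - 1) v` count the `y` with `-T y` a nonzero square and a nonsquare. -/
def devLine (p s r t σ : ℤ) : ℤ := p * ((p - 1) * s ^ 2 - (s - 1) * (p * r + σ * t))

/-- The analogous deviation for `(γ, δ)` with `δ ≠ 0`, `f^*(γ) = 0` and trace zero at `b / δ`. -/
def devNull (p s r : ℤ) : ℤ := (p - 1) * s * ((p - 1) * s - p * r)

/-- The analogous deviation for `(γ, δ)` with `δ ≠ 0`, `η(f^*(γ)) = σ ≠ 0` and trace zero at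
`b / δ`. -/
def devPlane (p s r t σ : ℤ) : ℤ :=
  (p - 1) ^ 2 * s ^ 2 - p * r * ((p - 1) * (s - 1) - 1) + p * σ * t

/-- The deviation for `(γ, δ)` with `δ ≠ 0`, depending on `σ = η(f^*(γ))` and
`ν = η(-T(b / δ))`. -/
def dev (p s r t σ ν : ℤ) : ℤ :=
  if σ = 0 then devNull p s r + (if ν = 0 then 0 else p * (p - 1) * s)
  else devPlane p s r t σ - if ν = σ then 2 * p * s else 0

variable {p s r t : ℤ}

theorem abs_devLine_lt (hp : 3 ≤ p) (hs : p ≤ s) (hr : 1 ≤ r) (hrs : r ≤ s + 1) (ht : |t| ≤ r)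
    {σ : ℤ} (hσ : σ = 1 ∨ σ = -1) : |devLine p s r t σ| < (p - 1) * s ^ 3 := by
  obtain ⟨ht_lower, ht_upper⟩ := abs_le.mp ht
  obtain ⟨x, hx⟩ : ∃ x, x = p * r + σ * t := ⟨_, rfl⟩
  have one_le_x : 1 ≤ x := by rcases hσ with rfl | rfl <;> nlinarith
  have x_le : x ≤ (p + 1) * (s + 1) :=
    calc x ≤ (p + 1) * r := by rcases hσ with rfl | rfl <;> nlinarith
      _ ≤ (p + 1) * (s + 1) := by gcongr
  have one_le_mul : 1 ≤ (s - 1) * x := by nlinarith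
  have cube_bound : (p - 1) * (p * s ^ 2) ≤ (p - 1) * s ^ 3 :=
    mul_le_mul_of_nonneg_left (by nlinarith [sq_nonneg s]) (by linarith)
  have mul_x_le : (s - 1) * x ≤ (s - 1) * ((p + 1) * (s + 1)) :=
    mul_le_mul_of_nonneg_left x_le (by linarith)
  have two_mul_le : 2 * (p * s ^ 2) ≤ (p - 1) * (p * s ^ 2) :=
    mul_le_mul_of_nonneg_right (by linarith) (by positivity)
  rw [devLine, ← hx, abs_lt]
  constructor <;> nlinarith

theorem abs_devNull_lt (hp : 3 ≤ p) (hs : p ≤ s) (hr : 1 ≤ r) (hrs : r ≤ s + 1) :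
    |devNull p s r| < (p - 1) * s ^ 3 ∧ |devNull p s r + p * (p - 1) * s| < (p - 1) * s ^ 3 := by
  have factor (y : ℤ) (hy : 0 ≤ y) (hyp : y ≤ p) :
      |(p - 1) * s * ((p - 1) * s - p * r + y)| < (p - 1) * s ^ 3 := by
    have hpos : 0 < (p - 1) * s := by nlinarith
    have hlt : |(p - 1) * s - p * r + y| < s ^ 2 := by
      rw [abs_lt]
      constructor <;> nlinarith
    rw [abs_mul, abs_of_pos hpos, pow_succ', ← mul_assoc]
    exact mul_lt_mul_of_pos_left hlt hpos
  constructor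
  · simpa [devNull] using factor 0 le_rfl (by linarith)
  · convert factor p (by linarith) le_rfl using 2
    rw [devNull]
    ring

theorem abs_devPlane_lt (hp : 3 ≤ p) (hs : p ≤ s) (hr : 1 ≤ r) (hrs : r ≤ s + 1) (ht : |t| ≤ r)
    {σ : ℤ} (hσ : σ = 1 ∨ σ = -1) :
    |devPlane p s r t σ| < (p - 1) * s ^ 3 ∧
      |devPlane p s r t σ - 2 * p * s| < (p - 1) * s ^ 3 := by
  obtain ⟨x, hx⟩ : ∃ x, x = r * ((p - 1) * (s - 1) - 1) - σ * t := ⟨_, rfl⟩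
  have dev_eq : devPlane p s r t σ = (p - 1) ^ 2 * s ^ 2 - p * x := by
    rw [devPlane, hx]
    ring
  obtain ⟨hσt_lower, hσt_upper⟩ : -r ≤ σ * t ∧ σ * t ≤ r := by
    obtain ⟨ht_lower, ht_upper⟩ := abs_le.mp ht
    rcases hσ with rfl | rfl <;> constructor <;> linarith
  have two_le : 2 ≤ (p - 1) * (s - 1) - 1 := by nlinarith
  have x_nonneg : 0 ≤ p * x := mul_nonneg (by linarith) (by nlinarith)
  have x_le : p * x ≤ p * ((s + 1) * ((p - 1) * (s - 1))) :=
    mul_le_mul_of_nonneg_left (by nlinarith) (by linarith)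
  have sq_lt : (p - 1) * s * ((p - 1) * s) < (p - 1) * s * s ^ 2 :=
    mul_lt_mul_of_pos_left (by nlinarith) (by nlinarith)
  have shift_lt : s * (2 * p) < s * ((p - 1) * s * (s - 1)) := by
    have : 3 * 2 ≤ s * (s - 1) := by nlinarith
    exact mul_lt_mul_of_pos_left (by nlinarith) (by linarith)
  rw [dev_eq, abs_lt, abs_lt]
  refine ⟨⟨?_, ?_⟩, ?_, ?_⟩ <;> nlinarith

end Deviation

/-- The data from which the weight distribution is computed: `f` is bent with dual `fs` and integral
Walsh factor `E`, and `T` is invariant under the multiplicative group of the subfield of `p ^ m`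
elements, with prescribed numbers of square and nonsquare values of `-T`. The element `b` is the
reference point at which `T (b / δ)` governs the weight of `(γ, δ)`. -/
structure IsWeightData {p : ℕ} [Fact p.Prime] {F : Type*} [Field F] [Fintype F] [DecidableEq F]
    [Algebra (ZMod p) F] (f fs T : F → ZMod p) (E : ℤ) (m : ℕ) (b : F) (u v : ℤ) : Prop where
  ne_two : p ≠ 2
  one_le : 1 ≤ m
  card_eq : Fintype.card F = (p ^ m) ^ 2
  integralDual : HasIntegralDual f fs E
  dual_smul : ∀ (c : ZMod p) (x : F), fs (c • x) = c ^ 2 * fs x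
  sum_dual : ∑ x : F, ψ (fs x) = E
  sq_eq : E ^ 2 = ((p : ℤ) ^ m) ^ 2
  map_zero : f 0 = 0
  trace_zero : T 0 = 0
  trace_mul : ∀ u y : F, u ^ (p ^ m - 1) = 1 → T (u * y) = T y
  pow_eq : b ^ (p ^ m - 1) = -1
  nonneg_pos : 0 ≤ u
  nonneg_neg : 0 ≤ v
  pos_add : 1 ≤ u + v
  card_pos : (#{y : F | y ≠ 0 ∧ quadraticChar (ZMod p) (-T y) = 1} : ℤ) = ((p : ℤ) ^ m - 1) * u
  card_neg : (#{y : F | y ≠ 0 ∧ quadraticChar (ZMod p) (-T y) = -1} : ℤ) = ((p : ℤ) ^ m - 1) * v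

namespace IsWeightData

variable [DecidableEq F] {f fs T : F → ZMod p} {E : ℤ} {m : ℕ} {b : F} {u v : ℤ}

theorem dual_zero (h : IsWeightData f fs T E m b u v) : fs 0 = 0 := by
  simpa using h.dual_smul 0 0

theorem three_le (h : IsWeightData f fs T E m b u v) : (3 : ℤ) ≤ p := by
  exact_mod_cast (Fact.out : p.Prime).two_le.lt_of_ne' h.ne_two

theorem le_pow (h : IsWeightData f fs T E m b u v) : (p : ℤ) ≤ (p : ℤ) ^ m := by
  exact_mod_cast Nat.le_self_pow (Nat.one_le_iff_ne_zero.mp h.one_le) p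

theorem card_eq_int (h : IsWeightData f fs T E m b u v) :
    (Fintype.card F : ℤ) = ((p : ℤ) ^ m) ^ 2 := by
  exact_mod_cast h.card_eq

theorem sum_trace (h : IsWeightData f fs T E m b u v) {R : Type*} [CommRing R] (g : ℤ → R) :
    ∑ y : F with y ≠ 0, g (quadraticChar (ZMod p) (-T y)) =
      ((p : R) ^ m - 1) * ((p ^ m + 1 - u - v) * g 0 + u * g 1 + v * g (-1)) := by
  have indicator (y : F) : g (quadraticChar (ZMod p) (-T y)) = g 0 +
      (if quadraticChar (ZMod p) (-T y) = 1 then g 1 - g 0 else 0) +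
      (if quadraticChar (ZMod p) (-T y) = -1 then g (-1) - g 0 else 0) := by
    rcases eq_or_ne (-T y) 0 with h0 | h0
    · simp [h0]
    · rcases quadraticChar_dichotomy h0 with hχ | hχ <;> simp [hχ]
  have card_ne_zero : (#{y : F | y ≠ 0} : R) = ((p : R) ^ m) ^ 2 - 1 := by
    rw [filter_ne', card_erase_of_mem (mem_univ _), card_univ, Nat.cast_pred Fintype.card_pos,
      h.card_eq]
    push_cast
    rfl
  have card_pos := congrArg (Int.cast : ℤ → R) h.card_pos
  have card_neg := congrArg (Int.cast : ℤ → R) h.card_neg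
  push_cast at card_pos card_neg
  rw [sum_congr rfl fun y _ => indicator y, sum_add_distrib, sum_add_distrib, ← sum_filter,
    ← sum_filter, filter_filter, filter_filter, sum_const, sum_const, sum_const, nsmul_eq_mul,
    nsmul_eq_mul, nsmul_eq_mul, card_ne_zero, card_pos, card_neg]
  ring

theorem add_le (h : IsWeightData f fs T E m b u v) : u + v ≤ (p : ℤ) ^ m + 1 := by
  have count_zero : 0 ≤ ∑ y : F with y ≠ 0,
      if quadraticChar (ZMod p) (-T y) = 0 then (1 : ℤ) else 0 :=
    sum_nonneg fun _ _ => by split_ifs <;> simp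
  rw [h.sum_trace (fun x => if x = 0 then 1 else 0)] at count_zero
  norm_num at count_zero
  have hp := h.three_le
  have hs := h.le_pow
  by_contra hc
  nlinarith

theorem sum_ramanujanSum (h : IsWeightData f fs T E m b u v) :
    ∑ y, ramanujanSum (T y) =
      (p - 1) + ((p : ℤ) ^ m - 1) * (p * (p ^ m + 1 - u - v) - (p ^ m + 1)) := by
  rw [← add_sum_erase _ _ (mem_univ (0 : F)), ← filter_ne', h.trace_zero]
  simp only [ramanujanSum_eq_ite_quadraticChar,
    h.sum_trace (fun x => if x = 0 then (p : ℤ) - 1 else -1), Int.cast_id, neg_zero,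
    quadraticChar_zero, if_true, one_ne_zero, neg_eq_zero, if_false]
  ring

theorem sum_quadraticSum (h : IsWeightData f fs T E m b u v) {a : ZMod p} (ha : a ≠ 0) :
    ∑ y, quadraticSum a (T y) =
      p * quadraticChar (ZMod p) a * (((p : ℤ) ^ m - 1) * (u - v)) := by
  rw [← add_sum_erase _ _ (mem_univ (0 : F)), ← filter_ne', h.trace_zero]
  simp only [quadraticSum_of_ne_zero ha, ← mul_sum, h.sum_trace (fun x => x), Int.cast_id, neg_zero,
    quadraticChar_zero]
  ring

theorem weight_of_snd_eq_zero (h : IsWeightData f fs T E m b u v) {c : F} (hc : c ≠ 0) :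
    (p : ℤ) ^ 2 * (#{z : F × F | f z.1 + T z.2 = 0} -
        #{z : F × F | f z.1 + T z.2 = 0 ∧ Tr (c * z.1 + 0 * z.2) = 0}) =
      (p - 1) * ((p : ℤ) ^ m) ^ 4 + E * if quadraticChar (ZMod p) (fs c) = 0 then 0 else
        devLine p (p ^ m) (u + v) (u - v) (quadraticChar (ZMod p) (fs c)) := by
  have zeros := h.integralDual.card_zeros (T := T) h.dual_zero
  have zeros_hyperplane := h.integralDual.card_zeros_hyperplane_of_snd_eq_zero (T := T) h.ne_two
    h.dual_smul hc
  rw [h.card_eq_int, h.sum_ramanujanSum] at zeros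
  rw [h.card_eq_int] at zeros_hyperplane
  rw [mul_sub, zeros_hyperplane, pow_two (p : ℤ), mul_assoc, zeros]
  by_cases ha : fs c = 0
  · simp only [ha, quadraticSum_zero_left, ← mul_sum, h.sum_ramanujanSum, quadraticChar_zero,
      if_true]
    ring
  · rw [h.sum_quadraticSum ha, if_neg (by rwa [quadraticChar_eq_zero_iff]), devLine]
    ring

theorem weight_of_snd_ne_zero (h : IsWeightData f fs T E m b u v) (c : F) {d : F} (hd : d ≠ 0) :
    (p : ℤ) ^ 2 * (#{z : F × F | f z.1 + T z.2 = 0} -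
        #{z : F × F | f z.1 + T z.2 = 0 ∧ Tr (c * z.1 + d * z.2) = 0}) =
      (p - 1) * ((p : ℤ) ^ m) ^ 4 + E * dev p (p ^ m) (u + v) (u - v)
        (quadraticChar (ZMod p) (fs c)) (quadraticChar (ZMod p) (-T (b / d))) := by
  have zeros := h.integralDual.card_zeros (T := T) h.dual_zero
  have zeros_hyperplane := h.integralDual.card_zeros_hyperplane_of_snd_ne_zero (T := T) h.ne_two
    h.one_le h.card_eq h.dual_smul h.trace_mul h.trace_zero h.pow_eq (c := c) hd
  rw [h.card_eq_int, h.sum_ramanujanSum] at zeros zeros_hyperplane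
  have hs : (p : ℤ) ^ m - 1 ≠ 0 := by
    have := h.three_le
    have := h.le_pow
    omega
  apply mul_left_cancel₀ hs
  rw [mul_sub, mul_sub, zeros_hyperplane, pow_two (p : ℤ), mul_assoc (p : ℤ) p, zeros, dev]
  by_cases ha : fs c = 0
  · simp only [ha, quadraticSum_zero_left, ← mul_sum, h.sum_ramanujanSum]
    simp only [ramanujanSum_eq_ite_quadraticChar, neg_zero, quadraticChar_zero, if_true, devNull]
    split_ifs <;> ring
  · rw [h.sum_quadraticSum ha, if_neg (by rwa [quadraticChar_eq_zero_iff]), devPlane,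
      quadraticSum_of_ne_zero ha, quadraticSum_of_ne_zero ha, ramanujanSum_eq_ite_quadraticChar,
      ramanujanSum_eq_ite_quadraticChar, neg_zero, quadraticChar_zero]
    rcases quadraticChar_dichotomy ha with hσ | hσ <;>
      rcases eq_or_ne (-T (b / d)) 0 with hτ | hτ
    case inl.inl | inr.inl =>
      simp only [hσ, hτ, quadraticChar_zero]
      norm_num
      ring
    all_goals rcases quadraticChar_dichotomy hτ with hν | hν <;> norm_num [hσ, hν] <;> ring

end IsWeightData

/-- The weight with deviation `x`. -/
def weightOf (p s E x : ℤ) : ℚ := ((p - 1) * s ^ 4 + E * x) / p ^ 2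

/-- The weight distribution for arbitrary `E`, `u`, `v`, before rows are merged. -/
def generalTable (p s E u v : ℤ) : List (ℚ × ℚ) :=
  let Z : ℚ := ((s : ℚ) ^ 2 + (p - 1) * E) / p
  let Y : ℚ := ((s : ℚ) ^ 2 - E) / p
  [(0, 1),
   (weightOf p s E 0, Z - 1),
   (weightOf p s E (devNull p s (u + v) + p * (p - 1) * s), (s - 1) * (u + v) * Z),
   (weightOf p s E (devNull p s (u + v)), (s - 1) * (s + 1 - u - v) * Z),
   (weightOf p s E (devLine p s (u + v) (u - v) 1), (p - 1) / 2 * Y),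
   (weightOf p s E (devLine p s (u + v) (u - v) (-1)), (p - 1) / 2 * Y),
   (weightOf p s E (devPlane p s (u + v) (u - v) 1 - 2 * p * s),
    (s - 1) * u * ((p - 1) / 2 * Y)),
   (weightOf p s E (devPlane p s (u + v) (u - v) 1), (s - 1) * (s + 1 - u) * ((p - 1) / 2 * Y)),
   (weightOf p s E (devPlane p s (u + v) (u - v) (-1) - 2 * p * s),
    (s - 1) * v * ((p - 1) / 2 * Y)),
   (weightOf p s E (devPlane p s (u + v) (u - v) (-1)),
    (s - 1) * (s + 1 - v) * ((p - 1) / 2 * Y))]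

/-- The sum of the frequencies of the rows of weight `w`. -/
def rowSum (w : ℚ) (table : List (ℚ × ℚ)) : ℚ :=
  (table.map fun r => r.2 * if r.1 = w then 1 else 0).sum

theorem sum_filter_eq_rowSum (w : ℚ) (table : List (ℚ × ℚ)) :
    ((table.filter fun r => decide (r.1 = w)).map Prod.snd).sum = rowSum w table := by
  unfold rowSum
  induction table with
  | nil => simp
  | cons a l ih => by_cases h : a.1 = w <;> simp [h, ih]

theorem weightOf_pos {p s E x : ℤ} (hp : p ≠ 0) (hs : 0 < s) (hE : E ^ 2 = s ^ 2)
    (hx : |x| < (p - 1) * s ^ 3) : 0 < weightOf p s E x := by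
  have abs_E : |E| = s := by rw [← abs_of_pos hs, ← sq_eq_sq_iff_abs_eq_abs, hE]
  have abs_lt_main : |E * x| < (p - 1) * s ^ 4 :=
    calc |E * x| = s * |x| := by rw [abs_mul, abs_E]
      _ < s * ((p - 1) * s ^ 3) := mul_lt_mul_of_pos_left hx hs
      _ = (p - 1) * s ^ 4 := by ring
  have numerator_pos : 0 < (p - 1) * s ^ 4 + E * x := by linarith [(abs_lt.mp abs_lt_main).1]
  rw [weightOf]
  have : (0 : ℚ) < p ^ 2 := by positivity
  exact div_pos (by exact_mod_cast numerator_pos) this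

theorem natCast_eq_weightOf {p : ℕ} (hp : p ≠ 0) {s E x : ℤ} {n : ℕ}
    (h : (p : ℤ) ^ 2 * n = (p - 1) * s ^ 4 + E * x) : (n : ℚ) = weightOf p s E x := by
  rw [weightOf, eq_div_iff (by positivity), mul_comm]
  exact_mod_cast h

section Codewords

theorem hammingNorm_codeword {f T : F → ZMod p} {D : Finset (F × F)}
    (hD : ∀ z, z ∈ D ↔ z ≠ 0 ∧ f z.1 + T z.2 = 0) (g : F × F) :
    (hammingNorm (codeword p D g) : ℤ) =
      #{z : F × F | f z.1 + T z.2 = 0} -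
        #{z : F × F | f z.1 + T z.2 = 0 ∧ Tr (g.1 * z.1 + g.2 * z.2) = 0} := by
  have norm_eq : hammingNorm (codeword p D g) = #{z ∈ D | ¬ Tr (g.1 * z.1 + g.2 * z.2) = 0} := by
    rw [hammingNorm, card_filter, card_filter]
    exact sum_coe_sort D fun z : F × F => if ¬ Tr (g.1 * z.1 + g.2 * z.2) = 0 then 1 else 0
  have add_origin : ({z ∈ D | ¬ Tr (g.1 * z.1 + g.2 * z.2) = 0} : Finset (F × F)) =
      {z ∈ ({z : F × F | f z.1 + T z.2 = 0} : Finset (F × F)) |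
        ¬ Tr (g.1 * z.1 + g.2 * z.2) = 0} := by
    ext z
    simp only [mem_filter, hD, mem_univ, true_and]
    refine and_congr_left fun hz => and_iff_right ?_
    rintro rfl
    simp at hz
  rw [norm_eq, add_origin, ← card_filter_add_card_filter_not
    (s := ({z : F × F | f z.1 + T z.2 = 0} : Finset (F × F)))
    (fun z => Tr (g.1 * z.1 + g.2 * z.2) = 0)]
  simp only [filter_filter]
  push_cast
  ring

theorem weightCount_code {D : Finset (F × F)} (hD : Function.Injective (codeword p D)) (w : ℚ) :
    (weightCount (code p D) w : ℚ) =
      ∑ c : F, ∑ d : F, if (hammingNorm (codeword p D (c, d)) : ℚ) = w then 1 else 0 := by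
  have image : {c | c ∈ code p D ∧ (hammingNorm c : ℚ) = w} =
      (({g : F × F | (hammingNorm (codeword p D g) : ℚ) = w} : Finset (F × F)).map
        ⟨codeword p D, hD⟩ : Finset (D → ZMod p)) := by
    ext c
    simp only [code, Set.mem_ofPred_eq, LinearMap.mem_range, coe_map, Function.Embedding.coeFn_mk,
      Set.mem_image, mem_coe, mem_filter, mem_univ, true_and]
    constructor
    · rintro ⟨⟨g, rfl⟩, hg⟩
      exact ⟨g, hg, rfl⟩
    · rintro ⟨g, hg, rfl⟩
      exact ⟨⟨g, rfl⟩, hg⟩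
  rw [weightCount, image, Set.ncard_coe_finset, card_map, card_filter, Fintype.sum_prod_type]
  push_cast
  rfl

end Codewords

theorem sum_quadraticChar_comp {K : Type*} [Field K] [Fintype K] [DecidableEq K]
    (hK : ringChar K ≠ 2) (g : ℤ → ℚ) :
    ∑ a : K, g (quadraticChar K a) = g 0 + (Fintype.card K - 1) / 2 * (g 1 + g (-1)) := by
  have interpolate (a : K) : g (quadraticChar K a) = (g 1 + g (-1)) / 2 +
      (g 1 - g (-1)) / 2 * (quadraticChar K a : ℤ) +
      if a = 0 then g 0 - (g 1 + g (-1)) / 2 else 0 := by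
    rcases eq_or_ne a 0 with rfl | ha
    · simp
    · rcases quadraticChar_dichotomy ha with hχ | hχ <;> rw [hχ, if_neg ha] <;> push_cast <;> ring
  simp only [interpolate, sum_add_distrib, ← mul_sum, ← Int.cast_sum, quadraticChar_sum_zero hK,
    Int.cast_zero, sum_ite_eq', mem_univ, if_true, sum_const, card_univ, nsmul_eq_mul]
  ring

namespace IsWeightData

variable [DecidableEq F] {f fs T : F → ZMod p} {E : ℤ} {m : ℕ} {b : F} {u v : ℤ}

theorem abs_sub_le (h : IsWeightData f fs T E m b u v) : |u - v| ≤ u + v :=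
  abs_le.mpr ⟨by linarith [h.nonneg_pos], by linarith [h.nonneg_neg]⟩

theorem sum_dual_quadraticChar (h : IsWeightData f fs T E m b u v) (g : ℤ → ℚ) :
    ∑ c : F, g (quadraticChar (ZMod p) (fs c)) =
      (((p : ℚ) ^ m) ^ 2 + (p - 1) * E) / p * g 0 +
        (p - 1) / 2 * ((((p : ℚ) ^ m) ^ 2 - E) / p) * (g 1 + g (-1)) := by
  have hp0 : (p : ℚ) ≠ 0 := Nat.cast_ne_zero.mpr (Fact.out : p.Prime).ne_zero
  have ringChar_ne_two : ringChar (ZMod p) ≠ 2 := by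
    rw [ZMod.ringChar_zmod_n]
    exact h.ne_two
  have card_fiber (a : ZMod p) : (#{c : F | fs c = a} : ℚ) =
      (((p : ℚ) ^ m) ^ 2 - E) / p + if a = 0 then (E : ℚ) else 0 := by
    have hfiber := congrArg (Int.cast : ℤ → ℚ) (card_fiber_of_sum_eq h.sum_dual a)
    rw [h.card_eq_int] at hfiber
    split_ifs at hfiber ⊢ <;> push_cast at hfiber <;> field_simp <;> linarith
  have fiberwise : ∑ c : F, g (quadraticChar (ZMod p) (fs c)) =
      ∑ a : ZMod p, (#{c : F | fs c = a} : ℚ) * g (quadraticChar (ZMod p) a) := by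
    rw [← sum_fiberwise univ fs]
    refine sum_congr rfl fun a _ => ?_
    rw [sum_congr rfl (g := fun _ => g (quadraticChar (ZMod p) a))
      (fun x hx => by rw [(mem_filter.mp hx).2]), sum_const, nsmul_eq_mul]
  rw [fiberwise]
  simp only [card_fiber, add_mul, sum_add_distrib, ← mul_sum, ite_mul, zero_mul, sum_ite_eq',
    mem_univ, if_true, quadraticChar_zero,
    sum_quadraticChar_comp ringChar_ne_two, ZMod.card]
  field_simp
  ring

theorem sum_trace_div (h : IsWeightData f fs T E m b u v) (g : ℤ → ℚ) :
    ∑ d : F with d ≠ 0, g (quadraticChar (ZMod p) (-T (b / d))) =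
      ((p : ℚ) ^ m - 1) * ((p ^ m + 1 - u - v) * g 0 + u * g 1 + v * g (-1)) := by
  rw [← h.sum_trace]
  have hb : b ≠ 0 := by
    rintro rfl
    have hs := three_le_prime_pow h.ne_two h.one_le
    exact neg_ne_zero.mpr one_ne_zero
      (by rw [← h.pow_eq, zero_pow (by omega)] : (-1 : F) = 0)
  have mem_div (d : F) (hd : d ∈ ({d : F | d ≠ 0} : Finset F)) :
      b / d ∈ ({d : F | d ≠ 0} : Finset F) := by
    simp only [mem_filter, mem_univ, true_and] at hd ⊢
    exact div_ne_zero hb hd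
  exact sum_bij' (fun d _ => b / d) (fun d _ => b / d) mem_div mem_div
    (fun _ _ => div_div_cancel₀ hb) (fun _ _ => div_div_cancel₀ hb) fun _ _ => rfl

variable {D : Finset (F × F)}

theorem card_eq_length (h : IsWeightData f fs T E m b u v)
    (hD : ∀ z, z ∈ D ↔ z ≠ 0 ∧ f z.1 + T z.2 = 0) :
    (p : ℤ) * (#D + 1) = ((p : ℤ) ^ m) ^ 4 +
      E * ((p - 1) + ((p : ℤ) ^ m - 1) * (p * (p ^ m + 1 - u - v) - (p ^ m + 1))) := by
  have erase_origin : D = ({z : F × F | f z.1 + T z.2 = 0} : Finset (F × F)).erase 0 := by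
    ext z
    rw [hD, mem_erase, mem_filter]
    simp
  have card_add_one : #D + 1 = #{z : F × F | f z.1 + T z.2 = 0} := by
    rw [erase_origin, card_erase_add_one (by simp [h.map_zero, h.trace_zero])]
  rw [← Nat.cast_one, ← Nat.cast_add, card_add_one, h.integralDual.card_zeros h.dual_zero,
    h.card_eq_int, h.sum_ramanujanSum]
  ring

theorem hammingNorm_of_snd_eq_zero (h : IsWeightData f fs T E m b u v)
    (hD : ∀ z, z ∈ D ↔ z ≠ 0 ∧ f z.1 + T z.2 = 0) {c : F} (hc : c ≠ 0) :
    (hammingNorm (codeword p D (c, 0)) : ℚ) = weightOf p (p ^ m) E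
      (if quadraticChar (ZMod p) (fs c) = 0 then 0 else
        devLine p (p ^ m) (u + v) (u - v) (quadraticChar (ZMod p) (fs c))) :=
  natCast_eq_weightOf (Fact.out : p.Prime).ne_zero
    (by rw [hammingNorm_codeword hD, ← h.weight_of_snd_eq_zero hc])

theorem hammingNorm_of_snd_ne_zero (h : IsWeightData f fs T E m b u v)
    (hD : ∀ z, z ∈ D ↔ z ≠ 0 ∧ f z.1 + T z.2 = 0) (c : F) {d : F} (hd : d ≠ 0) :
    (hammingNorm (codeword p D (c, d)) : ℚ) = weightOf p (p ^ m) E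
      (dev p (p ^ m) (u + v) (u - v) (quadraticChar (ZMod p) (fs c))
        (quadraticChar (ZMod p) (-T (b / d)))) :=
  natCast_eq_weightOf (Fact.out : p.Prime).ne_zero
    (by rw [hammingNorm_codeword hD, ← h.weight_of_snd_ne_zero c hd])

theorem abs_dev_lt (h : IsWeightData f fs T E m b u v) {σ : ℤ} (hσ : σ = 0 ∨ σ = 1 ∨ σ = -1)
    (ν : ℤ) : |dev p (p ^ m) (u + v) (u - v) σ ν| < (p - 1) * ((p : ℤ) ^ m) ^ 3 := by
  have hnull := abs_devNull_lt h.three_le h.le_pow h.pos_add h.add_le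
  have hplane (hσ : σ = 1 ∨ σ = -1) :=
    abs_devPlane_lt h.three_le h.le_pow h.pos_add h.add_le h.abs_sub_le hσ
  rw [dev]
  split_ifs with hσ0 hν hν
  · simpa using hnull.1
  · exact hnull.2
  · exact (hplane (hσ.resolve_left hσ0)).2
  · simpa using (hplane (hσ.resolve_left hσ0)).1

theorem hammingNorm_pos (h : IsWeightData f fs T E m b u v)
    (hD : ∀ z, z ∈ D ↔ z ≠ 0 ∧ f z.1 + T z.2 = 0) {g : F × F} (hg : g ≠ 0) :
    0 < hammingNorm (codeword p D g) := by
  have hs : (0 : ℤ) < (p : ℤ) ^ m := by linarith [h.three_le, h.le_pow]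
  have weight_pos {x : ℤ} (hx : |x| < (p - 1) * ((p : ℤ) ^ m) ^ 3) : 0 < weightOf p (p ^ m) E x :=
    weightOf_pos (by linarith [h.three_le]) hs h.sq_eq hx
  rw [← Nat.cast_pos (α := ℚ)]
  obtain ⟨c, d⟩ := g
  rcases eq_or_ne d 0 with rfl | hd
  · rw [h.hammingNorm_of_snd_eq_zero hD fun hc => hg (Prod.ext hc rfl)]
    apply weight_pos
    split_ifs with h0
    · have : (0 : ℤ) < p - 1 := by linarith [h.three_le]
      rw [abs_zero]
      positivity
    · rw [quadraticChar_eq_zero_iff] at h0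
      exact abs_devLine_lt h.three_le h.le_pow h.pos_add h.add_le h.abs_sub_le
        (quadraticChar_dichotomy h0)
  · rw [h.hammingNorm_of_snd_ne_zero hD c hd]
    refine weight_pos (h.abs_dev_lt ?_ _)
    rcases eq_or_ne (fs c) 0 with h0 | h0
    · exact Or.inl (quadraticChar_eq_zero_iff.mpr h0)
    · exact Or.inr (quadraticChar_dichotomy h0)

theorem codeword_injective (h : IsWeightData f fs T E m b u v)
    (hD : ∀ z, z ∈ D ↔ z ≠ 0 ∧ f z.1 + T z.2 = 0) : Function.Injective (codeword p D) := by
  rw [injective_iff_map_eq_zero]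
  intro g hg
  by_contra h0
  exact (h.hammingNorm_pos hD h0).ne' (by rw [hg, hammingNorm_zero])

theorem finrank_code (h : IsWeightData f fs T E m b u v)
    (hD : ∀ z, z ∈ D ↔ z ≠ 0 ∧ f z.1 + T z.2 = 0) :
    Module.finrank (ZMod p) (code p D) = 2 * (2 * m) := by
  rw [code, LinearMap.finrank_range_of_inj (h.codeword_injective hD), Module.finrank_prod,
    finrank_eq_of_card (e := 2 * m) (by rw [h.card_eq]; ring)]
  ring

theorem weightCount_eq_sum_dev (h : IsWeightData f fs T E m b u v)
    (hD : ∀ z, z ∈ D ↔ z ≠ 0 ∧ f z.1 + T z.2 = 0) {w : ℚ} {I : ℤ → ℚ}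
    (hI : ∀ x, I x = if weightOf p (p ^ m) E x = w then 1 else 0) :
    (weightCount (code p D) w : ℚ) =
      (if 0 = w then 1 else 0) - I 0 +
      ∑ c : F, I (if quadraticChar (ZMod p) (fs c) = 0 then 0 else
        devLine p (p ^ m) (u + v) (u - v) (quadraticChar (ZMod p) (fs c))) +
      ∑ c : F, ∑ d : F with d ≠ 0, I (dev p (p ^ m) (u + v) (u - v)
        (quadraticChar (ZMod p) (fs c)) (quadraticChar (ZMod p) (-T (b / d)))) := by
  have sum_snd (c : F) :
      ∑ d : F, (if (hammingNorm (codeword p D (c, d)) : ℚ) = w then (1 : ℚ) else 0) =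
      (if (hammingNorm (codeword p D (c, 0)) : ℚ) = w then (1 : ℚ) else 0) +
      ∑ d : F with d ≠ 0, I (dev p (p ^ m) (u + v) (u - v)
        (quadraticChar (ZMod p) (fs c)) (quadraticChar (ZMod p) (-T (b / d)))) := by
    rw [← add_sum_erase _ _ (mem_univ (0 : F)), ← filter_ne']
    congr 1
    refine sum_congr rfl fun d hd => ?_
    rw [hI, h.hammingNorm_of_snd_ne_zero hD c (mem_filter.mp hd).2]
  have sum_line (c : F) (hc : c ∈ ({c : F | c ≠ 0} : Finset F)) :
      (if (hammingNorm (codeword p D (c, 0)) : ℚ) = w then (1 : ℚ) else 0) =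
      I (if quadraticChar (ZMod p) (fs c) = 0 then 0 else
        devLine p (p ^ m) (u + v) (u - v) (quadraticChar (ZMod p) (fs c))) := by
    rw [hI, h.hammingNorm_of_snd_eq_zero hD (mem_filter.mp hc).2]
  have codeword_zero : codeword p D ((0, 0) : F × F) = 0 := (codeword p D).map_zero
  rw [weightCount_code (h.codeword_injective hD)]
  simp only [sum_snd, sum_add_distrib]
  congr 1
  rw [← add_sum_erase _ _ (mem_univ (0 : F)), ← add_sum_erase _ (fun c : F => I _)
    (mem_univ (0 : F)), ← filter_ne', sum_congr rfl sum_line]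
  simp only [codeword_zero, hammingNorm_zero, h.dual_zero, quadraticChar_zero, if_true,
    Nat.cast_zero]
  ring

theorem hasWeightDistribution (h : IsWeightData f fs T E m b u v)
    (hD : ∀ z, z ∈ D ↔ z ≠ 0 ∧ f z.1 + T z.2 = 0) :
    HasWeightDistribution (code p D) (generalTable p (p ^ m) E u v) := by
  intro w
  obtain ⟨I, hI⟩ : ∃ I : ℤ → ℚ, ∀ x, I x = if weightOf p (p ^ m) E x = w then 1 else 0 :=
    ⟨_, fun _ => rfl⟩
  rw [sum_filter_eq_rowSum, h.weightCount_eq_sum_dev hD hI,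
    h.sum_dual_quadraticChar fun σ => I (if σ = 0 then 0 else
      devLine p (p ^ m) (u + v) (u - v) σ)]
  simp only [fun σ => h.sum_trace_div fun ν => I (dev p (p ^ m) (u + v) (u - v) σ ν)]
  rw [h.sum_dual_quadraticChar fun σ => ((p : ℚ) ^ m - 1) *
    ((p ^ m + 1 - u - v) * I (dev p (p ^ m) (u + v) (u - v) σ 0) +
      u * I (dev p (p ^ m) (u + v) (u - v) σ 1) + v * I (dev p (p ^ m) (u + v) (u - v) σ (-1)))]
  simp only [dev, if_true, one_ne_zero, neg_eq_zero, if_false, zero_ne_one,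
    show (0 : ℤ) ≠ -1 by norm_num, show (1 : ℤ) ≠ -1 by norm_num, show (-1 : ℤ) ≠ 1 by norm_num,
    add_zero, sub_zero]
  simp only [rowSum, generalTable, List.map_cons, List.map_nil, List.sum_cons, List.sum_nil, ← hI]
  push_cast
  ring

end IsWeightData

section Distinct

theorem weightOf_injective {p s E : ℤ} (hp : p ≠ 0) (hE : E ≠ 0) :
    Function.Injective (weightOf p s E) := by
  intro x y hxy
  have hp' : (p : ℚ) ≠ 0 := by exact_mod_cast hp
  have hE' : (E : ℚ) ≠ 0 := by exact_mod_cast hE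
  rw [weightOf, weightOf, div_left_inj' (pow_ne_zero 2 hp'), add_right_inj] at hxy
  exact_mod_cast mul_left_cancel₀ hE' hxy

theorem abs_sign_mul_le {σ : ℤ} (hσ : σ = 1 ∨ σ = -1) (t : ℤ) : -|t| ≤ σ * t ∧ σ * t ≤ |t| := by
  rcases hσ with rfl | rfl <;> constructor <;> linarith [neg_abs_le t, le_abs_self t]

/-- Conditions on the parameters under which all deviations with `u + v = 2 h a` and
`u - v = 2 h t` are distinct: the square root of the order of the field is `s = p r`, and
`s + 1 = 2 h L`. -/
structure IsSeparated (p r h L a t : ℤ) : Prop where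
  three_le : 3 ≤ p
  odd : Odd p
  eq : p * r + 1 = 2 * h * L
  pos_sum : 0 < a
  lt : a < L
  abs_le : |t| ≤ a
  abs_lt : a + |t| < r
  ne : ∀ σ : ℤ, σ = 1 ∨ σ = -1 → (r * (p - 1) + 2) * L ≠ (p * r + 1) * (a + σ * t)

namespace IsSeparated

variable {p r h L a t : ℤ}

theorem pos (H : IsSeparated p r h L a t) : 0 < r := by
  linarith [H.pos_sum, H.abs_lt, abs_nonneg t]

theorem sqrt_pos (H : IsSeparated p r h L a t) : 0 < p * r :=
  mul_pos (by linarith [H.three_le]) H.pos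

theorem prime_ne_zero (H : IsSeparated p r h L a t) : p ≠ 0 := by
  linarith [H.three_le]

theorem isCoprime (H : IsSeparated p r h L a t) : IsCoprime (p * r) (2 * h) :=
  ⟨-1, L, by linear_combination -H.eq⟩

theorem eq_zero_of_dvd (H : IsSeparated p r h L a t) {x : ℤ} (hx0 : 0 ≤ x) (hx : x < r)
    (hdvd : r ∣ 2 * h * x) : x = 0 :=
  Int.eq_zero_of_dvd_of_nonneg_of_lt hx0 hx
    ((IsCoprime.mul_left_iff.mp H.isCoprime).2.dvd_of_dvd_mul_left hdvd)

theorem sqrt_dvd (H : IsSeparated p r h L a t) {x : ℤ} (hdvd : p * (p * r) ∣ p * (2 * h * x)) :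
    p * r ∣ x :=
  H.isCoprime.dvd_of_dvd_mul_left ((mul_dvd_mul_iff_left H.prime_ne_zero).mp hdvd)

theorem devNull_ne_zero (H : IsSeparated p r h L a t) : devNull p (p * r) (2 * h * a) ≠ 0 := by
  intro h0
  have prefactor_pos : 0 < (p - 1) * (p * r) * p :=
    mul_pos (mul_pos (by linarith [H.three_le]) H.sqrt_pos) (by linarith [H.three_le])
  have factored : ((p - 1) * (p * r) * p) * ((p - 1) * r - 2 * h * a) = 0 := by
    rw [← h0, devNull]
    ring
  have cofactor := (mul_eq_zero.mp factored).resolve_left prefactor_pos.ne'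
  exact H.pos_sum.ne' (H.eq_zero_of_dvd H.pos_sum.le (by linarith [H.abs_lt, abs_nonneg t])
    ⟨p - 1, by linarith⟩)

theorem devNull_add_ne_zero (H : IsSeparated p r h L a t) :
    devNull p (p * r) (2 * h * a) + p * (p - 1) * (p * r) ≠ 0 := by
  intro h0
  have prefactor_pos : 0 < (p - 1) * (p * r) * p :=
    mul_pos (mul_pos (by linarith [H.three_le]) H.sqrt_pos) (by linarith [H.three_le])
  have factored : ((p - 1) * (p * r) * p) * ((p - 1) * r + 1 - 2 * h * a) = 0 := by
    rw [← h0, devNull]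
    ring
  have cofactor := (mul_eq_zero.mp factored).resolve_left prefactor_pos.ne'
  obtain ⟨n, hn⟩ := H.odd
  have parity : 2 * (n * r - h * a) + 1 = 0 := by
    rw [← cofactor, hn]
    ring
  omega

/- Modulo `p s`, the deviations with `f^*(γ) = 0` vanish, and those with `η(f^*(γ)) = σ` are
`2 h p (p a + σ t)`. -/
theorem ne_of_dvd (H : IsSeparated p r h L a t) {σ x y : ℤ} (hσ : σ = 1 ∨ σ = -1)
    (hx : p * (p * r) ∣ x - p * (p * (2 * h * a) + σ * (2 * h * t))) (hy : p * (p * r) ∣ y) :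
    x ≠ y := by
  rintro rfl
  have dvd_residue : p * (p * r) ∣ p * (2 * h * (p * a + σ * t)) :=
    (dvd_sub hy hx).trans (dvd_of_eq (by ring))
  obtain ⟨lower, upper⟩ := abs_sign_mul_le hσ t
  have residue_pos : 0 < p * a + σ * t := by nlinarith [H.three_le, H.abs_le, H.pos_sum]
  have residue_lt : p * a + σ * t < p * r := by
    nlinarith [H.three_le, H.abs_lt, H.pos_sum, abs_nonneg t]
  exact residue_pos.ne'
    (Int.eq_zero_of_dvd_of_nonneg_of_lt residue_pos.le residue_lt (H.sqrt_dvd dvd_residue))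

theorem ne_of_sign (H : IsSeparated p r h L a t) (ht : t ≠ 0) {x y : ℤ}
    (hx : p * (p * r) ∣ x - p * (p * (2 * h * a) + 1 * (2 * h * t)))
    (hy : p * (p * r) ∣ y - p * (p * (2 * h * a) + -1 * (2 * h * t))) : x ≠ y := by
  rintro rfl
  have dvd_residue : p * (p * r) ∣ p * (2 * h * (2 * t)) :=
    (dvd_sub hy hx).trans (dvd_of_eq (by ring))
  have residue_lt : |2 * t| < p * r := by
    rw [abs_mul, abs_two]
    nlinarith [H.three_le, H.abs_le, H.abs_lt, H.pos]
  have := Int.eq_zero_of_abs_lt_dvd (H.sqrt_dvd dvd_residue) residue_lt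
  omega

theorem devNull_dvd : p * (p * r) ∣ devNull p (p * r) (2 * h * a) :=
  ⟨(p - 1) * ((p - 1) * r - 2 * h * a), by rw [devNull]; ring⟩

theorem devNull_add_dvd : p * (p * r) ∣ devNull p (p * r) (2 * h * a) + p * (p - 1) * (p * r) :=
  dvd_add devNull_dvd ⟨p - 1, by ring⟩

theorem devLine_dvd (σ : ℤ) : p * (p * r) ∣ devLine p (p * r) (2 * h * a) (2 * h * t) σ -
    p * (p * (2 * h * a) + σ * (2 * h * t)) :=
  ⟨(p - 1) * (p * r) - (p * (2 * h * a) + σ * (2 * h * t)), by rw [devLine]; ring⟩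

theorem devPlane_dvd (σ : ℤ) : p * (p * r) ∣ devPlane p (p * r) (2 * h * a) (2 * h * t) σ -
    p * (p * (2 * h * a) + σ * (2 * h * t)) :=
  ⟨(p - 1) ^ 2 * r - 2 * h * a * (p - 1), by rw [devPlane]; ring⟩

theorem devPlane_sub_dvd (σ : ℤ) : p * (p * r) ∣
    devPlane p (p * r) (2 * h * a) (2 * h * t) σ - 2 * p * (p * r) -
    p * (p * (2 * h * a) + σ * (2 * h * t)) := by
  rw [sub_right_comm]
  exact dvd_sub (devPlane_dvd σ) ⟨2, by ring⟩

theorem devLine_ne_devPlane (H : IsSeparated p r h L a t) {σ : ℤ} (hσ : σ = 1 ∨ σ = -1) :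
    devLine p (p * r) (2 * h * a) (2 * h * t) σ ≠
      devPlane p (p * r) (2 * h * a) (2 * h * t) σ := by
  intro h0
  have factored : (p * (p * r)) * (r * (p - 1) - 2 * h * (a + σ * t)) = 0 := by
    rw [devLine, devPlane] at h0
    linear_combination h0
  have cofactor := (mul_eq_zero.mp factored).resolve_left
    (mul_pos (by linarith [H.three_le]) H.sqrt_pos).ne'
  obtain ⟨lower, upper⟩ := abs_sign_mul_le hσ t
  have sum_eq_zero : a + σ * t = 0 :=
    H.eq_zero_of_dvd (by linarith [H.abs_le]) (by linarith [H.abs_lt]) ⟨p - 1, by linarith⟩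
  rw [sum_eq_zero, mul_zero, sub_zero] at cofactor
  nlinarith [H.pos, H.three_le]

theorem devLine_ne_devPlane_sub (H : IsSeparated p r h L a t) {σ : ℤ} (hσ : σ = 1 ∨ σ = -1) :
    devLine p (p * r) (2 * h * a) (2 * h * t) σ ≠
      devPlane p (p * r) (2 * h * a) (2 * h * t) σ - 2 * p * (p * r) := by
  intro h0
  have factored : (p * (p * r)) * (r * (p - 1) + 2 - 2 * h * (a + σ * t)) = 0 := by
    rw [devLine, devPlane] at h0
    linear_combination h0
  have cofactor := (mul_eq_zero.mp factored).resolve_left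
    (mul_pos (by linarith [H.three_le]) H.sqrt_pos).ne'
  exact H.ne σ hσ (by linear_combination L * cofactor - (a + σ * t) * H.eq)

end IsSeparated

end Distinct

section NumWeights

theorem rowSum_cons (w : ℚ) (r : ℚ × ℚ) (l : List (ℚ × ℚ)) :
    rowSum w (r :: l) = (r.2 * if r.1 = w then 1 else 0) + rowSum w l := by
  simp [rowSum]

theorem rowSum_nonneg (w : ℚ) (l : List (ℚ × ℚ)) (hl : ∀ r ∈ l, 0 < r.2) : 0 ≤ rowSum w l := by
  refine List.sum_nonneg fun x hx => ?_
  obtain ⟨r, hr, rfl⟩ := List.mem_map.mp hx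
  have := hl r hr
  positivity

theorem rowSum_pos_iff (w : ℚ) (l : List (ℚ × ℚ)) (hl : ∀ r ∈ l, 0 < r.2) :
    0 < rowSum w l ↔ w ∈ l.map Prod.fst := by
  induction l with
  | nil => simp [rowSum]
  | cons r l ih =>
    have tail_pos := fun r hr => hl r (List.mem_cons_of_mem _ hr)
    have rowSum_tail_nonneg := rowSum_nonneg w l tail_pos
    have head_pos := hl r List.mem_cons_self
    rw [rowSum_cons, List.map_cons, List.mem_cons, ← ih tail_pos]
    by_cases hw : r.1 = w
    · rw [if_pos hw, mul_one]
      exact ⟨fun _ => Or.inl hw.symm, fun _ => by linarith⟩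
    · rw [if_neg hw, mul_zero, zero_add]
      exact ⟨Or.inr, fun h => h.resolve_left (Ne.symm hw)⟩

variable {ι : Type*} [Fintype ι] {C : Submodule (ZMod p) (ι → ZMod p)} {l : List (ℚ × ℚ)}

theorem weightCount_pos_iff {w : ℚ} : 0 < weightCount C w ↔ ∃ c ∈ C, (hammingNorm c : ℚ) = w := by
  rw [weightCount, Set.ncard_pos]
  rfl

theorem weightCount_zero_le_one : weightCount C 0 ≤ 1 := by
  rw [weightCount, Set.ncard_le_one]
  rintro c ⟨-, hc⟩ d ⟨-, hd⟩
  rw [Nat.cast_eq_zero, hammingNorm_eq_zero] at hc hd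
  rw [hc, hd]

theorem HasWeightDistribution.weightCount_eq {p : ℕ} {C : Submodule (ZMod p) (ι → ZMod p)}
    (hC : HasWeightDistribution C ((0, 1) :: l)) (w : ℚ) :
    (weightCount C w : ℚ) = (if 0 = w then 1 else 0) + rowSum w l := by
  rw [hC w, sum_filter_eq_rowSum, rowSum_cons, one_mul]

theorem HasWeightDistribution.zero_notMem (hC : HasWeightDistribution C ((0, 1) :: l))
    (hl : ∀ r ∈ l, 0 < r.2) : (0 : ℚ) ∉ l.map Prod.fst := by
  intro h
  have row_pos := (rowSum_pos_iff 0 l hl).mpr h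
  have count_eq := hC.weightCount_eq 0
  have count_le : (weightCount C 0 : ℚ) ≤ 1 := by exact_mod_cast weightCount_zero_le_one
  rw [if_pos rfl] at count_eq
  linarith

theorem HasWeightDistribution.mem_iff (hC : HasWeightDistribution C ((0, 1) :: l))
    (hl : ∀ r ∈ l, 0 < r.2) {w : ℚ} (hw : w ≠ 0) :
    w ∈ l.map Prod.fst ↔ ∃ c ∈ C, (hammingNorm c : ℚ) = w := by
  rw [← weightCount_pos_iff, ← rowSum_pos_iff w l hl, ← Nat.cast_pos (α := ℚ),
    hC.weightCount_eq, if_neg hw.symm, zero_add]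

theorem HasWeightDistribution.numWeights_eq (hC : HasWeightDistribution C ((0, 1) :: l))
    (hl : ∀ r ∈ l, 0 < r.2) (hnodup : (l.map Prod.fst).Nodup) : numWeights C = l.length := by
  have weights_eq : (fun n : ℕ => (n : ℚ)) '' {w : ℕ | w ≠ 0 ∧ ∃ c ∈ C, hammingNorm c = w} =
      ((l.map Prod.fst).toFinset : Finset ℚ) := by
    ext w
    simp only [Set.mem_image, Set.mem_ofPred_eq, mem_coe, List.mem_toFinset]
    constructor
    · rintro ⟨n, ⟨hn, c, hc, rfl⟩, rfl⟩
      exact (hC.mem_iff hl (Nat.cast_ne_zero.mpr hn)).mpr ⟨c, hc, rfl⟩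
    · intro hw
      have hw0 : w ≠ 0 := fun h => hC.zero_notMem hl (h ▸ hw)
      obtain ⟨c, hc, rfl⟩ := (hC.mem_iff hl hw0).mp hw
      exact ⟨_, ⟨Nat.cast_ne_zero.mp hw0, c, hc, rfl⟩, rfl⟩
  rw [numWeights, ← Set.ncard_image_of_injective _ (Nat.cast_injective (R := ℚ)), weights_eq,
    Set.ncard_coe_finset, List.toFinset_card_of_nodup hnodup, List.length_map]

end NumWeights

section Merge

/-- The form of `generalTable` when one of `u`, `v` is zero and the other is `w`; the sign `σ` is
`1` if `v = 0` and `-1` if `u = 0`. -/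
def tableEq (p s E w σ : ℤ) : List (ℚ × ℚ) :=
  let Z : ℚ := ((s : ℚ) ^ 2 + (p - 1) * E) / p
  let Y : ℚ := ((s : ℚ) ^ 2 - E) / p
  [(0, 1),
   (weightOf p s E 0, Z - 1),
   (weightOf p s E (devNull p s w + p * (p - 1) * s), (s - 1) * w * Z),
   (weightOf p s E (devNull p s w), (s - 1) * (s + 1 - w) * Z),
   (weightOf p s E (devLine p s w (σ * w) 1), (p - 1) / 2 * Y),
   (weightOf p s E (devLine p s w (σ * w) (-1)), (p - 1) / 2 * Y),
   (weightOf p s E (devPlane p s w (σ * w) σ - 2 * p * s), (s - 1) * w * ((p - 1) / 2 * Y)),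
   (weightOf p s E (devPlane p s w (σ * w) (-σ)), (s - 1) * (s + 1) * ((p - 1) / 2 * Y)),
   (weightOf p s E (devPlane p s w (σ * w) σ), (s - 1) * (s + 1 - w) * ((p - 1) / 2 * Y))]

/-- The form of `generalTable` when `u = v = w / 2`. -/
def tableHalf (p s E w : ℤ) : List (ℚ × ℚ) :=
  let Z : ℚ := ((s : ℚ) ^ 2 + (p - 1) * E) / p
  let Y : ℚ := ((s : ℚ) ^ 2 - E) / p
  [(0, 1),
   (weightOf p s E 0, Z - 1),
   (weightOf p s E (devNull p s w + p * (p - 1) * s), (s - 1) * w * Z),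
   (weightOf p s E (devNull p s w), (s - 1) * (s + 1 - w) * Z),
   (weightOf p s E (devLine p s w 0 1), (p - 1) * Y),
   (weightOf p s E (devPlane p s w 0 1 - 2 * p * s), (s - 1) * w * ((p - 1) / 2 * Y)),
   (weightOf p s E (devPlane p s w 0 1), (s - 1) * (2 * (s + 1) - w) * ((p - 1) / 2 * Y))]

theorem HasWeightDistribution.of_rowSum_eq {p : ℕ} {ι : Type*} [Fintype ι]
    {C : Submodule (ZMod p) (ι → ZMod p)} {t t' : List (ℚ × ℚ)} (hC : HasWeightDistribution C t)
    (h : ∀ w, rowSum w t = rowSum w t') : HasWeightDistribution C t' := fun w => by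
  rw [hC w, sum_filter_eq_rowSum, sum_filter_eq_rowSum, h]

theorem devLine_neg (p s x y σ : ℤ) : devLine p s x (-y) σ = devLine p s x y (-σ) := by
  simp [devLine]

theorem devPlane_neg (p s x y σ : ℤ) : devPlane p s x (-y) σ = devPlane p s x y (-σ) := by
  simp [devPlane]

variable (p s E u v : ℤ) (w : ℚ)

theorem rowSum_generalTable_swap :
    rowSum w (generalTable p s E v u) = rowSum w (generalTable p s E u v) := by
  rw [generalTable, add_comm v, ← neg_sub u v]
  simp only [rowSum, generalTable, List.map_cons, List.map_nil, List.sum_cons, List.sum_nil,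
    devLine_neg, devPlane_neg, neg_neg]
  ring

theorem rowSum_generalTable_left :
    rowSum w (generalTable p s E u 0) = rowSum w (tableEq p s E u 1) := by
  simp only [rowSum, generalTable, tableEq, List.map_cons, List.map_nil, List.sum_cons,
    List.sum_nil, add_zero, sub_zero, one_mul]
  push_cast
  ring

theorem rowSum_generalTable_right :
    rowSum w (generalTable p s E 0 v) = rowSum w (tableEq p s E v (-1)) := by
  simp only [rowSum, generalTable, tableEq, List.map_cons, List.map_nil, List.sum_cons,
    List.sum_nil, zero_add, zero_sub, neg_one_mul, neg_neg]
  push_cast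
  ring

theorem rowSum_generalTable_half :
    rowSum w (generalTable p s E u u) = rowSum w (tableHalf p s E (2 * u)) := by
  have devLine_zero : devLine p s (2 * u) 0 (-1) = devLine p s (2 * u) 0 1 := by simp [devLine]
  have devPlane_zero : devPlane p s (2 * u) 0 (-1) = devPlane p s (2 * u) 0 1 := by
    simp [devPlane]
  simp only [rowSum, generalTable, tableHalf, List.map_cons, List.map_nil, List.sum_cons,
    List.sum_nil, sub_self, ← two_mul, devLine_zero, devPlane_zero]
  push_cast
  ring

end Merge

section Tables

variable {p ℓ k m : ℕ} {ε h : ℤ}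

theorem natCast_pow_sub_one (hp : p ≠ 0) (hm : 1 ≤ m) :
    (p : ℚ) ^ (2 * m - 1) = ((p : ℚ) ^ m) ^ 2 / p := by
  have hp' : (p : ℚ) ≠ 0 := by exact_mod_cast hp
  rw [eq_div_iff hp', ← pow_succ, ← pow_mul]
  congr 1
  omega

theorem cast_eq_div (hℓ : ℓ ≠ 0) (hh : (p : ℤ) ^ m + 1 = 2 * h * (ℓ : ℤ) ^ k) :
    (h : ℚ) = ((p : ℚ) ^ m + 1) / (2 * (ℓ : ℚ) ^ k) := by
  have : (ℓ : ℚ) ^ k ≠ 0 := pow_ne_zero k (by exact_mod_cast hℓ)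
  have hh' : (p : ℚ) ^ m + 1 = 2 * h * (ℓ : ℚ) ^ k := by exact_mod_cast hh
  rw [eq_div_iff (by positivity), hh']
  ring

theorem tableOneThree_eq (hp : p ≠ 0) (hℓ : ℓ ≠ 0) (hm : 1 ≤ m)
    (hh : (p : ℤ) ^ m + 1 = 2 * h * (ℓ : ℤ) ^ k) :
    tableOneThree p ℓ k (2 * m) ε =
      tableHalf p (p ^ m) (ε * sqrtPStarPow p (2 * m)) (2 * h * (ℓ - 1)) := by
  have hp' : (p : ℚ) ≠ 0 := by exact_mod_cast hp
  have hL : (ℓ : ℚ) ^ k ≠ 0 := pow_ne_zero k (by exact_mod_cast hℓ)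
  simp only [tableOneThree, tableHalf, weightOf, devNull, devLine, devPlane,
    natCast_pow_sub_one hp hm, pow_mul', Nat.mul_div_cancel_left m two_pos, List.cons.injEq,
    Prod.mk.injEq, true_and, and_true]
  push_cast
  rw [cast_eq_div hℓ hh]
  generalize (p : ℚ) ^ m = s
  generalize (ℓ : ℚ) ^ k = L at *
  generalize ((sqrtPStarPow p (2 * m) : ℤ) : ℚ) = x
  refine ⟨⟨?_, ?_⟩, ⟨?_, ?_⟩, ⟨?_, ?_⟩, ⟨?_, ?_⟩, ⟨?_, ?_⟩, ?_, ?_⟩ <;>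
    field_simp <;> ring

theorem rowSum_tableOneOne (hp : p ≠ 0) (hℓ : ℓ ≠ 0) (hm : 1 ≤ m)
    (hh : (p : ℤ) ^ m + 1 = 2 * h * (ℓ : ℤ) ^ k) (w : ℚ) :
    rowSum w (tableOneOne p ℓ k (2 * m) ε) =
      rowSum w (tableEq p (p ^ m) (ε * sqrtPStarPow p (2 * m)) (2 * h * (ℓ - 1)) 1) := by
  obtain ⟨r₀, r₁, r₂, r₃, r₄, r₅, r₆, r₇, r₈, hOneOne, hEq⟩ : ∃ r₀ r₁ r₂ r₃ r₄ r₅ r₆ r₇ r₈,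
      tableOneOne p ℓ k (2 * m) ε = [r₀, r₁, r₂, r₃, r₄, r₅, r₆, r₇, r₈] ∧
      tableEq p (p ^ m) (ε * sqrtPStarPow p (2 * m)) (2 * h * (ℓ - 1)) 1 =
        [r₀, r₁, r₂, r₃, r₄, r₅, r₆, r₈, r₇] := by
    refine ⟨_, _, _, _, _, _, _, _, _, rfl, ?_⟩
    have hp' : (p : ℚ) ≠ 0 := by exact_mod_cast hp
    have hL : (ℓ : ℚ) ^ k ≠ 0 := pow_ne_zero k (by exact_mod_cast hℓ)
    simp only [tableEq, weightOf, devNull, devLine, devPlane,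
      natCast_pow_sub_one hp hm, pow_mul', Nat.mul_div_cancel_left m two_pos, List.cons.injEq,
      Prod.mk.injEq, true_and, and_true]
    push_cast
    rw [cast_eq_div hℓ hh]
    generalize (p : ℚ) ^ m = s
    generalize (ℓ : ℚ) ^ k = L at *
    generalize ((sqrtPStarPow p (2 * m) : ℤ) : ℚ) = x
    refine ⟨⟨?_, ?_⟩, ⟨?_, ?_⟩, ⟨?_, ?_⟩, ⟨?_, ?_⟩, ⟨?_, ?_⟩, ⟨?_, ?_⟩, ⟨?_, ?_⟩, ?_, ?_⟩ <;>
      field_simp <;> ring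
  rw [hOneOne, hEq]
  simp only [rowSum_cons]
  ring

theorem tableNotOneThree_eq (hp : p ≠ 0) (hℓ : ℓ ≠ 0) (hk : 1 ≤ k) (hm : 1 ≤ m)
    (hh : (p : ℤ) ^ m + 1 = 2 * h * (ℓ : ℤ) ^ k) :
    tableNotOneThree p ℓ k (2 * m) ε =
      tableHalf p (p ^ m) (ε * sqrtPStarPow p (2 * m)) (2 * h * ℓ) := by
  have hp' : (p : ℚ) ≠ 0 := by exact_mod_cast hp
  have hℓ' : (ℓ : ℚ) ≠ 0 := by exact_mod_cast hℓ
  have hM : (ℓ : ℚ) ^ (k - 1) ≠ 0 := pow_ne_zero _ hℓ'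
  simp only [tableNotOneThree, tableHalf, weightOf, devNull, devLine, devPlane,
    natCast_pow_sub_one hp hm, pow_mul', Nat.mul_div_cancel_left m two_pos, List.cons.injEq,
    Prod.mk.injEq, true_and, and_true]
  push_cast
  rw [cast_eq_div hℓ hh, ← mul_pow_sub_one (by omega : k ≠ 0)]
  generalize (p : ℚ) ^ m = s
  generalize (ℓ : ℚ) ^ (k - 1) = M at *
  generalize ((sqrtPStarPow p (2 * m) : ℤ) : ℚ) = x
  refine ⟨⟨?_, ?_⟩, ⟨?_, ?_⟩, ⟨?_, ?_⟩, ⟨?_, ?_⟩, ⟨?_, ?_⟩, ?_, ?_⟩ <;>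
    field_simp <;> ring

theorem tableNotOneOneEq_eq (hp : p ≠ 0) (hℓ : ℓ ≠ 0) (hk : 1 ≤ k) (hm : 1 ≤ m)
    (hh : (p : ℤ) ^ m + 1 = 2 * h * (ℓ : ℤ) ^ k) {σ : ℤ} (hσ : σ = 1 ∨ σ = -1) :
    tableNotOneOneEq p ℓ k (2 * m) ε σ σ =
      tableEq p (p ^ m) (ε * sqrtPStarPow p (2 * m)) (2 * h * ℓ) σ := by
  have hp' : (p : ℚ) ≠ 0 := by exact_mod_cast hp
  have hℓ' : (ℓ : ℚ) ≠ 0 := by exact_mod_cast hℓ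
  have hM : (ℓ : ℚ) ^ (k - 1) ≠ 0 := pow_ne_zero _ hℓ'
  have sq_sign : (σ : ℚ) * σ = 1 := by rcases hσ with rfl | rfl <;> norm_num
  have sign_mul_sum : (σ : ℚ) * (σ + (ℓ - 1) * σ) = ℓ := by linear_combination (ℓ : ℚ) * sq_sign
  have sign_cancel (y : ℚ) : (p : ℚ) * σ * (σ * y) = p * y := by
    linear_combination p * y * sq_sign
  have neg_sign_cancel (y : ℚ) : (p : ℚ) * -σ * (σ * y) = -(p * y) := by
    linear_combination -p * y * sq_sign
  simp only [tableNotOneOneEq, tableEq, weightOf, devNull, devLine, devPlane,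
    natCast_pow_sub_one hp hm, pow_mul', Nat.mul_div_cancel_left m two_pos, List.cons.injEq,
    Prod.mk.injEq, true_and, and_true]
  push_cast
  rw [cast_eq_div hℓ hh, ← mul_pow_sub_one (by omega : k ≠ 0)]
  generalize (p : ℚ) ^ m = s
  generalize (ℓ : ℚ) ^ (k - 1) = M at *
  generalize ((sqrtPStarPow p (2 * m) : ℤ) : ℚ) = x
  simp only [sign_mul_sum, sign_cancel, neg_sign_cancel]
  refine ⟨⟨?_, ?_⟩, ⟨?_, ?_⟩, ⟨?_, ?_⟩, ⟨?_, ?_⟩, ⟨?_, ?_⟩, ⟨?_, ?_⟩, ⟨?_, ?_⟩, ?_, ?_⟩ <;>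
    field_simp <;> ring

theorem tableNotOneOneNeg_eq (hp : p ≠ 0) (hℓ : ℓ ≠ 0) (hk : 1 ≤ k) (hm : 1 ≤ m)
    (hh : (p : ℤ) ^ m + 1 = 2 * h * (ℓ : ℤ) ^ k) :
    tableNotOneOneNeg p ℓ k (2 * m) ε 1 (-1) =
      generalTable p (p ^ m) (ε * sqrtPStarPow p (2 * m)) (2 * h) (2 * h * (ℓ - 1)) := by
  have hp' : (p : ℚ) ≠ 0 := by exact_mod_cast hp
  have hℓ' : (ℓ : ℚ) ≠ 0 := by exact_mod_cast hℓ
  have hM : (ℓ : ℚ) ^ (k - 1) ≠ 0 := pow_ne_zero _ hℓ'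
  simp only [tableNotOneOneNeg, generalTable, weightOf, devNull, devLine, devPlane,
    natCast_pow_sub_one hp hm, pow_mul', Nat.mul_div_cancel_left m two_pos, List.cons.injEq,
    Prod.mk.injEq, true_and, and_true]
  push_cast
  rw [cast_eq_div hℓ hh, ← mul_pow_sub_one (by omega : k ≠ 0)]
  generalize (p : ℚ) ^ m = s
  generalize (ℓ : ℚ) ^ (k - 1) = M at *
  generalize ((sqrtPStarPow p (2 * m) : ℤ) : ℚ) = x
  refine ⟨⟨?_, ?_⟩, ⟨?_, ?_⟩, ⟨?_, ?_⟩, ⟨?_, ?_⟩, ⟨?_, ?_⟩, ⟨?_, ?_⟩, ⟨?_, ?_⟩, ⟨?_, ?_⟩,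
    ?_, ?_⟩ <;> field_simp <;> ring

theorem rowSum_tableNotOneOneNeg_neg (p ℓ k e : ℕ) (ε : ℤ) (w : ℚ) :
    rowSum w (tableNotOneOneNeg p ℓ k e ε (-1) 1) =
      rowSum w (tableNotOneOneNeg p ℓ k e ε 1 (-1)) := by
  simp only [rowSum, tableNotOneOneNeg, List.map_cons, List.map_nil, List.sum_cons, List.sum_nil]
  push_cast
  have neg_sum : (-1 : ℚ) + (ℓ - 1) * 1 = -(1 + (ℓ - 1) * -1) := by ring
  simp only [neg_sum, mul_neg, sub_neg_eq_add, ← sub_eq_add_neg]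
  ring_nf

end Tables

section Count

/-- The deviations of the words with `f^*(γ) = 0`. -/
def nullDevs (p s x : ℤ) : List ℤ :=
  [0, devNull p s x + p * (p - 1) * s, devNull p s x]

/-- The deviations of the words with `η(f^*(γ)) = σ`. -/
def signDevs (p s x y σ : ℤ) : List ℤ :=
  [devLine p s x y σ, devPlane p s x y σ - 2 * p * s, devPlane p s x y σ]

namespace IsSeparated

variable {p r h L a t E : ℤ}

theorem nodup_nullDevs (H : IsSeparated p r h L a t) : (nullDevs p (p * r) (2 * h * a)).Nodup := by
  have shift_ne_zero : p * (p - 1) * (p * r) ≠ 0 :=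
    mul_ne_zero (mul_ne_zero H.prime_ne_zero (by linarith [H.three_le])) H.sqrt_pos.ne'
  simp only [nullDevs, List.nodup_cons, List.mem_cons, List.not_mem_nil, or_false, not_or,
    not_false_eq_true, List.nodup_nil, and_true]
  exact ⟨⟨H.devNull_add_ne_zero.symm, H.devNull_ne_zero.symm⟩, by simpa using shift_ne_zero⟩

theorem nodup_signDevs (H : IsSeparated p r h L a t) {σ : ℤ} (hσ : σ = 1 ∨ σ = -1) :
    (signDevs p (p * r) (2 * h * a) (2 * h * t) σ).Nodup := by
  have shift_ne_zero : 2 * p * (p * r) ≠ 0 :=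
    mul_ne_zero (mul_ne_zero two_ne_zero H.prime_ne_zero) H.sqrt_pos.ne'
  simp only [signDevs, List.nodup_cons, List.mem_cons, List.not_mem_nil, or_false, not_or,
    not_false_eq_true, List.nodup_nil, and_true]
  exact ⟨⟨H.devLine_ne_devPlane_sub hσ, H.devLine_ne_devPlane hσ⟩, by simpa using shift_ne_zero⟩

theorem dvd_of_mem_nullDevs {x : ℤ} (hx : x ∈ nullDevs p (p * r) (2 * h * a)) :
    p * (p * r) ∣ x := by
  simp only [nullDevs, List.mem_cons, List.not_mem_nil, or_false] at hx
  rcases hx with rfl | rfl | rfl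
  exacts [dvd_zero _, devNull_add_dvd, devNull_dvd]

theorem dvd_of_mem_signDevs {x σ : ℤ} (hx : x ∈ signDevs p (p * r) (2 * h * a) (2 * h * t) σ) :
    p * (p * r) ∣ x - p * (p * (2 * h * a) + σ * (2 * h * t)) := by
  simp only [signDevs, List.mem_cons, List.not_mem_nil, or_false] at hx
  rcases hx with rfl | rfl | rfl
  exacts [devLine_dvd σ, devPlane_sub_dvd σ, devPlane_dvd σ]

theorem nodup_nullDevs_append_signDevs (H : IsSeparated p r h L a t) {σ : ℤ}
    (hσ : σ = 1 ∨ σ = -1) :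
    (nullDevs p (p * r) (2 * h * a) ++ signDevs p (p * r) (2 * h * a) (2 * h * t) σ).Nodup :=
  List.nodup_append.mpr ⟨H.nodup_nullDevs, H.nodup_signDevs hσ, fun _ hx _ hy =>
    (H.ne_of_dvd hσ (dvd_of_mem_signDevs hy) (dvd_of_mem_nullDevs hx)).symm⟩

theorem nodup_devs (H : IsSeparated p r h L a t) (ht : t ≠ 0) :
    (nullDevs p (p * r) (2 * h * a) ++ signDevs p (p * r) (2 * h * a) (2 * h * t) 1 ++
      signDevs p (p * r) (2 * h * a) (2 * h * t) (-1)).Nodup := by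
  refine List.nodup_append.mpr ⟨H.nodup_nullDevs_append_signDevs (.inl rfl),
    H.nodup_signDevs (.inr rfl), fun x hx y hy => ?_⟩
  rcases List.mem_append.mp hx with hx | hx
  · exact (H.ne_of_dvd (.inr rfl) (dvd_of_mem_signDevs hy) (dvd_of_mem_nullDevs hx)).symm
  · exact H.ne_of_sign ht (dvd_of_mem_signDevs hx) (dvd_of_mem_signDevs hy)

theorem pos_h (H : IsSeparated p r h L a t) : 0 < h := by
  by_contra hh
  nlinarith [H.eq, H.sqrt_pos, H.pos_sum, H.lt]

theorem abs_le_of_sq_eq (H : IsSeparated p r h L a t) (hE : E ^ 2 = (p * r) ^ 2) : |E| ≤ p * r :=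
  abs_le_of_sq_le_sq hE.le H.sqrt_pos.le

theorem ne_zero_of_sq_eq (H : IsSeparated p r h L a t) (hE : E ^ 2 = (p * r) ^ 2) : E ≠ 0 := by
  rintro rfl
  nlinarith [H.sqrt_pos]

theorem one_lt_card_zeros_dual (H : IsSeparated p r h L a t) (hE : E ^ 2 = (p * r) ^ 2) :
    1 < (((p * r : ℤ) : ℚ) ^ 2 + (p - 1) * E) / p := by
  have hp := H.three_le
  have hr : 2 ≤ r := by linarith [H.abs_lt, H.pos_sum, abs_nonneg t]
  have lower : (p - 1) * (-(p * r)) ≤ (p - 1) * E :=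
    mul_le_mul_of_nonneg_left (_root_.abs_le.mp (H.abs_le_of_sq_eq hE)).1 (by linarith)
  have hpr : 2 * p ≤ p * r := by nlinarith
  have numerator_gt : p < (p * r) ^ 2 + (p - 1) * E := by nlinarith
  rw [one_lt_div (by exact_mod_cast (by linarith : 0 < p))]
  exact_mod_cast numerator_gt

theorem card_fiber_dual_pos (H : IsSeparated p r h L a t) (hE : E ^ 2 = (p * r) ^ 2) :
    0 < (((p * r : ℤ) : ℚ) ^ 2 - E) / p := by
  have hp := H.three_le
  have upper := (_root_.abs_le.mp (H.abs_le_of_sq_eq hE)).2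
  have hpr : 3 ≤ p * r := by nlinarith [H.pos]
  have numerator_pos : 0 < (p * r) ^ 2 - E := by nlinarith
  exact div_pos (by exact_mod_cast numerator_pos) (by exact_mod_cast (by linarith : 0 < p))

theorem cast_sub_one_pos (H : IsSeparated p r h L a t) : (0 : ℚ) < (p : ℚ) - 1 := by
  have : 0 < p - 1 := by linarith [H.three_le]
  exact_mod_cast this

theorem cast_sqrt_sub_one_pos (H : IsSeparated p r h L a t) :
    (0 : ℚ) < ((p * r : ℤ) : ℚ) - 1 := by
  have : 0 < p * r - 1 := by nlinarith [H.three_le, H.pos]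
  exact_mod_cast this

theorem cast_sum_pos (H : IsSeparated p r h L a t) : (0 : ℚ) < ((2 * h * a : ℤ) : ℚ) := by
  have := mul_pos (mul_pos two_pos H.pos_h) H.pos_sum
  exact_mod_cast this

theorem cast_sum_lt (H : IsSeparated p r h L a t) :
    (0 : ℚ) < ((p * r : ℤ) : ℚ) + 1 - ((2 * h * a : ℤ) : ℚ) := by
  have : 0 < p * r + 1 - 2 * h * a := by
    rw [H.eq]
    nlinarith [H.pos_h, H.lt]
  exact_mod_cast this

theorem nodup_map_weightOf (H : IsSeparated p r h L a t) (hE : E ^ 2 = (p * r) ^ 2) {l : List ℤ}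
    (hl : l.Nodup) : (l.map (weightOf p (p * r) E)).Nodup :=
  hl.map (weightOf_injective H.prime_ne_zero (H.ne_zero_of_sq_eq hE))

variable {q : ℕ} [Fact q.Prime] {ι : Type*} [Fintype ι] {C : Submodule (ZMod q) (ι → ZMod q)}

theorem numWeights_tableHalf (H : IsSeparated p r h L a 0) (hE : E ^ 2 = (p * r) ^ 2)
    (hC : HasWeightDistribution C (tableHalf p (p * r) E (2 * h * a))) : numWeights C = 6 := by
  have hZ := H.one_lt_card_zeros_dual hE
  have hY := H.card_fiber_dual_pos hE
  have hs := H.cast_sqrt_sub_one_pos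
  have hp := H.cast_sub_one_pos
  have hsum := H.cast_sum_pos
  have hlt := H.cast_sum_lt
  have hlt' : (0 : ℚ) < 2 * (((p * r : ℤ) : ℚ) + 1) - ((2 * h * a : ℤ) : ℚ) := by linarith
  refine HasWeightDistribution.numWeights_eq hC ?_ ?_
  · simp only [List.mem_cons, List.not_mem_nil, or_false, forall_eq_or_imp, forall_eq]
    have := one_pos.trans hZ
    refine ⟨by linarith, ?_, ?_, ?_, ?_, ?_⟩ <;> positivity
  · have hnodup := H.nodup_nullDevs_append_signDevs (.inl rfl)
    rw [mul_zero] at hnodup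
    exact H.nodup_map_weightOf hE hnodup

theorem numWeights_generalTable (H : IsSeparated p r h L a t) (hE : E ^ 2 = (p * r) ^ 2)
    (ht : t ≠ 0) {u v : ℤ} (hu : 0 < u) (hv : 0 < v) (hadd : u + v = 2 * h * a)
    (hsub : u - v = 2 * h * t) (hC : HasWeightDistribution C (generalTable p (p * r) E u v)) :
    numWeights C = 9 := by
  have hZ := H.one_lt_card_zeros_dual hE
  have hY := H.card_fiber_dual_pos hE
  have hs := H.cast_sqrt_sub_one_pos
  have hp := H.cast_sub_one_pos
  have hu' : (0 : ℚ) < u := by exact_mod_cast hu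
  have hv' : (0 : ℚ) < v := by exact_mod_cast hv
  have hlt : (0 : ℚ) < ((p * r : ℤ) : ℚ) + 1 - u - v := by
    rw [sub_sub, ← Int.cast_add, hadd]
    exact H.cast_sum_lt
  have hltu : (0 : ℚ) < ((p * r : ℤ) : ℚ) + 1 - u := by linarith
  have hltv : (0 : ℚ) < ((p * r : ℤ) : ℚ) + 1 - v := by linarith
  refine HasWeightDistribution.numWeights_eq hC ?_ ?_
  · simp only [List.mem_cons, List.not_mem_nil, or_false, forall_eq_or_imp, forall_eq]
    have := one_pos.trans hZ
    refine ⟨by linarith, ?_, ?_, ?_, ?_, ?_, ?_, ?_, ?_⟩ <;> positivity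
  · have hnodup := H.nodup_devs ht
    rw [← hadd, ← hsub] at hnodup
    refine H.nodup_map_weightOf hE (l := [_, _, _, _, _, _, _, _, _]) ?_
    simp only [nullDevs, signDevs, List.cons_append, List.nil_append, List.nodup_cons,
      List.mem_cons, List.not_mem_nil, or_false, not_or, not_false_eq_true, List.nodup_nil,
      and_true] at hnodup ⊢
    grind

theorem numWeights_tableEq {σ : ℤ} (hσ : σ = 1 ∨ σ = -1) (H : IsSeparated p r h L a (σ * a))
    (hE : E ^ 2 = (p * r) ^ 2)
    (hC : HasWeightDistribution C (tableEq p (p * r) E (2 * h * a) σ)) : numWeights C = 8 := by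
  have hZ := H.one_lt_card_zeros_dual hE
  have hY := H.card_fiber_dual_pos hE
  have hs := H.cast_sqrt_sub_one_pos
  have hs' : (0 : ℚ) < ((p * r : ℤ) : ℚ) + 1 := by linarith
  have hp := H.cast_sub_one_pos
  have hsum := H.cast_sum_pos
  have hlt := H.cast_sum_lt
  refine HasWeightDistribution.numWeights_eq hC ?_ ?_
  · simp only [List.mem_cons, List.not_mem_nil, or_false, forall_eq_or_imp, forall_eq]
    have := one_pos.trans hZ
    refine ⟨by linarith, ?_, ?_, ?_, ?_, ?_, ?_, ?_⟩ <;> positivity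
  · have sign_mul_ne_zero : σ * a ≠ 0 :=
      mul_ne_zero (by rcases hσ with rfl | rfl <;> norm_num) H.pos_sum.ne'
    have hnodup := H.nodup_devs sign_mul_ne_zero
    rw [mul_left_comm] at hnodup
    refine H.nodup_map_weightOf hE (l := [_, _, _, _, _, _, _, _]) ?_
    simp only [nullDevs, signDevs, List.cons_append, List.nil_append, List.nodup_cons,
      List.mem_cons, List.not_mem_nil, or_false, not_or, not_false_eq_true, List.nodup_nil,
      and_true] at hnodup ⊢
    rcases hσ with rfl | rfl <;> grind

end IsSeparated

end Count

section Separation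

variable {p r h L a t : ℤ}

theorem isSeparated_of_three_mul_le (hp : 3 ≤ p) (hodd : Odd p) (heq : p * r + 1 = 2 * h * L)
    (ha : 0 < a) (ht : |t| ≤ a) (hlt : a + |t| < r) (hL : 3 * a ≤ L) :
    IsSeparated p r h L a t where
  three_le := hp
  odd := hodd
  eq := heq
  pos_sum := ha
  lt := by linarith
  abs_le := ht
  abs_lt := hlt
  ne σ hσ := by
    have hr : 0 < r := by linarith [abs_nonneg t]
    have hr_mul : 0 ≤ r * (p - 1) := mul_nonneg hr.le (by linarith)
    have gap_nonneg : 0 ≤ a * r * (p - 3) := mul_nonneg (by positivity) (by linarith)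
    have upper := calc (p * r + 1) * (a + σ * t)
        _ ≤ (p * r + 1) * (2 * a) :=
          mul_le_mul_of_nonneg_left (by linarith [(abs_sign_mul_le hσ t).2]) (by positivity)
    have lower : (r * (p - 1) + 2) * (3 * a) ≤ (r * (p - 1) + 2) * L :=
      mul_le_mul_of_nonneg_left hL (by linarith)
    nlinarith

theorem isSeparated_of_eq_add_one (hp : 3 ≤ p) (hodd : Odd p) (heq : p * r + 1 = 2 * h * L)
    (ha : 2 * p ≤ a) (ht : t = a ∨ t = 0) (hlt : a + |t| < r) (hL : L = a + 1) :
    IsSeparated p r h L a t where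
  three_le := hp
  odd := hodd
  eq := heq
  pos_sum := by linarith
  lt := by linarith
  abs_le := by
    rcases ht with rfl | rfl
    · exact (abs_of_nonneg (by linarith)).le
    · rw [abs_zero]
      linarith
  abs_lt := hlt
  ne σ hσ := by
    have hr : a + 1 ≤ r := by linarith [abs_nonneg t]
    subst hL
    rcases ht with rfl | rfl
    · rcases hσ with rfl | rfl
      · have excess_nonneg : 0 ≤ p * r * (t - 1) :=
          mul_nonneg (mul_nonneg (by linarith) (by linarith)) (by linarith)
        nlinarith
      · have hr_mul : 0 ≤ r * (p - 1) := mul_nonneg (by linarith) (by linarith)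
        nlinarith
    · have excess_le : (a + 1) * (p + 1) ≤ r * (a + 1 - p) :=
        mul_le_mul hr (by linarith) (by linarith) (by linarith)
      nlinarith

end Separation

section Size

theorem mul_add_one_lt_pow (c : ℕ) {n : ℕ} (hn : 2 ≤ n) : c * (n + 1) < (c + 1) ^ n := by
  induction n, hn using Nat.le_induction with
  | base => nlinarith [sq_nonneg ((c : ℤ) - 1)]
  | succ n _ ih =>
    calc c * (n + 1 + 1) < (c * (n + 1) + 1) * (c + 1) := by
          nlinarith [Nat.zero_le (c ^ 2 * (n + 1))]
      _ ≤ (c + 1) ^ n * (c + 1) := Nat.mul_le_mul_right _ ih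
      _ = (c + 1) ^ (n + 1) := (pow_succ _ _).symm

variable {p ℓ k m c : ℕ}

theorem three_mul_le_pow (hℓ : 3 ≤ ℓ) (hk : 2 ≤ k) : 3 * ℓ ≤ ℓ ^ k :=
  calc 3 * ℓ ≤ ℓ * ℓ := Nat.mul_le_mul_right _ hℓ
    _ = ℓ ^ 2 := (sq ℓ).symm
    _ ≤ ℓ ^ k := Nat.pow_le_pow_right (by omega) hk

theorem mul_lt_pow_of_two_le (hp : c + 1 ≤ p) (hℓ : ℓ.Prime) (hℓ2 : ℓ ≠ 2) (hk : 2 ≤ k)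
    (hm : Nat.totient (ℓ ^ k) = 2 * m) : c * ℓ < p ^ (m - 1) := by
  have hℓ3 : 3 ≤ ℓ := hℓ.two_le.lt_of_ne' hℓ2
  have sub_one_le : ℓ - 1 ≤ m - 1 := by
    rw [Nat.totient_prime_pow hℓ (by omega)] at hm
    have : ℓ * 2 ≤ ℓ ^ (k - 1) * (ℓ - 1) :=
      Nat.mul_le_mul (Nat.le_self_pow (by omega) ℓ) (by omega)
    omega
  calc c * ℓ = c * (ℓ - 1 + 1) := by rw [Nat.sub_add_cancel hℓ.one_le]
    _ < (c + 1) ^ (ℓ - 1) := mul_add_one_lt_pow c (by omega)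
    _ ≤ p ^ (ℓ - 1) := Nat.pow_le_pow_left hp _
    _ ≤ p ^ (m - 1) := Nat.pow_le_pow_right (by omega) sub_one_le

theorem two_mul_le_sub_one (hp : Odd p) (hℓ : ℓ.Prime) (hℓ2 : ℓ ≠ 2) (hℓp : ℓ ≡ 1 [MOD p]) :
    2 * p ≤ ℓ - 1 := by
  have p_dvd : p ∣ ℓ - 1 := (Nat.modEq_iff_dvd' hℓ.one_le).mp hℓp.symm
  have two_dvd : 2 ∣ ℓ - 1 := (hℓ.even_sub_one hℓ2).two_dvd
  exact Nat.le_of_dvd (Nat.sub_pos_of_lt hℓ.one_lt)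
    ((Nat.coprime_two_left.mpr hp).mul_dvd_of_dvd_of_dvd two_dvd p_dvd)

theorem mul_sub_one_lt_pow (hp : 2 * c + 1 ≤ p) (hp3 : 3 ≤ p) (hpodd : Odd p) (hℓ : ℓ.Prime)
    (hℓ2 : ℓ ≠ 2) (hk : 1 ≤ k) (hm : Nat.totient (ℓ ^ k) = 2 * m) (hℓp : ℓ ≡ 1 [MOD p]) :
    c * (ℓ - 1) < p ^ (m - 1) := by
  have hℓp' := two_mul_le_sub_one hpodd hℓ hℓ2 hℓp
  obtain ⟨n, hn⟩ := hℓ.odd_of_ne_two hℓ2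
  have le_half : n ≤ m := by
    rw [Nat.totient_prime_pow hℓ (by omega)] at hm
    have : 1 * (ℓ - 1) ≤ ℓ ^ (k - 1) * (ℓ - 1) :=
      Nat.mul_le_mul_right _ (Nat.one_le_pow _ _ hℓ.pos)
    omega
  calc c * (ℓ - 1) = 2 * c * (n - 1 + 1) := by
        rw [hn, Nat.add_sub_cancel, Nat.sub_add_cancel (by omega)]
        ring
    _ < (2 * c + 1) ^ (n - 1) := mul_add_one_lt_pow _ (by omega)
    _ ≤ p ^ (n - 1) := Nat.pow_le_pow_left hp _
    _ ≤ p ^ (m - 1) := Nat.pow_le_pow_right (by omega) (by omega)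

theorem isSeparated_of_modEq_one {r h t : ℤ} (hp : 3 ≤ p) (hpodd : Odd p) (hℓ : ℓ.Prime)
    (hℓ2 : ℓ ≠ 2) (hk : 1 ≤ k) (hℓp : ℓ ≡ 1 [MOD p])
    (heq : (p : ℤ) * r + 1 = 2 * h * (ℓ : ℤ) ^ k) (ht : t = (ℓ : ℤ) - 1 ∨ t = 0)
    (hlt : (ℓ : ℤ) - 1 + |t| < r) :
    IsSeparated p r h ((ℓ : ℤ) ^ k) ((ℓ : ℤ) - 1) t := by
  have hℓp' := two_mul_le_sub_one hpodd hℓ hℓ2 hℓp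
  have hpodd' : Odd (p : ℤ) := by exact_mod_cast hpodd
  rcases eq_or_lt_of_le hk with rfl | hk
  · exact isSeparated_of_eq_add_one (by omega) hpodd' heq (by omega) ht hlt (by ring)
  · have three_mul_le : 3 * (ℓ : ℤ) ≤ (ℓ : ℤ) ^ k := by
      exact_mod_cast three_mul_le_pow (hℓ.two_le.lt_of_ne' hℓ2) hk
    have abs_le : |t| ≤ (ℓ : ℤ) - 1 := by
      rcases ht with rfl | rfl
      · exact (abs_of_nonneg (by omega)).le
      · rw [abs_zero]
        omega
    exact isSeparated_of_three_mul_le (by omega) hpodd' heq (by omega) abs_le hlt (by linarith)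

theorem isSeparated_of_two_le {r h t : ℤ} (hp : 3 ≤ p) (hpodd : Odd p) (hℓ : ℓ.Prime)
    (hℓ2 : ℓ ≠ 2) (hk : 2 ≤ k) (heq : (p : ℤ) * r + 1 = 2 * h * (ℓ : ℤ) ^ k)
    (ht : |t| ≤ (ℓ : ℤ)) (hlt : (ℓ : ℤ) + |t| < r) :
    IsSeparated p r h ((ℓ : ℤ) ^ k) ℓ t := by
  have hℓ3 : 3 ≤ ℓ := hℓ.two_le.lt_of_ne' hℓ2
  exact isSeparated_of_three_mul_le (by omega) (by exact_mod_cast hpodd) heq (by omega) ht hlt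
    (by exact_mod_cast three_mul_le_pow hℓ3 hk)

end Size

section Parameters

/-- The numerical parameters: `φ(ℓ ^ k) = 2 m`, so that `p ^ m` is the square root of the order `q`
of the field, and `p ^ m + 1 = 2 h ℓ ^ k`, so that `N = (q - 1) / (2 ℓ ^ k)` is `(p ^ m - 1) h`. -/
structure IsParameters (p ℓ k m h : ℕ) : Prop where
  ne_two : p ≠ 2
  prime : ℓ.Prime
  prime_ne_two : ℓ ≠ 2
  ne : p ≠ ℓ
  one_le : 1 ≤ k
  orderOf_eq : orderOf (p : ZMod (ℓ ^ k)) = Nat.totient (ℓ ^ k)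
  totient_eq : Nat.totient (ℓ ^ k) = 2 * m
  sqrt_add_one : p ^ m + 1 = 2 * h * ℓ ^ k

theorem exists_isParameters {p ℓ k : ℕ} [Fact p.Prime] (hp : p ≠ 2) (hℓ : ℓ.Prime) (hℓ2 : ℓ ≠ 2)
    (hpℓ : p ≠ ℓ) (hk : 1 ≤ k) (hprim : orderOf (p : ZMod (2 * ℓ ^ k)) = Nat.totient (ℓ ^ k)) :
    ∃ m h, IsParameters p ℓ k m h := by
  have hodd : Odd p := (Fact.out : p.Prime).odd_of_ne_two hp
  have hord := orderOf_natCast_prime_pow hodd (hℓ.odd_of_ne_two hℓ2) hprim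
  obtain ⟨m, hm⟩ := (even_totient_prime_pow hℓ hℓ2 hk).two_dvd
  have hdvd := two_mul_prime_pow_dvd hodd hℓ hℓ2 hk hord
  rw [hm, Nat.mul_div_cancel_left m two_pos] at hdvd
  obtain ⟨h, hh⟩ := hdvd
  exact ⟨m, h, hp, hℓ, hℓ2, hpℓ, hk, hord, hm, by rw [hh, mul_right_comm]⟩

namespace IsParameters

variable {ℓ k m h : ℕ} (P : IsParameters p ℓ k m h)
include P

omit [Fact p.Prime] in
theorem one_le_exponent : 1 ≤ m := by
  have := Nat.totient_pos.mpr (pow_pos P.prime.pos k)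
  have := P.totient_eq
  omega

omit [Fact p.Prime] in
theorem pos_cofactor : 0 < h := by
  refine Nat.pos_of_ne_zero ?_
  rintro rfl
  simpa using P.sqrt_add_one

omit [Fact p.Prime] in
theorem cast_sqrt_add_one : (p : ℤ) ^ m + 1 = 2 * h * (ℓ : ℤ) ^ k := by
  exact_mod_cast P.sqrt_add_one

omit [Fact p.Prime] in
theorem mul_cast_pow_add_one : (p : ℤ) * (p : ℤ) ^ (m - 1) + 1 = 2 * h * (ℓ : ℤ) ^ k := by
  rw [← pow_succ', Nat.sub_add_cancel P.one_le_exponent, P.cast_sqrt_add_one]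

omit [Fact p.Prime] in
theorem card_sub_one : p ^ (2 * m) - 1 = (p ^ m - 1) * h * (2 * ℓ ^ k) := by
  rw [pow_mul', ← one_pow 2, Nat.sq_sub_sq, one_pow, P.sqrt_add_one]
  ring

omit [Fact p.Prime] in
theorem card_sub_one_div : (p ^ (2 * m) - 1) / (2 * ℓ ^ k) = (p ^ m - 1) * h := by
  have := pow_pos P.prime.pos k
  rw [P.card_sub_one, Nat.mul_div_cancel _ (by omega)]

theorem odd : Odd p :=
  (Fact.out : p.Prime).odd_of_ne_two P.ne_two

theorem three_le : 3 ≤ p :=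
  (Fact.out : p.Prime).two_le.lt_of_ne' P.ne_two

theorem natCast_pow_ne_zero (n : ℕ) : (ℓ : ZMod p) ^ n ≠ 0 := by
  refine pow_ne_zero _ fun hzero => P.ne ?_
  rw [ZMod.natCast_eq_zero_iff] at hzero
  exact (Nat.prime_dvd_prime_iff_eq Fact.out P.prime).mp hzero

theorem natCast_totient : (Nat.totient (ℓ ^ k) : ZMod p) = (ℓ : ZMod p) ^ (k - 1) * (ℓ - 1) := by
  rw [Nat.totient_prime_pow P.prime P.one_le, Nat.cast_mul, Nat.cast_pow,
    Nat.cast_pred P.prime.pos]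

theorem natCast_totient_eq_zero_iff : (Nat.totient (ℓ ^ k) : ZMod p) = 0 ↔ ℓ ≡ 1 [MOD p] := by
  rw [P.natCast_totient, mul_eq_zero, or_iff_right (P.natCast_pow_ne_zero _), sub_eq_zero,
    ← ZMod.natCast_eq_natCast_iff, Nat.cast_one]

end IsParameters

end Parameters

section SignCount

/-- The indicator of `η(-x) = σ`, where `η` is the quadratic character. -/
noncomputable def signIndicator (σ : ℤ) (x : ZMod p) : ℤ :=
  if quadraticChar (ZMod p) (-x) = σ then 1 else 0

theorem signIndicator_nonneg (σ : ℤ) (x : ZMod p) : 0 ≤ signIndicator σ x := by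
  unfold signIndicator
  positivity

theorem signIndicator_zero {σ : ℤ} (hσ : σ = 1 ∨ σ = -1) : signIndicator σ (0 : ZMod p) = 0 := by
  rcases hσ with rfl | rfl <;> simp [signIndicator]

theorem signIndicator_add_signIndicator_neg_one {x : ZMod p} (hx : x ≠ 0) :
    signIndicator 1 x + signIndicator (-1) x = 1 := by
  unfold signIndicator
  rcases quadraticChar_dichotomy (neg_ne_zero.mpr hx) with h | h <;> simp [h]

theorem signIndicator_of_one_mod_four (hp : p ≡ 1 [MOD 4]) (σ : ℤ) (x : ZMod p) :
    signIndicator σ x = if quadraticChar (ZMod p) x = σ then 1 else 0 := by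
  have hp2 : p ≠ 2 := by rintro rfl; revert hp; decide
  rw [signIndicator, ← neg_one_mul, map_mul, quadraticChar_neg_one (by rwa [ZMod.ringChar_zmod_n]),
    ZMod.card, ZMod.χ₄_nat_one_mod_four hp, one_mul]

theorem signIndicator_of_three_mod_four (hp : p ≡ 3 [MOD 4]) (σ : ℤ) (x : ZMod p) :
    signIndicator σ x = if -quadraticChar (ZMod p) x = σ then 1 else 0 := by
  have hp2 : p ≠ 2 := by rintro rfl; revert hp; decide
  rw [signIndicator, ← neg_one_mul, map_mul, quadraticChar_neg_one (by rwa [ZMod.ringChar_zmod_n]),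
    ZMod.card, ZMod.χ₄_nat_three_mod_four hp, neg_one_mul]

theorem signIndicator_neg_of_one_mod_four (hp : p ≡ 1 [MOD 4]) (σ : ℤ) (x : ZMod p) :
    signIndicator σ (-x) = signIndicator σ x := by
  rw [signIndicator_of_one_mod_four hp, signIndicator]

theorem signIndicator_add_signIndicator_neg (hp : p ≡ 3 [MOD 4]) {σ : ℤ} (hσ : σ = 1 ∨ σ = -1)
    {x : ZMod p} (hx : x ≠ 0) : signIndicator σ x + signIndicator σ (-x) = 1 := by
  rw [signIndicator_of_three_mod_four hp, signIndicator, neg_neg]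
  rcases quadraticChar_dichotomy hx with h | h <;> rcases hσ with rfl | rfl <;> norm_num [h]

/-- `2 ℓ ^ k / (q - 1)` times the number of `y ≠ 0` with `η (-Tr (y ^ N)) = σ`. -/
noncomputable def signCount (p ℓ k : ℕ) [Fact p.Prime] (σ : ℤ) : ℤ :=
  signIndicator σ (Nat.totient (ℓ ^ k) : ZMod p) +
      signIndicator σ (-Nat.totient (ℓ ^ k) : ZMod p) +
    (ℓ - 1) *
      (signIndicator σ ((ℓ : ZMod p) ^ (k - 1)) + signIndicator σ (-(ℓ : ZMod p) ^ (k - 1)))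

theorem signCount_of_one_mod_four (hp : p ≡ 1 [MOD 4]) (ℓ k : ℕ) (σ : ℤ) : signCount p ℓ k σ =
    2 * ((if quadraticChar (ZMod p) (Nat.totient (ℓ ^ k)) = σ then 1 else 0) +
      (ℓ - 1) * (if quadraticChar (ZMod p) ((ℓ : ZMod p) ^ (k - 1)) = σ then 1 else 0)) := by
  simp only [signCount, signIndicator_neg_of_one_mod_four hp, signIndicator_of_one_mod_four hp]
  ring

namespace IsParameters

variable {ℓ k m h : ℕ} (P : IsParameters p ℓ k m h)
include P

theorem signCount_nonneg (σ : ℤ) : 0 ≤ signCount p ℓ k σ :=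
  add_nonneg (add_nonneg (signIndicator_nonneg _ _) (signIndicator_nonneg _ _))
    (mul_nonneg (sub_nonneg.mpr (by exact_mod_cast P.prime.one_le))
      (add_nonneg (signIndicator_nonneg _ _) (signIndicator_nonneg _ _)))

theorem signCount_add_of_modEq_one (hℓp : ℓ ≡ 1 [MOD p]) :
    signCount p ℓ k 1 + signCount p ℓ k (-1) = 2 * (ℓ - 1) := by
  have hpos := signIndicator_add_signIndicator_neg_one (P.natCast_pow_ne_zero (k - 1))
  have hneg := signIndicator_add_signIndicator_neg_one
    (neg_ne_zero.mpr (P.natCast_pow_ne_zero (k - 1)))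
  simp only [signCount, P.natCast_totient_eq_zero_iff.mpr hℓp, neg_zero,
    signIndicator_zero (.inl rfl), signIndicator_zero (.inr rfl)]
  linear_combination ((ℓ : ℤ) - 1) * (hpos + hneg)

theorem signCount_add_of_not_modEq_one (hℓp : ¬ ℓ ≡ 1 [MOD p]) :
    signCount p ℓ k 1 + signCount p ℓ k (-1) = 2 * ℓ := by
  have htotient := P.natCast_totient_eq_zero_iff.not.mpr hℓp
  have hpos := signIndicator_add_signIndicator_neg_one (P.natCast_pow_ne_zero (k - 1))
  have hneg := signIndicator_add_signIndicator_neg_one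
    (neg_ne_zero.mpr (P.natCast_pow_ne_zero (k - 1)))
  have hpos' := signIndicator_add_signIndicator_neg_one htotient
  have hneg' := signIndicator_add_signIndicator_neg_one (neg_ne_zero.mpr htotient)
  unfold signCount
  linear_combination ((ℓ : ℤ) - 1) * (hpos + hneg) + hpos' + hneg'

theorem one_le_signCount_add : 1 ≤ signCount p ℓ k 1 + signCount p ℓ k (-1) := by
  have := P.prime.two_le
  by_cases hℓp : ℓ ≡ 1 [MOD p]
  · rw [P.signCount_add_of_modEq_one hℓp]
    omega
  · rw [P.signCount_add_of_not_modEq_one hℓp]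
    omega

theorem signCount_of_modEq_one_of_one (hℓp : ℓ ≡ 1 [MOD p]) (hp : p ≡ 1 [MOD 4]) :
    signCount p ℓ k 1 = 2 * (ℓ - 1) ∧ signCount p ℓ k (-1) = 0 := by
  have hℓ1 : (ℓ : ZMod p) = 1 := by
    rw [← Nat.cast_one, ZMod.natCast_eq_natCast_iff]
    exact hℓp
  simp only [signCount_of_one_mod_four hp, P.natCast_totient_eq_zero_iff.mpr hℓp, hℓ1, one_pow,
    map_one, quadraticChar_zero]
  norm_num

theorem signCount_of_modEq_one_of_three (hℓp : ℓ ≡ 1 [MOD p]) (hp : p ≡ 3 [MOD 4]) {σ : ℤ}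
    (hσ : σ = 1 ∨ σ = -1) : signCount p ℓ k σ = ℓ - 1 := by
  simp only [signCount, P.natCast_totient_eq_zero_iff.mpr hℓp, neg_zero, signIndicator_zero hσ,
    signIndicator_add_signIndicator_neg hp hσ (P.natCast_pow_ne_zero _)]
  ring

theorem signCount_of_not_modEq_one_of_three (hℓp : ¬ ℓ ≡ 1 [MOD p]) (hp : p ≡ 3 [MOD 4]) {σ : ℤ}
    (hσ : σ = 1 ∨ σ = -1) : signCount p ℓ k σ = ℓ := by
  rw [signCount, signIndicator_add_signIndicator_neg hp hσ (P.natCast_pow_ne_zero _),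
    signIndicator_add_signIndicator_neg hp hσ (P.natCast_totient_eq_zero_iff.not.mpr hℓp)]
  ring

end IsParameters

end SignCount

section Data

theorem sqrtPStarPow_sq (p m : ℕ) : sqrtPStarPow p (2 * m) ^ 2 = (p : ℤ) ^ (2 * m) := by
  rw [sqrtPStarPow, Nat.mul_div_cancel_left m two_pos, ← pow_mul, mul_comm m, pow_mul, pow_mul,
    pStar, mul_pow, ← pow_mul, mul_comm _ 2, pow_mul, neg_one_sq, one_pow, one_mul]

theorem exists_sign_mul_eq_of_sq_eq {x y : ℤ} (h : x ^ 2 = y ^ 2) :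
    ∃ ε : ℤ, (ε = 1 ∨ ε = -1) ∧ x = ε * y := by
  rcases sq_eq_sq_iff_eq_or_eq_neg.mp h with rfl | rfl
  · exact ⟨1, .inl rfl, (one_mul _).symm⟩
  · exact ⟨-1, .inr rfl, (neg_one_mul _).symm⟩

theorem MemRF.exists_sign_sum_eq {f fs : F → ZMod p} (hf : MemRF f) (hdual : IsDual f fs)
    (hquad : ∀ (c : ZMod p) (x : F), fs (c • x) = c ^ 2 * fs x) (hp : p ≠ 2) {m : ℕ}
    (hF : Fintype.card F = p ^ (2 * m)) :
    ∃ ε : ℤ, (ε = 1 ∨ ε = -1) ∧ ∑ x, ψ (f x) = (ε * sqrtPStarPow p (2 * m) : ℤ) := by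
  obtain ⟨E, hEsq, hE⟩ := hf.1.1.exists_int_eq_sum hp hF (hf.map_smul_of_dual hdual hquad)
  obtain ⟨ε, hε, rfl⟩ := exists_sign_mul_eq_of_sq_eq (hEsq.trans (sqrtPStarPow_sq p m).symm)
  exact ⟨ε, hε, hE⟩

theorem sign_mul_sqrtPStarPow_sq {ε : ℤ} (hε : ε = 1 ∨ ε = -1) (p m : ℕ) :
    (ε * sqrtPStarPow p (2 * m)) ^ 2 = (p : ℤ) ^ (2 * m) := by
  rw [mul_pow, sqrtPStarPow_sq, sq_eq_one_iff.mpr hε, one_mul]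

theorem exists_pow_sub_one_eq_neg_one (hp : p ≠ 2) {m : ℕ} (hm : 1 ≤ m)
    (hF : Fintype.card F = (p ^ m) ^ 2) : ∃ b : F, b ^ (p ^ m - 1) = -1 := by
  have := Classical.decEq F
  have hcard := card_pow_sub_one_eq_neg_one hF (one_ne_neg_one_of_algebra hp) (odd_prime_pow hp m)
  have := three_le_prime_pow hp hm
  obtain ⟨b, hb⟩ := card_pos.mp (by omega : 0 < #{u : F | u ^ (p ^ m - 1) = -1})
  exact ⟨b, (mem_filter.mp hb).2⟩

namespace IsParameters

variable [DecidableEq F] {ℓ k m h : ℕ} (P : IsParameters p ℓ k m h)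
include P

theorem card_quadraticChar_trace_pow (hF : Fintype.card F = p ^ (2 * m)) {σ : ℤ}
    (hσ : σ = 1 ∨ σ = -1) :
    (#{y : F | y ≠ 0 ∧ quadraticChar (ZMod p) (-Tr (y ^ ((p ^ m - 1) * h))) = σ} : ℤ) =
      ((p : ℤ) ^ m - 1) * (h * signCount p ℓ k σ) := by
  have hcast : ((p ^ m - 1 : ℕ) : ℤ) = (p : ℤ) ^ m - 1 := by
    rw [Nat.cast_pred (pow_pos (Fact.out : p.Prime).pos m), Nat.cast_pow]
  have hsum := sum_trace_pow P.prime P.one_le P.ne P.orderOf_eq (hF.trans (by rw [P.totient_eq]))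
    P.ne_two P.prime_ne_two (by rw [hF, P.card_sub_one]) (signIndicator σ)
  rw [signIndicator_zero hσ, mul_zero, add_zero, Nat.cast_mul, hcast, mul_assoc] at hsum
  rw [← filter_filter, card_filter, signCount, ← hsum]
  push_cast
  rfl

theorem isWeightData (hF : Fintype.card F = p ^ (2 * m)) {f fs : F → ZMod p} (hf0 : f 0 = 0)
    (hdual : IsDual f fs) (hquad : ∀ (c : ZMod p) (x : F), fs (c • x) = c ^ 2 * fs x) {E : ℤ}
    (hEsq : E ^ 2 = (p : ℤ) ^ (2 * m)) (hE : ∑ x, ψ (f x) = E) {b : F}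
    (hb : b ^ (p ^ m - 1) = -1) :
    IsWeightData f fs (fun y => Tr (y ^ ((p ^ m - 1) * h))) E m b
      (h * signCount p ℓ k 1) (h * signCount p ℓ k (-1)) where
  ne_two := P.ne_two
  one_le := P.one_le_exponent
  card_eq := by rw [hF, pow_mul']
  integralDual := hdual.hasIntegralDual hquad hE
  dual_smul := hquad
  sum_dual := hdual.sum_dual hf0 (by simpa using hquad 0 0) hE (by rw [hEsq, hF, Nat.cast_pow])
  sq_eq := by rw [hEsq, pow_mul']
  map_zero := hf0
  trace_zero := by
    have := three_le_prime_pow P.ne_two P.one_le_exponent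
    rw [zero_pow (Nat.mul_ne_zero (by omega) P.pos_cofactor.ne'), map_zero]
  trace_mul u y hu := by rw [mul_pow, pow_mul u, hu, one_pow, one_mul]
  pow_eq := hb
  nonneg_pos := mul_nonneg (Int.natCast_nonneg h) (P.signCount_nonneg _)
  nonneg_neg := mul_nonneg (Int.natCast_nonneg h) (P.signCount_nonneg _)
  pos_add := by
    rw [← mul_add]
    exact one_le_mul_of_one_le_of_one_le (by exact_mod_cast P.pos_cofactor) P.one_le_signCount_add
  card_pos := P.card_quadraticChar_trace_pow hF (.inl rfl)
  card_neg := P.card_quadraticChar_trace_pow hF (.inr rfl)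

theorem exists_isWeightData (hF : Fintype.card F = p ^ (2 * m)) {f fs : F → ZMod p}
    (hf : MemRF f) (hdual : IsDual f fs)
    (hquad : ∀ (c : ZMod p) (x : F), fs (c • x) = c ^ 2 * fs x) :
    ∃ (ε : ℤ) (b : F), (ε = 1 ∨ ε = -1) ∧
      (∀ a, walsh f a = (ε : ℂ) * (sqrtPStarPow p (2 * m) : ℂ) * ZMod.stdAddChar (fs a)) ∧
      IsWeightData f fs (fun y => Tr (y ^ ((p ^ (2 * m) - 1) / (2 * ℓ ^ k))))
        (ε * sqrtPStarPow p (2 * m)) m b (h * signCount p ℓ k 1) (h * signCount p ℓ k (-1)) := by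
  obtain ⟨ε, hε, hE⟩ := hf.exists_sign_sum_eq hdual hquad P.ne_two hF
  obtain ⟨b, hb⟩ := exists_pow_sub_one_eq_neg_one (F := F) P.ne_two P.one_le_exponent
    (hF.trans (pow_mul' p 2 m))
  refine ⟨ε, b, hε, fun a => ?_, ?_⟩
  · rw [hdual.walsh_eq (by simpa using hquad 0 0), hE, Int.cast_mul]
  · rw [P.card_sub_one_div]
    exact P.isWeightData hF hf.2.1 hdual hquad (sign_mul_sqrtPStarPow_sq hε p m) hE hb

end IsParameters

end Data

section Length

variable [DecidableEq F] {f fs T : F → ZMod p} {E : ℤ} {m : ℕ} {b : F} {u v : ℤ}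
  {D : Finset (F × F)}

theorem IsWeightData.card_eq_rat (H : IsWeightData f fs T E m b u v)
    (hD : ∀ z, z ∈ D ↔ z ≠ 0 ∧ f z.1 + T z.2 = 0) {ℓ k : ℕ} {h a : ℤ} (hℓ : ℓ ≠ 0)
    (hh : (p : ℤ) ^ m + 1 = 2 * h * (ℓ : ℤ) ^ k) (huv : u + v = 2 * h * a) :
    (#D : ℚ) = ((p : ℚ) ^ (2 * m)) ^ 2 / p + E * ((p : ℚ) ^ (2 * m) * (p - 1) / p -
      a * ((p : ℚ) ^ (2 * m) - 1) / (ℓ : ℚ) ^ k) - 1 := by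
  have hp : (p : ℚ) ≠ 0 := Nat.cast_ne_zero.mpr (Fact.out : p.Prime).ne_zero
  have hL : (ℓ : ℚ) ^ k ≠ 0 := pow_ne_zero k (Nat.cast_ne_zero.mpr hℓ)
  have hint := H.card_eq_length hD
  rw [sub_sub _ u v, huv] at hint
  have hlen : (p : ℚ) * (#D + 1) = ((p : ℚ) ^ m) ^ 4 +
      E * ((p - 1) + ((p : ℚ) ^ m - 1) * (p * (p ^ m + 1 - 2 * h * a) - (p ^ m + 1))) := by
    exact_mod_cast hint
  rw [mul_comm, ← eq_div_iff hp, ← eq_sub_iff_add_eq, cast_eq_div hℓ hh] at hlen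
  rw [hlen, pow_mul']
  field_simp
  ring

namespace IsParameters

variable {ℓ k h : ℕ} (P : IsParameters p ℓ k m h) {ε : ℤ}
  (H : IsWeightData f fs T (ε * sqrtPStarPow p (2 * m)) m b (h * signCount p ℓ k 1)
    (h * signCount p ℓ k (-1)))
  (hD : ∀ z, z ∈ D ↔ z ≠ 0 ∧ f z.1 + T z.2 = 0)
include P H hD

theorem card_eq_lengthOne (hℓp : ℓ ≡ 1 [MOD p]) : (#D : ℚ) = lengthOne p ℓ k (2 * m) ε := by
  rw [H.card_eq_rat hD (a := ℓ - 1) P.prime.ne_zero P.cast_sqrt_add_one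
    (by rw [← mul_add, P.signCount_add_of_modEq_one hℓp]; ring), lengthOne]
  push_cast
  rfl

theorem card_eq_lengthNotOne (hℓp : ¬ ℓ ≡ 1 [MOD p]) :
    (#D : ℚ) = lengthNotOne p ℓ k (2 * m) ε := by
  have hk := P.one_le
  rw [H.card_eq_rat hD (a := ℓ) P.prime.ne_zero P.cast_sqrt_add_one
    (by rw [← mul_add, P.signCount_add_of_not_modEq_one hℓp]; ring), lengthNotOne,
    ← mul_pow_sub_one (by omega : k ≠ 0), Int.cast_natCast,
    mul_div_mul_left _ _ (Nat.cast_ne_zero.mpr P.prime.ne_zero)]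
  push_cast
  rfl

end IsParameters

end Length

section NumberOfWeights

theorem five_le_of_one_mod_four (hp : p ≡ 1 [MOD 4]) : 5 ≤ p := by
  have := (Fact.out : p.Prime).one_lt
  have : p % 4 = 1 := hp
  omega

namespace IsParameters

variable {ℓ k m h : ℕ} (P : IsParameters p ℓ k m h) {ι : Type*} [Fintype ι]
  {C : Submodule (ZMod p) (ι → ZMod p)} {E : ℤ} (hE : E ^ 2 = ((p : ℤ) ^ m) ^ 2)
include P hE

theorem numWeights_eq_eight_of_modEq_one (hℓp : ℓ ≡ 1 [MOD p]) (hp : p ≡ 1 [MOD 4])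
    (hC : HasWeightDistribution C (tableEq p ((p : ℤ) ^ m) E (2 * h * (ℓ - 1)) 1)) :
    numWeights C = 8 := by
  have hm := P.one_le_exponent
  have hlt := mul_sub_one_lt_pow (c := 2) (five_le_of_one_mod_four hp) P.three_le P.odd P.prime
    P.prime_ne_two P.one_le P.totient_eq hℓp
  zify [P.prime.one_le] at hlt
  have hsep := isSeparated_of_modEq_one (t := 1 * (ℓ - 1)) P.three_le P.odd P.prime
    P.prime_ne_two P.one_le hℓp P.mul_cast_pow_add_one (.inl (one_mul _)) <| by
      rwa [one_mul, abs_of_nonneg (by have := P.prime.one_le; omega), ← two_mul]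
  rw [← mul_pow_sub_one (by omega : m ≠ 0)] at hE hC
  exact hsep.numWeights_tableEq (.inl rfl) hE hC

theorem numWeights_eq_six_of_modEq_one (hℓp : ℓ ≡ 1 [MOD p])
    (hC : HasWeightDistribution C (tableHalf p ((p : ℤ) ^ m) E (2 * h * (ℓ - 1)))) :
    numWeights C = 6 := by
  have hm := P.one_le_exponent
  have hlt := mul_sub_one_lt_pow (c := 1) P.three_le P.three_le P.odd P.prime P.prime_ne_two
    P.one_le P.totient_eq hℓp
  zify [P.prime.one_le] at hlt
  have hsep := isSeparated_of_modEq_one P.three_le P.odd P.prime P.prime_ne_two P.one_le hℓp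
    P.mul_cast_pow_add_one (.inr rfl) <| by rwa [abs_zero, add_zero, ← one_mul ((ℓ : ℤ) - 1)]
  rw [← mul_pow_sub_one (by omega : m ≠ 0)] at hE hC
  exact hsep.numWeights_tableHalf hE hC

omit hE in
theorem isSeparated_of_one_mod_four (hk : 2 ≤ k) (hp : p ≡ 1 [MOD 4]) {t : ℤ} (ht : |t| ≤ ℓ) :
    IsSeparated p ((p : ℤ) ^ (m - 1)) h ((ℓ : ℤ) ^ k) ℓ t := by
  have hp5 := five_le_of_one_mod_four hp
  have hlt := mul_lt_pow_of_two_le (c := 2) (by omega : 2 + 1 ≤ p) P.prime P.prime_ne_two hk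
    P.totient_eq
  zify at hlt
  exact isSeparated_of_two_le P.three_le P.odd P.prime P.prime_ne_two hk
    P.mul_cast_pow_add_one ht (by linarith)

theorem numWeights_eq_eight_of_two_le (hk : 2 ≤ k) (hp : p ≡ 1 [MOD 4]) {σ : ℤ}
    (hσ : σ = 1 ∨ σ = -1)
    (hC : HasWeightDistribution C (tableEq p ((p : ℤ) ^ m) E (2 * h * ℓ) σ)) :
    numWeights C = 8 := by
  have hm := P.one_le_exponent
  have habs : |σ * (ℓ : ℤ)| = ℓ := by rcases hσ with rfl | rfl <;> simp
  rw [← mul_pow_sub_one (by omega : m ≠ 0)] at hE hC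
  exact (P.isSeparated_of_one_mod_four hk hp habs.le).numWeights_tableEq hσ hE hC

theorem numWeights_eq_nine_of_two_le (hk : 2 ≤ k) (hp : p ≡ 1 [MOD 4])
    (hC : HasWeightDistribution C
      (generalTable p ((p : ℤ) ^ m) E (2 * h) (2 * h * (ℓ - 1)))) :
    numWeights C = 9 := by
  have hm := P.one_le_exponent
  have hh := P.pos_cofactor
  have hℓ3 : 3 ≤ ℓ := P.prime.two_le.lt_of_ne' P.prime_ne_two
  have hsep := P.isSeparated_of_one_mod_four hk hp (t := 2 - ℓ) (abs_le.mpr ⟨by omega, by omega⟩)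
  rw [← mul_pow_sub_one (by omega : m ≠ 0)] at hE hC
  exact hsep.numWeights_generalTable hE (by omega) (by omega)
    (mul_pos (by omega) (by omega)) (by ring) (by ring) hC

theorem numWeights_eq_six_of_two_le (hk : 2 ≤ k)
    (hC : HasWeightDistribution C (tableHalf p ((p : ℤ) ^ m) E (2 * h * ℓ))) :
    numWeights C = 6 := by
  have hm := P.one_le_exponent
  have hlt := mul_lt_pow_of_two_le (c := 1) (Nat.lt_of_succ_lt P.three_le) P.prime P.prime_ne_two hk
    P.totient_eq
  zify at hlt
  have hsep := isSeparated_of_two_le (t := 0) P.three_le P.odd P.prime P.prime_ne_two hk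
    P.mul_cast_pow_add_one (by simp) (by rwa [abs_zero, add_zero, ← one_mul (ℓ : ℤ)])
  rw [← mul_pow_sub_one (by omega : m ≠ 0)] at hE hC
  exact hsep.numWeights_tableHalf hE hC

end IsParameters

end NumberOfWeights

section Tables

namespace IsParameters

variable {ℓ k m h : ℕ} (P : IsParameters p ℓ k m h) {ι : Type*} [Fintype ι]
  {C : Submodule (ZMod p) (ι → ZMod p)} {ε : ℤ}
  (hE : (ε * sqrtPStarPow p (2 * m)) ^ 2 = ((p : ℤ) ^ m) ^ 2)
  (hC : HasWeightDistribution C (generalTable p (p ^ m) (ε * sqrtPStarPow p (2 * m))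
    (h * signCount p ℓ k 1) (h * signCount p ℓ k (-1))))

section

include hC

theorem hasWeightDistribution_tableHalf {a : ℤ} (hpos : signCount p ℓ k 1 = a)
    (hneg : signCount p ℓ k (-1) = a) :
    HasWeightDistribution C
      (tableHalf p (p ^ m) (ε * sqrtPStarPow p (2 * m)) (2 * h * a)) := by
  rw [hpos, hneg] at hC
  rw [mul_assoc]
  exact hC.of_rowSum_eq (rowSum_generalTable_half _ _ _ _)

theorem hasWeightDistribution_tableEq (hp : p ≡ 1 [MOD 4]) {σ : ℤ} (hσ : σ = 1 ∨ σ = -1)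
    (htotient : quadraticChar (ZMod p) (Nat.totient (ℓ ^ k)) = σ)
    (hpow : quadraticChar (ZMod p) ((ℓ : ZMod p) ^ (k - 1)) = σ) :
    HasWeightDistribution C
      (tableEq p (p ^ m) (ε * sqrtPStarPow p (2 * m)) (2 * h * ℓ) σ) := by
  have count_eq (τ : ℤ) : h * signCount p ℓ k τ = if σ = τ then 2 * h * (ℓ : ℤ) else 0 := by
    rw [signCount_of_one_mod_four hp, htotient, hpow]
    split_ifs <;> ring
  rw [count_eq, count_eq] at hC
  rcases hσ with rfl | rfl
  · exact hC.of_rowSum_eq (rowSum_generalTable_left _ _ _ _)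
  · exact hC.of_rowSum_eq (rowSum_generalTable_right _ _ _ _)

theorem hasWeightDistribution_generalTable (hp : p ≡ 1 [MOD 4]) {σ : ℤ} (hσ : σ = 1 ∨ σ = -1)
    (htotient : quadraticChar (ZMod p) (Nat.totient (ℓ ^ k)) = σ)
    (hpow : quadraticChar (ZMod p) ((ℓ : ZMod p) ^ (k - 1)) = -σ) :
    HasWeightDistribution C (generalTable p (p ^ m) (ε * sqrtPStarPow p (2 * m)) (2 * h)
      (2 * h * (ℓ - 1))) := by
  have count_eq (τ : ℤ) : h * signCount p ℓ k τ =
      (if σ = τ then 2 * (h : ℤ) else 0) + if -σ = τ then 2 * h * ((ℓ : ℤ) - 1) else 0 := by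
    rw [signCount_of_one_mod_four hp, htotient, hpow]
    split_ifs <;> ring
  rw [count_eq, count_eq] at hC
  rcases hσ with rfl | rfl
  · simpa using hC
  · exact hC.of_rowSum_eq fun w => by simpa using rowSum_generalTable_swap _ _ _ _ _ w

end

include P hE hC

theorem tableOneOne_and_numWeights (hℓp : ℓ ≡ 1 [MOD p]) (hp : p ≡ 1 [MOD 4]) :
    HasWeightDistribution C (tableOneOne p ℓ k (2 * m) ε) ∧ numWeights C = 8 := by
  obtain ⟨hpos, hneg⟩ := P.signCount_of_modEq_one_of_one hℓp hp
  rw [hpos, hneg, mul_zero, ← mul_assoc, mul_comm (h : ℤ)] at hC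
  have hC' := hC.of_rowSum_eq (rowSum_generalTable_left _ _ _ _)
  exact ⟨hC'.of_rowSum_eq fun w => (rowSum_tableOneOne (Fact.out : p.Prime).ne_zero
      P.prime.ne_zero P.one_le_exponent P.cast_sqrt_add_one w).symm,
    P.numWeights_eq_eight_of_modEq_one hE hℓp hp hC'⟩

theorem tableOneThree_and_numWeights (hℓp : ℓ ≡ 1 [MOD p]) (hp : p ≡ 3 [MOD 4]) :
    HasWeightDistribution C (tableOneThree p ℓ k (2 * m) ε) ∧ numWeights C = 6 := by
  have hC' := hasWeightDistribution_tableHalf hC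
    (P.signCount_of_modEq_one_of_three hℓp hp (.inl rfl))
    (P.signCount_of_modEq_one_of_three hℓp hp (.inr rfl))
  rw [tableOneThree_eq (Fact.out : p.Prime).ne_zero P.prime.ne_zero P.one_le_exponent
    P.cast_sqrt_add_one]
  exact ⟨hC', P.numWeights_eq_six_of_modEq_one hE hℓp hC'⟩

theorem tableNotOneThree_and_numWeights (hℓp : ¬ ℓ ≡ 1 [MOD p]) (hp : p ≡ 3 [MOD 4]) :
    HasWeightDistribution C (tableNotOneThree p ℓ k (2 * m) ε) ∧ (2 ≤ k → numWeights C = 6) := by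
  have hC' := hasWeightDistribution_tableHalf hC
    (P.signCount_of_not_modEq_one_of_three hℓp hp (.inl rfl))
    (P.signCount_of_not_modEq_one_of_three hℓp hp (.inr rfl))
  rw [tableNotOneThree_eq (Fact.out : p.Prime).ne_zero P.prime.ne_zero P.one_le P.one_le_exponent
    P.cast_sqrt_add_one]
  exact ⟨hC', fun hk => P.numWeights_eq_six_of_two_le hE hk hC'⟩

variable {h₁ h₂ : ℤ} (hh₁ : h₁ = quadraticChar (ZMod p) (Nat.totient (ℓ ^ k)))
  (hh₂ : h₂ = quadraticChar (ZMod p) ((ℓ : ZMod p) ^ (k - 1)))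
include hh₁ hh₂

theorem tableNotOneOneEq_and_numWeights (hp : p ≡ 1 [MOD 4]) (hsign : h₁ = h₂) :
    HasWeightDistribution C (tableNotOneOneEq p ℓ k (2 * m) ε h₁ h₂) ∧
      (2 ≤ k → numWeights C = 8) := by
  have hσ : h₂ = 1 ∨ h₂ = -1 := hh₂ ▸ quadraticChar_dichotomy (P.natCast_pow_ne_zero _)
  have hC' := hasWeightDistribution_tableEq hC hp hσ (hh₁.symm.trans hsign) hh₂.symm
  rw [hsign, tableNotOneOneEq_eq (Fact.out : p.Prime).ne_zero P.prime.ne_zero P.one_le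
    P.one_le_exponent P.cast_sqrt_add_one hσ]
  exact ⟨hC', fun hk => P.numWeights_eq_eight_of_two_le hE hk hp hσ hC'⟩

theorem tableNotOneOneNeg_and_numWeights (hp : p ≡ 1 [MOD 4]) (hsign : h₁ = -h₂) :
    HasWeightDistribution C (tableNotOneOneNeg p ℓ k (2 * m) ε h₁ h₂) ∧
      (2 ≤ k → numWeights C = 9) := by
  have hσ : h₂ = 1 ∨ h₂ = -1 := hh₂ ▸ quadraticChar_dichotomy (P.natCast_pow_ne_zero _)
  have hC' := hasWeightDistribution_generalTable hC hp (σ := h₁) (by omega) hh₁.symm (by omega)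
  refine ⟨?_, fun hk => P.numWeights_eq_nine_of_two_le hE hk hp hC'⟩
  rw [← tableNotOneOneNeg_eq (Fact.out : p.Prime).ne_zero P.prime.ne_zero P.one_le
    P.one_le_exponent P.cast_sqrt_add_one] at hC'
  obtain rfl | rfl := hσ
  · rw [hsign]
    exact hC'.of_rowSum_eq fun w => (rowSum_tableNotOneOneNeg_neg _ _ _ _ _ w).symm
  · rwa [hsign, neg_neg]

end IsParameters

end Tables

end BentCode

theorem theorem2 (p ℓ k e : ℕ) [Fact p.Prime] (hp : p ≠ 2) (hℓ : ℓ.Prime) (hℓ2 : ℓ ≠ 2)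
    (hpℓ : p ≠ ℓ) (hk : 1 ≤ k)
    (hprim : orderOf (p : ZMod (2 * ℓ ^ k)) = Nat.totient (ℓ ^ k))
    (he : e = Nat.totient (ℓ ^ k))
    {F : Type*} [Field F] [Fintype F] [Algebra (ZMod p) F] (hF : Fintype.card F = p ^ e)
    (f fs : F → ZMod p) (hf : BentCode.MemRF f) (hdual : BentCode.IsDual f fs)
    (hquad : ∀ (c : ZMod p) (x : F), fs (c • x) = c ^ 2 * fs x)
    (D : Finset (F × F)) (hD : D = BentCode.definingSet f ((p ^ e - 1) / (2 * ℓ ^ k)))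
    (h₁ h₂ : ℤ) (hh₁ : h₁ = quadraticChar (ZMod p) (Nat.totient (ℓ ^ k) : ZMod p))
    (hh₂ : h₂ = quadraticChar (ZMod p) ((ℓ : ZMod p) ^ (k - 1))) :
    ∃ ε : ℤ, (ε = 1 ∨ ε = -1) ∧
      (∀ a : F, BentCode.walsh f a =
        (ε : ℂ) * (BentCode.sqrtPStarPow p e : ℂ) * ZMod.stdAddChar (fs a)) ∧
      Module.finrank (ZMod p) (BentCode.code p D) = 2 * e ∧
      -- first case
      (ℓ ≡ 1 [MOD p] → p ≡ 1 [MOD 4] →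
        (D.card : ℚ) = BentCode.lengthOne p ℓ k e ε ∧
        BentCode.HasWeightDistribution (BentCode.code p D) (BentCode.tableOneOne p ℓ k e ε) ∧
        BentCode.numWeights (BentCode.code p D) = 8) ∧
      -- second case
      (ℓ ≡ 1 [MOD p] → p ≡ 3 [MOD 4] →
        (D.card : ℚ) = BentCode.lengthOne p ℓ k e ε ∧
        BentCode.HasWeightDistribution (BentCode.code p D) (BentCode.tableOneThree p ℓ k e ε) ∧
        BentCode.numWeights (BentCode.code p D) = 6) ∧
      -- third case; for `k = 1` some rows of the tables have frequency zero
      (¬ ℓ ≡ 1 [MOD p] → p ≡ 1 [MOD 4] →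
        (D.card : ℚ) = BentCode.lengthNotOne p ℓ k e ε ∧
        (h₁ = h₂ →
          BentCode.HasWeightDistribution (BentCode.code p D)
            (BentCode.tableNotOneOneEq p ℓ k e ε h₁ h₂) ∧
          (2 ≤ k → BentCode.numWeights (BentCode.code p D) = 8)) ∧
        (h₁ = -h₂ →
          BentCode.HasWeightDistribution (BentCode.code p D)
            (BentCode.tableNotOneOneNeg p ℓ k e ε h₁ h₂) ∧
          (2 ≤ k → BentCode.numWeights (BentCode.code p D) = 9))) ∧
      -- fourth case; for `k = 1` one row of the table has frequency zero
      (¬ ℓ ≡ 1 [MOD p] → p ≡ 3 [MOD 4] →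
        (D.card : ℚ) = BentCode.lengthNotOne p ℓ k e ε ∧
        BentCode.HasWeightDistribution (BentCode.code p D) (BentCode.tableNotOneThree p ℓ k e ε) ∧
        (2 ≤ k → BentCode.numWeights (BentCode.code p D) = 6)) := by
  classical
  obtain ⟨m, h, P⟩ := BentCode.exists_isParameters hp hℓ hℓ2 hpℓ hk hprim
  obtain rfl : e = 2 * m := he.trans P.totient_eq
  obtain ⟨ε, b, hε, hwalsh, H⟩ := P.exists_isWeightData hF hf hdual hquad
  have hmem : ∀ z, z ∈ D ↔ z ≠ 0 ∧
      f z.1 + Algebra.trace (ZMod p) F (z.2 ^ ((p ^ (2 * m) - 1) / (2 * ℓ ^ k))) = 0 := by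
    simp [hD, BentCode.definingSet]
  have hE := H.sq_eq
  have hC := H.hasWeightDistribution hmem
  refine ⟨ε, hε, hwalsh, H.finrank_code hmem, fun hℓp hp4 => ?_, fun hℓp hp4 => ?_,
    fun hℓp hp4 => ?_, fun hℓp hp4 => ?_⟩
  · exact ⟨P.card_eq_lengthOne H hmem hℓp, P.tableOneOne_and_numWeights hE hC hℓp hp4⟩
  · exact ⟨P.card_eq_lengthOne H hmem hℓp, P.tableOneThree_and_numWeights hE hC hℓp hp4⟩
  · exact ⟨P.card_eq_lengthNotOne H hmem hℓp,
      P.tableNotOneOneEq_and_numWeights hE hC hh₁ hh₂ hp4,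
      P.tableNotOneOneNeg_and_numWeights hE hC hh₁ hh₂ hp4⟩
  · exact ⟨P.card_eq_lengthNotOne H hmem hℓp, P.tableNotOneThree_and_numWeights hE hC hℓp hp4⟩
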